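/- **Setting.** Let $S\subset\mathbb Z$ be finite, $V=\mathbb Z\times S$, $\kappa,\lambda\ge 0$, let $c(\sigma,\sigma')=c(\sigma',\sigma)\ge 0$ be symmetric rates on $S$, and let $\rho\ge 0$. *Particles.* For $N\ge 1$, a run-and-tumble particle is the Markov jump process on $V$ that makes the jumps $(x,\sigma)\to(x+1,\sigma)$ and $(x,\sigma)\to(x-1,\sigma)$ at rate $\kappa N^2$ each, the jump $(x,\sigma)\to(x+\sigma,\sigma)$ at rate $\lambda N$, and the jumps $(x,\sigma)\to(x,\sigma')$ at rate $c(\sigma,\sigma')$. Let $\eta_t=\eta^N_t\in\mathbb N^V$ count the particles at each site at time $t$ in a system of independent run-and-tumble particles whose initial configuration $\eta_0$ has law $\mu_\rho=\bigotimes_{v\in V}\mathrm{Pois}(\rho)$. *Test functions and fluctuation fields.* Let $C^\infty_{c,S}$ be the space of $\phi:\mathbb R\times S\to\mathbb R$ with $\phi(\cdot,\sigma)\in C_c^\infty(\mathbb R)$ for all $\sigma\in S$, and put $\langle\langle\phi,\psi\rangle\rangle=\sum_{\sigma\in S}\int_{\mathbb R}\phi(x,\sigma)\psi(x,\sigma)\,dx$.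 For $\phi\in C^\infty_{c,S}$ let $$Y^N_t(\phi)=\frac1{\sqrt N}\sum_{(x,\sigma)\in V}\big(\eta_t(x,\sigma)-\rho\big)\,\phi\big(\tfrac xN,\sigma\big).$$ *Limiting operator.* For $\phi\in C_{c,S}^\infty$ let $$A\phi(x,\sigma)=\big(\kappa\,\partial_{xx}+\sigma\lambda\,\partial_x\big)\phi(x,\sigma)+\sum_{\sigma'\in S}c(\sigma,\sigma')\big(\phi(x,\sigma')-\phi(x,\sigma)\big),$$ $$\Sigma\phi(x,\sigma)=-\sum_{\sigma'\in S}c(\sigma,\sigma')\big(\phi(x,\sigma')-\phi(x,\sigma)\big).$$ Let $C_{0,S}$ be the Banach space of $f:\mathbb R\times S\to\mathbb R$ with $f(\cdot,\sigma)\in C_0(\mathbb R)$ for all $\sigma$, with the supremum norm. *Limiting SPDE.* A process $Y=(Y_t)_{t\ge0}$ of distributions on $\mathbb R\times S$, with $t\mapsto Y_t(\phi)$ càdlàg for every $\phi\in C^\infty_{c,S}$, is a solution of $$dY_t=A^*Y_t\,dt+\sqrt{2\kappa\rho}\,\partial_x\,d\mathscr W_t+\sqrt{2\rho\Sigma}\,d\tilde{\mathscr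 W}_t$$ if for every $\phi\in C^\infty_{c,S}$ the processes $$\mathscr M^\phi_t=Y_t(\phi)-Y_0(\phi)-\int_0^tY_s(A\phi)\,ds,\qquad (\mathscr M^\phi_t)^2-2t\kappa\rho\langle\langle\partial_x\phi,\partial_x\phi\rangle\rangle-2t\rho\langle\langle\phi,\Sigma\phi\rangle\rangle$$ are martingales with respect to the natural filtration of $Y$. **Proposition.** There is exactly one strongly continuous semigroup of positive contractions on $C_{0,S}$ whose generator is defined on $C^\infty_{c,S}$ and equals $A$ there; denote it by $(e^{tA})_{t\ge0}$. For all $t\ge 0$ and $\phi,\psi\in C_{c,S}^\infty$: 1. $Y^N_t(\phi)Y^N_0(\psi)$ is integrable for every $N\ge 1$, and $$\lim_{N\to\infty}\mathbb E\big[Y^N_t(\phi)\,Y^N_0(\psi)\big]=\rho\,\langle\langle e^{tA}\phi,\psi\rangle\rangle .$$ 2. If $Y$ is a stationary solution of the SPDE such that, for every $\chi\in C^\infty_{c,S}$, the law of $Y_0(\chi)$ is the limit, as $N\to\infty$, of the law of $Y^N_0(\chi)$, then $Y_t(\phi)Y_0(\psi)$ is integrable and $$\mathbb E\big[Y_t(\phi)\,Y_0(\psi)\big]=\rho\,\langle\langle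 e^{tA}\phi,\psi\rangle\rangle .$$ In particular, the limit in 1 equals the covariance $\mathbb E[Y_t(\phi)Y_0(\psi)]$ of every such solution. -/

import Mathlib

open MeasureTheory ProbabilityTheory Filter Topology
open scoped NNReal Distributions ZeroAtInfty

noncomputable section

namespace RunAndTumble

/-! ### State space, rates, test functions -/

/-- The single-particle state space `V = ℤ × S`: position and internal state. -/
abbrev Site (S : Finset ℤ) : Type := ℤ × S

/-- The rates of a run-and-tumble particle: `κ` (diffusive jumps), `lam` (active jumps) and the
symmetric flip rates `c`. -/
structure Rates (S : Finset ℤ) where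
  κ : ℝ≥0
  lam : ℝ≥0
  c : S → S → ℝ≥0
  symm : ∀ σ τ, c σ τ = c τ σ

/-- The space of test functions on `ℝ × S`: families, indexed by the finite set `S`, of smooth
compactly supported functions on `ℝ`, with its usual (LF) topology. -/
abbrev TestFn (S : Finset ℤ) : Type := S → 𝓓((⊤ : TopologicalSpace.Opens ℝ), ℝ)

/-- Distributions on `ℝ × S`. -/
abbrev Distr (S : Finset ℤ) : Type := TestFn S →L[ℝ] ℝ

/-- The Banach space `C_{0,S}` of functions on `ℝ × S` that are continuous and vanish at infinity
in the first variable, with the supremum norm. -/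
abbrev CZero (S : Finset ℤ) : Type := S → C₀(ℝ, ℝ)

/-- A test function as an element of `C_{0,S}`. -/
def TestFn.toCZero {S : Finset ℤ} (φ : TestFn S) : CZero S := fun σ =>
  { toFun := fun x => φ σ x
    continuous_toFun := (φ σ).continuous
    zero_at_infty' := (φ σ).hasCompactSupport.is_zero_at_infty }

/-- The spatial derivative of a test function on `ℝ`. -/
def ddx (f : 𝓓((⊤ : TopologicalSpace.Opens ℝ), ℝ)) : 𝓓((⊤ : TopologicalSpace.Opens ℝ), ℝ) :=
  LineDeriv.lineDerivOp (1 : ℝ) f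

theorem ddx_apply (f : 𝓓((⊤ : TopologicalSpace.Opens ℝ), ℝ)) (x : ℝ) :
    ddx f x = deriv (fun y => f y) x := by
  unfold ddx
  rw [TestFunction.lineDerivOp_eq_lineDerivCLM (𝕜 := ℝ), TestFunction.lineDerivCLM_apply]
  simp [lineDeriv, deriv_comp_const_add (fun y => f y) x]

/-- The inner product `⟨⟨f, g⟩⟩ = ∑ σ, ∫ f(x,σ) g(x,σ) dx`. -/
def pairing {S : Finset ℤ} (f g : S → ℝ → ℝ) : ℝ := ∑ σ, ∫ x, f σ x * g σ x

variable {S : Finset ℤ}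

/-- The flip operator `Σ`, `(Σ φ)(x,σ) = - ∑ σ', c(σ,σ') (φ(x,σ') - φ(x,σ))`. -/
def Rates.flip (R : Rates S) (φ : TestFn S) : TestFn S := fun σ =>
  -∑ τ, (R.c σ τ : ℝ) • (φ τ - φ σ)

/-- The limiting operator
`A φ(x,σ) = (κ ∂_xx + σ lam ∂_x) φ(x,σ) + ∑ σ', c(σ,σ') (φ(x,σ') - φ(x,σ))`. -/
def Rates.A (R : Rates S) (φ : TestFn S) : TestFn S := fun σ =>
  (R.κ : ℝ) • ddx (ddx (φ σ)) + (((σ : ℤ) : ℝ) * (R.lam : ℝ)) • ddx (φ σ)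
    + ∑ τ, (R.c σ τ : ℝ) • (φ τ - φ σ)

/-! ### The semigroup `e^{tA}` -/

/-- `T` is a Markov (Feller) semigroup on `C_{0,S}`, that is, a strongly continuous semigroup of
positive contractions, whose infinitesimal generator is defined on the test functions and equals
`A` there. -/
structure Rates.IsSemigroupOfA (R : Rates S) (T : ℝ≥0 → CZero S →L[ℝ] CZero S) : Prop where
  zero : ∀ f, T 0 f = f
  add : ∀ s t f, T (s + t) f = T s (T t f)
  strong_cont : ∀ f, Tendsto (fun t => T t f) (𝓝 0) (𝓝 f)
  contraction : ∀ t f, ‖T t f‖ ≤ ‖f‖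
  nonneg : ∀ t f, (∀ σ x, 0 ≤ f σ x) → ∀ σ x, 0 ≤ T t f σ x
  generator : ∀ φ : TestFn S,
    Tendsto (fun t : ℝ≥0 => (t : ℝ)⁻¹ • (T t φ.toCZero - φ.toCZero)) (𝓝[>] 0)
      (𝓝 (R.A φ).toCZero)

open Classical in
/-- `e^{tA}`: the unique Markov semigroup on `C_{0,S}` generated by `A`. The value in the absence
of existence or uniqueness is never used. -/
def Rates.expA (R : Rates S) : ℝ≥0 → CZero S →L[ℝ] CZero S :=
  if h : ∃! T, R.IsSemigroupOfA T then h.choose else fun _ => 0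

/-! ### Paths and filtrations -/

/-- Right-continuous with left limits. -/
def IsCadlag {β : Type*} [TopologicalSpace β] (x : ℝ≥0 → β) : Prop :=
  ∀ t, ContinuousWithinAt x (Set.Ici t) t ∧ ∃ l, Tendsto x (𝓝[<] t) (𝓝 l)

/-- The natural filtration `F_t = σ(X_s : s ≤ t)` of a process with values in an arbitrary
measurable space. -/
def naturalFiltration {Ω β : Type*} {m : MeasurableSpace Ω} [mβ : MeasurableSpace β]
    (X : ℝ≥0 → Ω → β) (hX : ∀ t, Measurable (X t)) : Filtration ℝ≥0 m where
  seq t := ⨆ s ≤ t, mβ.comap (X s)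
  mono' _ _ hst := biSup_mono fun _ hr => hr.trans hst
  le' _ := iSup₂_le fun s _ => (hX s).comap_le

/-! ### The particle system -/

/-- The generator of the position and internal state `(X_t, σ_t)` of one run-and-tumble particle
at scaling parameter `N`. -/
def Rates.siteGenerator (R : Rates S) (N : ℕ) (f : Site S → ℝ) (v : Site S) : ℝ :=
  (R.κ : ℝ) * (N : ℝ) ^ 2 * (f (v.1 + 1, v.2) + f (v.1 - 1, v.2) - 2 * f v)
    + (R.lam : ℝ) * (N : ℝ) * (f (v.1 + (v.2 : ℤ), v.2) - f v)
    + ∑ τ, (R.c v.2 τ : ℝ) * (f (v.1, τ) - f v)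

/-- `X` is a run-and-tumble particle started from `v`: a càdlàg process on `ℤ × S` that solves the
martingale problem for the (bounded) generator. -/
structure Rates.IsParticle (R : Rates S) (N : ℕ) {Ω : Type*} [MeasurableSpace Ω] (P : Measure Ω)
    (v : Site S) (X : ℝ≥0 → Ω → Site S) : Prop where
  measurable : ∀ t, Measurable (X t)
  cadlag : ∀ ω, IsCadlag fun t => X t ω
  start : ∀ᵐ ω ∂P, X 0 ω = v
  martingale : ∀ f : Site S → ℝ, (∃ C, ∀ w, |f w| ≤ C) →
    Martingale (fun (t : ℝ≥0) ω => f (X t ω) - f (X 0 ω)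
        - ∫ s in (0 : ℝ)..t, R.siteGenerator N f (X s.toNNReal ω))
      (naturalFiltration X measurable) P

/-- The product Poisson measure `μ_ρ` on configurations `ℕ^V`. -/
def poissonProduct (S : Finset ℤ) (ρ : ℝ≥0) : Measure (Site S → ℕ) :=
  Measure.infinitePi fun _ => poissonMeasure ρ

instance (S : Finset ℤ) (ρ : ℝ≥0) : IsProbabilityMeasure (poissonProduct S ρ) := by
  unfold poissonProduct; infer_instance

/-- `η` is the run-and-tumble particle process at scaling parameter `N`, started from `μ_ρ`:
`η_0` has law `μ_ρ`; the particles are labelled by `(v, i)` with `i < η_0(v)`; the particle `(v, i)`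
follows the trajectory `X v i` of a run-and-tumble particle started from `v`; the trajectories are
independent of each other and of `η_0`; and `η_t(w)` is the number of particles that are at `w` at
time `t` (the equality in `ℕ∞` says in particular that this number is almost surely finite). -/
structure Rates.IsSystem (R : Rates S) (N : ℕ) (ρ : ℝ≥0) {Ω : Type*} [MeasurableSpace Ω]
    (P : Measure Ω) (η : ℝ≥0 → Ω → Site S → ℕ) : Prop where
  measurable : ∀ t, Measurable (η t)
  initial : P.map (η 0) = poissonProduct S ρ
  particles : ∃ X : Site S → ℕ → ℝ≥0 → Ω → Site S,
    (∀ v i, R.IsParticle N P v (X v i)) ∧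
    iIndepFun (fun (p : Site S × ℕ) ω (t : ℝ≥0) => X p.1 p.2 t ω) P ∧
    IndepFun (η 0) (fun ω (p : Site S × ℕ) (t : ℝ≥0) => X p.1 p.2 t ω) P ∧
    ∀ t, ∀ᵐ ω ∂P, ∀ w,
      (η t ω w : ℕ∞) = Set.encard {p : Site S × ℕ | p.2 < η 0 ω p.1 ∧ X p.1 p.2 t ω = w}

/-- The fluctuation field of a configuration, tested against `φ`:
`N^{-1/2} ∑_{(x,σ)} (η(x,σ) - ρ) φ(x/N, σ)` (for `N ≥ 1` the sum has finitely many nonzero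
terms). -/
def fluctuation (N : ℕ) (ρ : ℝ≥0) (η : Site S → ℕ) (φ : TestFn S) : ℝ :=
  (√(N : ℝ))⁻¹ * ∑' v : Site S, ((η v : ℝ) - (ρ : ℝ)) * φ v.2 ((v.1 : ℝ) / (N : ℝ))

/-! ### The limiting SPDE -/

/-- The process `M^φ_t(Y) = Y_t(φ) - Y_0(φ) - ∫_0^t Y_s(A φ) ds`. -/
def Rates.driftPart (R : Rates S) {Ω : Type*} (Y : ℝ≥0 → Ω → Distr S) (φ : TestFn S)
    (t : ℝ≥0) (ω : Ω) : ℝ :=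
  Y t ω φ - Y 0 ω φ - ∫ s in (0 : ℝ)..t, Y s.toNNReal ω (R.A φ)

/-- The distribution-valued process `Y` with càdlàg paths solves
`dY = A^* Y dt + √(2κρ) ∂_x dW + √(2ρΣ) dW̃`, in the sense of the martingale problem: `M^φ(Y)` and
`M^φ(Y)² - 2tκρ ⟨⟨∂_x φ, ∂_x φ⟩⟩ - 2tρ ⟨⟨φ, Σφ⟩⟩` are martingales with respect to the natural
filtration of `Y`, for every test function `φ`. -/
structure Rates.SolvesSPDE (R : Rates S) (ρ : ℝ≥0) {Ω : Type*} [MeasurableSpace Ω]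
    (P : Measure Ω) (Y : ℝ≥0 → Ω → Distr S) : Prop where
  measurable : ∀ t, Measurable fun ω (φ : TestFn S) => Y t ω φ
  cadlag : ∀ ω φ, IsCadlag fun t => Y t ω φ
  martingale_drift : ∀ φ : TestFn S,
    Martingale (R.driftPart Y φ)
      (naturalFiltration (fun t ω (φ : TestFn S) => Y t ω φ) measurable) P
  martingale_noise : ∀ φ : TestFn S,
    Martingale (fun (t : ℝ≥0) ω => R.driftPart Y φ t ω ^ 2
        - 2 * t * R.κ * ρ * pairing (fun σ x => ddx (φ σ) x) (fun σ x => ddx (φ σ) x)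
        - 2 * t * ρ * pairing (fun σ x => φ σ x) (fun σ x => R.flip φ σ x))
      (naturalFiltration (fun t ω (φ : TestFn S) => Y t ω φ) measurable) P

/-- Stationarity: for every `h ≥ 0` the time-shifted process `(Y_{t+h})_t` has the same law
(finite-dimensional distributions) as `(Y_t)_t`. -/
def IsStationary {Ω : Type*} [MeasurableSpace Ω] (P : Measure Ω) (Y : ℝ≥0 → Ω → Distr S) : Prop :=
  ∀ h : ℝ≥0, IdentDistrib (fun ω (p : ℝ≥0 × TestFn S) => Y (p.1 + h) ω p.2)
    (fun ω (p : ℝ≥0 × TestFn S) => Y p.1 ω p.2) P P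

/-- The law of `Y_0` is the limit, as `N → ∞`, of the law of the fluctuation field of a
configuration sampled from `μ_ρ`. -/
def IsInitialLimit (ρ : ℝ≥0) {Ω : Type*} [MeasurableSpace Ω] (P : Measure Ω)
    [IsProbabilityMeasure P] (Y : ℝ≥0 → Ω → Distr S) : Prop :=
  ∀ φ : TestFn S,
    TendstoInDistribution (fun (N : ℕ) (η : Site S → ℕ) => fluctuation N ρ η φ) atTop
      (fun ω => Y 0 ω φ) (fun _ => poissonProduct S ρ) P

end RunAndTumble

end

open RunAndTumble

/-! Both covariances are governed by the same linear evolution. Let `discA n` be the generator of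
the rescaled particle, acting on test functions on the continuum. On the particle side, the
time-zero occupation numbers are independent with variance equal to their mean `ρ`, and the
trajectories are independent of them. Hence `E[Y^N_t(φ) Y^N_0(ψ)] = (ρ/N) ∑_v ψ(v/N) E_v φ(X_t/N)`.
This is a Riemann sum as soon as `E_v φ(X_t/N)` is uniformly close to `e^{tA} φ(v/N)`. On the SPDE
side, multiplying the drift martingale by `Y_0(ψ)` gives `d/dt E[Y_t(φ) Y_0(ψ)] = E[Y_t(Aφ)
Y_0(ψ)]`. Its initial value is `ρ⟨⟨φ,ψ⟩⟩`, because the centered Poisson field converges to white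
noise of intensity `ρ`.

Solving these equations by inserting `e^{tA} φ` fails, because that function is in general not a
test function. It is replaced by the explicit Euler iterates `(1 + h discA n)^m φ`, which are finite
combinations of translates of the components of `φ` and so remain test functions. If `h` times the
total jump rate is at most 1, all their coefficients are nonnegative. The weight `wt = 1/(1+x²)`
satisfies `discA n wt ≤ C wt` with `C` independent of `n`, so bounds `|φ| ≤ M wt` grow at most like
`e^{Ct}` (`WB.euler`). Since `discA n` commutes with the spatial derivative, derivatives obey the
same bounds. Taylor expansion gives `discA n - A = O(1/n)` in the weighted norm
(`DB.wb_discA_sub_A`).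

Together these yield the central estimate `Evolution.norm_sub_eulerApprox_le`: if `dF_t(ψ) = F_t(Gψ)
dt`, with `F_t` bounded in the weighted norm and `G` close to `A`, then `F_t(φ)` is close to `F_0`
of the Euler approximation. It is applied to semigroups generated by `A` (uniqueness), to the
uniformized semigroups of `discA n` (Cauchy property, hence existence), to the one-particle
expectations, and to the covariance of the SPDE. -/

noncomputable section

namespace RunAndTumble

variable {S : Finset ℤ}

/-! ### A weight that is almost invariant under the discretized generators -/

/-- The weight `1 / (1 + x²)`. -/
def wt (x : ℝ) : ℝ := (1 + x ^ 2)⁻¹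

theorem wt_pos (x : ℝ) : 0 < wt x := by unfold wt; positivity

theorem wt_le_one (x : ℝ) : wt x ≤ 1 := inv_le_one_of_one_le₀ (by nlinarith [sq_nonneg x])

theorem wt_sub (x a : ℝ) : wt (x + a) - wt x = -(a * (2 * x + a)) * (wt x * wt (x + a)) := by
  unfold wt
  have h1 : 1 + x ^ 2 ≠ 0 := by positivity
  have h2 : 1 + (x + a) ^ 2 ≠ 0 := by positivity
  field_simp
  ring

/-- Since `|2y| ≤ 1 + y²`, one factor of the weight absorbs the linear growth; the relative
increments of `wt` are then bounded uniformly in `x`. -/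
theorem abs_two_mul_add_mul_wt_le (x a : ℝ) : |2 * x + a| * wt (x + a) ≤ 1 + |a| := by
  have h0 := wt_pos (x + a)
  have h1 := wt_le_one (x + a)
  have h2 : |2 * (x + a)| * wt (x + a) ≤ 1 := by
    unfold wt
    rw [← div_eq_mul_inv, div_le_one (by positivity)]
    rw [abs_le]
    constructor <;> nlinarith [sq_nonneg (x + a - 1), sq_nonneg (x + a + 1)]
  have h3 : |2 * x + a| ≤ |2 * (x + a)| + |a| := by
    have : 2 * x + a = 2 * (x + a) - a := by ring
    rw [this]; exact abs_sub _ _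
  nlinarith [abs_nonneg a, mul_le_mul_of_nonneg_right h3 h0.le]

theorem abs_wt_sub_le (x a : ℝ) : |wt (x + a) - wt x| ≤ |a| * (1 + |a|) * wt x := by
  rw [wt_sub, abs_mul, abs_neg, abs_mul, abs_of_pos (mul_pos (wt_pos _) (wt_pos _))]
  have := mul_le_mul_of_nonneg_left (abs_two_mul_add_mul_wt_le x a)
    (mul_nonneg (abs_nonneg a) (wt_pos x).le)
  nlinarith

theorem wt_add_le {b : ℝ} (x : ℝ) {u : ℝ} (hu : |u| ≤ b) : wt (x + u) ≤ (1 + b) ^ 2 * wt x := by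
  have h1 := (abs_le.mp (abs_wt_sub_le x u)).2
  have h2 := wt_pos x
  have h3 : |u| * (1 + |u|) ≤ b * (1 + b) := by
    have := abs_nonneg u
    nlinarith
  have h4 : 0 ≤ b := (abs_nonneg u).trans hu
  nlinarith [mul_le_mul_of_nonneg_right h3 h2.le, mul_nonneg h4 h2.le]

/-- For `a = 1/n` the factor `a²` cancels the diffusive rate `n²`. An upper bound suffices because
it will be multiplied by nonnegative coefficients only. -/
theorem wt_second_difference_le (x a : ℝ) :
    wt (x + a) + wt (x - a) - 2 * wt x ≤ 8 * a ^ 2 * wt x := by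
  unfold wt
  have h1 : 0 < 1 + x ^ 2 := by positivity
  have h2 : 0 < 1 + (x + a) ^ 2 := by positivity
  have h3 : 0 < 1 + (x - a) ^ 2 := by positivity
  rw [← sub_nonneg]
  have : 8 * a ^ 2 * (1 + x ^ 2)⁻¹ -
      ((1 + (x + a) ^ 2)⁻¹ + (1 + (x - a) ^ 2)⁻¹ - 2 * (1 + x ^ 2)⁻¹) =
      a ^ 2 * (8 * ((1 + (x + a) ^ 2) * (1 + (x - a) ^ 2)) + 2 * (1 + x ^ 2 + a ^ 2) - 8 * x ^ 2)
      / ((1 + x ^ 2) * (1 + (x + a) ^ 2) * (1 + (x - a) ^ 2)) := by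
    field_simp
    ring
  rw [this]
  apply div_nonneg _ (by positivity)
  apply mul_nonneg (sq_nonneg a)
  -- The product of the two shifted factors equals `1 + 2x² + 2a² + (x² - a²)²`, so eight times it
  -- dominates `8x²`.
  nlinarith [sq_nonneg (x ^ 2 - a ^ 2), sq_nonneg x, sq_nonneg a]

/-! ### Taylor estimates -/

theorem abs_le_of_hasDerivAt {r r' : ℝ → ℝ} {a B : ℝ} (hr : ∀ u, HasDerivAt r (r' u) u)
    (h0 : r 0 = 0) (hB : ∀ u, |u| ≤ |a| → |r' u| ≤ B) : |r a| ≤ B * |a| := by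
  have := Convex.norm_image_sub_le_of_norm_hasDerivWithin_le (f := r) (f' := r')
    (s := Set.uIcc 0 a) (x := 0) (y := a) (C := B) (fun u _ => (hr u).hasDerivWithinAt)
    (fun u hu => hB u (by
      have := Set.abs_sub_left_of_mem_uIcc hu
      simpa using this)) (convex_uIcc 0 a) Set.left_mem_uIcc Set.right_mem_uIcc
  simpa [h0] using this

/-- The mean value inequality is used twice; `wt_add_le` moves the weight from the intermediate
points back to `x`, at the price of `(1 + b)²`. -/
theorem abs_taylor_one_le {f f' f'' : ℝ → ℝ} (h1 : ∀ x, HasDerivAt f (f' x) x)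
    (h2 : ∀ x, HasDerivAt f' (f'' x) x) {M b : ℝ} (hM : ∀ x, |f'' x| ≤ M * wt x)
    (x : ℝ) {a : ℝ} (ha : |a| ≤ b) :
    |f (x + a) - f x - a * f' x| ≤ M * ((1 + b) ^ 2 * wt x) * |a| ^ 2 := by
  have hM0 : 0 ≤ M := by
    have := (abs_nonneg _).trans (hM 0)
    exact nonneg_of_mul_nonneg_left this (wt_pos 0)
  have key : ∀ u, |u| ≤ |a| → |f' (x + u) - f' x| ≤ M * ((1 + b) ^ 2 * wt x) * |a| := by
    intro u hu
    refine (abs_le_of_hasDerivAt (r := fun u => f' (x + u) - f' x) (r' := fun u => f'' (x + u))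
      (fun u => ((h2 (x + u)).comp_const_add x u).sub_const _) (by simp)
      (B := M * ((1 + b) ^ 2 * wt x)) (fun v hv => (hM _).trans ?_)).trans ?_
    · exact mul_le_mul_of_nonneg_left (wt_add_le x ((hv.trans hu).trans ha)) hM0
    · exact mul_le_mul_of_nonneg_left hu (mul_nonneg hM0 (mul_nonneg (sq_nonneg _) (wt_pos x).le))
  have := abs_le_of_hasDerivAt (r := fun u => f (x + u) - f x - u * f' x)
    (r' := fun u => f' (x + u) - f' x) (a := a)
    (fun u => (((h1 (x + u)).comp_const_add x u).sub_const _).sub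
      (by simpa using (hasDerivAt_id u).mul_const (f' x))) (by simp) key
  simpa [pow_two, mul_assoc] using this

/-- The remainder is differentiated twice in the step size `u`, which leaves the second difference
of `f''`. Each mean value bound on the way back contributes one factor `|a|`. The constant 2 is not
sharp, but only the order matters. -/
theorem abs_taylor_two_le {f f' f'' f''' : ℝ → ℝ} (h1 : ∀ x, HasDerivAt f (f' x) x)
    (h2 : ∀ x, HasDerivAt f' (f'' x) x) (h3 : ∀ x, HasDerivAt f'' (f''' x) x) {M b : ℝ}
    (hM : ∀ x, |f''' x| ≤ M * wt x) (x : ℝ) {a : ℝ} (ha : |a| ≤ b) :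
    |f (x + a) + f (x - a) - 2 * f x - a ^ 2 * f'' x|
      ≤ 2 * M * ((1 + b) ^ 2 * wt x) * |a| ^ 3 := by
  have hM0 : 0 ≤ M := by
    have := (abs_nonneg _).trans (hM 0)
    exact nonneg_of_mul_nonneg_left this (wt_pos 0)
  have hsub : ∀ {g g' : ℝ → ℝ}, (∀ x, HasDerivAt g (g' x) x) →
      ∀ u, HasDerivAt (fun u => g (x - u)) (-g' (x - u)) u := by
    intro g g' hg u
    simpa using (hg (x - u)).comp_const_sub x u
  have hK : 0 ≤ M * ((1 + b) ^ 2 * wt x) := mul_nonneg hM0 (mul_nonneg (sq_nonneg _) (wt_pos x).le)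
  have k0 : ∀ u, |u| ≤ |a| → |f'' (x + u) - f'' x| ≤ M * ((1 + b) ^ 2 * wt x) * |a| := by
    intro u hu
    refine (abs_le_of_hasDerivAt (r := fun u => f'' (x + u) - f'' x) (r' := fun u => f''' (x + u))
      (fun u => ((h3 (x + u)).comp_const_add x u).sub_const _) (by simp)
      (B := M * ((1 + b) ^ 2 * wt x)) (fun v hv => (hM _).trans ?_)).trans ?_
    · exact mul_le_mul_of_nonneg_left (wt_add_le x ((hv.trans hu).trans ha)) hM0
    · exact mul_le_mul_of_nonneg_left hu hK
  have k1 : ∀ u, |u| ≤ |a| → |f'' (x + u) + f'' (x - u) - 2 * f'' x|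
      ≤ 2 * (M * ((1 + b) ^ 2 * wt x) * |a|) := by
    intro u hu
    have e1 := k0 u hu
    have e2 := k0 (-u) (by simpa using hu)
    rw [← sub_eq_add_neg] at e2
    rw [abs_le] at *
    constructor <;> linarith [e1.1, e1.2, e2.1, e2.2]
  have k2 : ∀ u, |u| ≤ |a| → |f' (x + u) - f' (x - u) - 2 * u * f'' x|
      ≤ 2 * (M * ((1 + b) ^ 2 * wt x) * |a|) * |a| := by
    intro u hu
    refine (abs_le_of_hasDerivAt (r := fun u => f' (x + u) - f' (x - u) - 2 * u * f'' x)
      (r' := fun u => f'' (x + u) + f'' (x - u) - 2 * f'' x) (fun u => ?_) (by simp)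
      (fun v hv => k1 v (hv.trans hu))).trans ?_
    · have := (((h2 (x + u)).comp_const_add x u).sub (hsub h2 u)).sub
        (((hasDerivAt_id u).const_mul 2).mul_const (f'' x))
      exact this.congr_deriv (by ring)
    · exact mul_le_mul_of_nonneg_left hu (by positivity)
  have := abs_le_of_hasDerivAt (r := fun u => f (x + u) + f (x - u) - 2 * f x - u ^ 2 * f'' x)
    (r' := fun u => f' (x + u) - f' (x - u) - 2 * u * f'' x) (a := a) (fun u => by
      have := ((((h1 (x + u)).comp_const_add x u).add (hsub h1 u)).sub_const (2 * f x)).sub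
        (((hasDerivAt_id u).pow 2).mul_const (f'' x))
      exact this.congr_deriv (by simp; ring)) (by simp; ring) k2
  calc _ ≤ _ := this
    _ = _ := by ring

/-! ### Test functions: translations and the discretized generators -/

/-- The translate `x ↦ f (x + a)` of a test function. -/
def translate (a : ℝ) (f : 𝓓((⊤ : TopologicalSpace.Opens ℝ), ℝ)) :
    𝓓((⊤ : TopologicalSpace.Opens ℝ), ℝ) where
  toFun x := f (x + a)
  contDiff' := f.contDiff.comp (contDiff_id.add contDiff_const)
  hasCompactSupport' := f.hasCompactSupport.comp_homeomorph (Homeomorph.addRight a)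
  tsupport_subset' := by simp

@[simp]
theorem translate_apply (a : ℝ) (f : 𝓓((⊤ : TopologicalSpace.Opens ℝ), ℝ)) (x : ℝ) :
    translate a f x = f (x + a) := rfl

theorem hasDerivAt_testFunction (f : 𝓓((⊤ : TopologicalSpace.Opens ℝ), ℝ)) (x : ℝ) :
    HasDerivAt f (ddx f x) x := by
  rw [ddx_apply]
  exact (f.contDiff.differentiable (by simp) x).hasDerivAt

theorem ddx_eq_of_hasDerivAt {f g : 𝓓((⊤ : TopologicalSpace.Opens ℝ), ℝ)}
    (h : ∀ x, HasDerivAt f (g x) x) : ddx f = g := by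
  ext x
  exact (hasDerivAt_testFunction f x).unique (h x)

theorem ddx_add (f g : 𝓓((⊤ : TopologicalSpace.Opens ℝ), ℝ)) : ddx (f + g) = ddx f + ddx g :=
  LineDeriv.lineDerivOp_add _ _ _

theorem ddx_smul (c : ℝ) (f : 𝓓((⊤ : TopologicalSpace.Opens ℝ), ℝ)) : ddx (c • f) = c • ddx f :=
  LineDeriv.lineDerivOp_smul _ _ _

theorem ddx_sub (f g : 𝓓((⊤ : TopologicalSpace.Opens ℝ), ℝ)) : ddx (f - g) = ddx f - ddx g := by
  rw [sub_eq_add_neg, ← neg_one_smul ℝ g, ddx_add, ddx_smul, neg_one_smul, ← sub_eq_add_neg]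

theorem ddx_sum {ι : Type*} (s : Finset ι) (f : ι → 𝓓((⊤ : TopologicalSpace.Opens ℝ), ℝ)) :
    ddx (∑ i ∈ s, f i) = ∑ i ∈ s, ddx (f i) :=
  LineDeriv.lineDerivOp_sum _ _ _

theorem ddx_translate (a : ℝ) (f : 𝓓((⊤ : TopologicalSpace.Opens ℝ), ℝ)) :
    ddx (translate a f) = translate a (ddx f) :=
  ddx_eq_of_hasDerivAt fun x => (hasDerivAt_testFunction f (x + a)).comp_add_const x a

/-- The spatial derivative, applied in every internal state. -/
def TestFn.deriv (φ : TestFn S) : TestFn S := fun σ => ddx (φ σ)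

/-- The generator of the rescaled particle, acting on test functions on `ℝ × S`. -/
def Rates.discA (R : Rates S) (n : ℕ) (φ : TestFn S) : TestFn S := fun σ =>
  ((R.κ : ℝ) * (n : ℝ) ^ 2) •
      (translate (1 / (n : ℝ)) (φ σ) + translate (-(1 / (n : ℝ))) (φ σ) - (2 : ℝ) • φ σ)
    + ((R.lam : ℝ) * (n : ℝ)) • (translate (((σ : ℤ) : ℝ) / (n : ℝ)) (φ σ) - φ σ)
    + ∑ τ, (R.c σ τ : ℝ) • (φ τ - φ σ)

theorem Rates.discA_apply (R : Rates S) (n : ℕ) (φ : TestFn S) (σ : S) (x : ℝ) :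
    R.discA n φ σ x = (R.κ : ℝ) * (n : ℝ) ^ 2 *
        (φ σ (x + 1 / (n : ℝ)) + φ σ (x - 1 / (n : ℝ)) - 2 * φ σ x)
      + (R.lam : ℝ) * (n : ℝ) * (φ σ (x + ((σ : ℤ) : ℝ) / (n : ℝ)) - φ σ x)
      + ∑ τ, (R.c σ τ : ℝ) * (φ τ x - φ σ x) := by
  simp only [discA, add_apply, smul_apply, translate_apply,
    sum_apply, smul_eq_mul, neg_apply, sub_eq_add_neg]

theorem Rates.A_apply (R : Rates S) (φ : TestFn S) (σ : S) (x : ℝ) :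
    R.A φ σ x = (R.κ : ℝ) * φ.deriv.deriv σ x + ((σ : ℤ) : ℝ) * (R.lam : ℝ) * φ.deriv σ x
      + ∑ τ, (R.c σ τ : ℝ) * (φ τ x - φ σ x) := by
  simp [A, TestFn.deriv]

/-- One step of the explicit Euler scheme for the discretized generator. -/
def Rates.euler (R : Rates S) (n : ℕ) (h : ℝ) (φ : TestFn S) : TestFn S := φ + h • R.discA n φ

/-- The coefficients do not depend on `x`. This and the analogue for `discA` let every weighted
bound pass to derivatives of all orders. -/
theorem Rates.deriv_A (R : Rates S) (φ : TestFn S) : (R.A φ).deriv = R.A φ.deriv := by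
  funext σ
  simp only [TestFn.deriv, A, ddx_add, ddx_smul, ddx_sum, ddx_sub]

theorem Rates.deriv_discA (R : Rates S) (n : ℕ) (φ : TestFn S) :
    (R.discA n φ).deriv = R.discA n φ.deriv := by
  funext σ
  simp only [TestFn.deriv, discA, ddx_add, ddx_smul, ddx_sum, ddx_sub, ddx_translate]

theorem TestFn.deriv_add (φ ψ : TestFn S) : (φ + ψ).deriv = φ.deriv + ψ.deriv :=
  funext fun _ => ddx_add _ _

theorem TestFn.deriv_sub (φ ψ : TestFn S) : (φ - ψ).deriv = φ.deriv - ψ.deriv :=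
  funext fun _ => ddx_sub _ _

theorem TestFn.deriv_smul (c : ℝ) (φ : TestFn S) : (c • φ).deriv = c • φ.deriv :=
  funext fun _ => ddx_smul _ _

theorem Rates.deriv_euler (R : Rates S) (n : ℕ) (h : ℝ) (φ : TestFn S) :
    (R.euler n h φ).deriv = R.euler n h φ.deriv := by
  rw [euler, TestFn.deriv_add, TestFn.deriv_smul, deriv_discA, euler]

/-! ### Weighted bounds on test functions -/

/-- `|φ| ≤ M wt`. -/
def WB (M : ℝ) (φ : TestFn S) : Prop := ∀ σ x, |φ σ x| ≤ M * wt x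

/-- The derivatives of `φ` of order at most `k` are bounded by `M wt`. -/
def DB (k : ℕ) (M : ℝ) (φ : TestFn S) : Prop := ∀ j ≤ k, WB M (TestFn.deriv^[j] φ)

theorem WB.mono {M M' : ℝ} {φ : TestFn S} (h : WB M φ) (hM : M ≤ M') : WB M' φ := fun σ x =>
  (h σ x).trans (mul_le_mul_of_nonneg_right hM (wt_pos x).le)

theorem WB.abs_le {M : ℝ} {φ : TestFn S} (h : WB M φ) (hM : 0 ≤ M) (σ : S) (x : ℝ) :
    |φ σ x| ≤ M :=
  (h σ x).trans (mul_le_of_le_one_right hM (wt_le_one x))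

theorem WB.add {M M' : ℝ} {φ ψ : TestFn S} (h : WB M φ) (h' : WB M' ψ) :
    WB (M + M') (φ + ψ) := fun σ x => by
  rw [add_mul]
  exact (abs_add_le _ _).trans (add_le_add (h σ x) (h' σ x))

theorem DB.mono {k : ℕ} {M M' : ℝ} {φ : TestFn S} (h : DB k M φ) (hM : M ≤ M') : DB k M' φ :=
  fun j hj => (h j hj).mono hM

theorem DB.mono_order {k k' : ℕ} {M : ℝ} {φ : TestFn S} (h : DB k M φ) (hk : k' ≤ k) :
    DB k' M φ := fun j hj => h j (hj.trans hk)

theorem DB.wb {k : ℕ} {M : ℝ} {φ : TestFn S} (h : DB k M φ) : WB M φ := h 0 (Nat.zero_le _)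

theorem DB.iterate {k l : ℕ} {M : ℝ} {φ : TestFn S} (h : DB (k + l) M φ) {j : ℕ} (hj : j ≤ k) :
    DB l M (TestFn.deriv^[j] φ) := fun i hi => by
  rw [← Function.iterate_add_apply]
  exact h _ (by omega)

theorem iterate_deriv_add (j : ℕ) (φ ψ : TestFn S) :
    TestFn.deriv^[j] (φ + ψ) = TestFn.deriv^[j] φ + TestFn.deriv^[j] ψ := by
  induction j generalizing φ ψ with
  | zero => rfl
  | succ j ih => simp only [Function.iterate_succ_apply, TestFn.deriv_add, ih]

theorem iterate_deriv_sub (j : ℕ) (φ ψ : TestFn S) :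
    TestFn.deriv^[j] (φ - ψ) = TestFn.deriv^[j] φ - TestFn.deriv^[j] ψ := by
  induction j generalizing φ ψ with
  | zero => rfl
  | succ j ih => simp only [Function.iterate_succ_apply, TestFn.deriv_sub, ih]

theorem DB.add {k : ℕ} {M M' : ℝ} {φ ψ : TestFn S} (h : DB k M φ) (h' : DB k M' ψ) :
    DB k (M + M') (φ + ψ) := fun j hj => by
  rw [iterate_deriv_add]
  exact (h j hj).add (h' j hj)

/-- Compact support makes `φ · (1 + x²)` bounded. -/
theorem exists_wb (φ : TestFn S) : ∃ M, 0 ≤ M ∧ WB M φ := by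
  have : ∀ σ, ∃ M, 0 ≤ M ∧ ∀ x, |φ σ x| ≤ M * wt x := by
    intro σ
    have hc : Continuous fun x => φ σ x * (1 + x ^ 2) := by
      have := (φ σ).continuous
      fun_prop
    have hs : HasCompactSupport fun x => φ σ x * (1 + x ^ 2) :=
      (φ σ).hasCompactSupport.mul_right
    obtain ⟨C, hC⟩ := hc.bounded_above_of_compact_support hs
    refine ⟨C, (norm_nonneg _).trans (hC 0), fun x => ?_⟩
    have := hC x
    have hp : 0 < 1 + x ^ 2 := by positivity
    rw [Real.norm_eq_abs, abs_mul, abs_of_pos hp] at this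
    rw [wt, ← div_eq_mul_inv, le_div_iff₀ hp]
    exact this
  choose M hM0 hM using this
  refine ⟨∑ σ, M σ, Finset.sum_nonneg fun σ _ => hM0 σ, fun σ x => (hM σ x).trans ?_⟩
  exact mul_le_mul_of_nonneg_right
    (Finset.single_le_sum (f := M) (fun τ _ => hM0 τ) (Finset.mem_univ σ)) (wt_pos x).le

theorem exists_db (k : ℕ) (φ : TestFn S) : ∃ M, 0 ≤ M ∧ DB k M φ := by
  choose M hM0 hM using fun j : ℕ => exists_wb (TestFn.deriv^[j] φ)
  refine ⟨∑ j ∈ Finset.range (k + 1), M j, Finset.sum_nonneg fun j _ => hM0 j, fun j hj =>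
    (hM j).mono ?_⟩
  exact Finset.single_le_sum (f := M) (fun i _ => hM0 i) (by simpa [Nat.lt_succ_iff] using hj)

/-! ### Growth of weighted bounds under the Euler scheme -/

variable (S) in
/-- An upper bound for the speeds in `S`. -/
def speedBound : ℝ := 1 + ∑ σ : S, |((σ : ℤ) : ℝ)|

theorem speedBound_nonneg : 0 ≤ speedBound S :=
  add_nonneg zero_le_one (Finset.sum_nonneg fun _ _ => abs_nonneg _)

/-- Thanks to the summand 1, `speedBound` controls the diffusive jump `1/n` as well as the active
jumps `σ/n`. -/
theorem one_le_speedBound : 1 ≤ speedBound S :=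
  le_add_of_nonneg_right (Finset.sum_nonneg fun _ _ => abs_nonneg _)

theorem abs_le_speedBound (σ : S) : |((σ : ℤ) : ℝ)| ≤ speedBound S := by
  have := Finset.single_le_sum (f := fun σ : S => |((σ : ℤ) : ℝ)|) (fun τ _ => abs_nonneg _)
    (Finset.mem_univ σ)
  unfold speedBound
  linarith

theorem abs_div_le_speedBound {n : ℕ} (hn : 1 ≤ n) (σ : S) :
    |((σ : ℤ) : ℝ) / (n : ℝ)| ≤ speedBound S / n := by
  have : (0 : ℝ) < n := by exact_mod_cast hn
  rw [abs_div, abs_of_pos this]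
  exact div_le_div_of_nonneg_right (abs_le_speedBound σ) this.le

/-- An upper bound for the total jump rate of a particle at scaling parameter `n`. -/
def Rates.jumpRate (R : Rates S) (n : ℕ) : ℝ :=
  2 * (R.κ : ℝ) * (n : ℝ) ^ 2 + (R.lam : ℝ) * n + ∑ σ, ∑ τ, (R.c σ τ : ℝ)

theorem Rates.jumpRate_nonneg (R : Rates S) (n : ℕ) : 0 ≤ R.jumpRate n := by
  unfold jumpRate; positivity

theorem Rates.sum_le_sum_sum (R : Rates S) (σ : S) :
    ∑ τ, (R.c σ τ : ℝ) ≤ ∑ σ, ∑ τ, (R.c σ τ : ℝ) :=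
  Finset.single_le_sum (f := fun σ => ∑ τ, (R.c σ τ : ℝ))
    (fun _ _ => Finset.sum_nonneg fun _ _ => NNReal.coe_nonneg _) (Finset.mem_univ σ)

/-- The exponential rate at which weighted bounds grow under the Euler scheme. -/
def Rates.growth (R : Rates S) : ℝ :=
  8 * R.κ + R.lam * (speedBound S * (1 + speedBound S))

theorem Rates.growth_nonneg (R : Rates S) : 0 ≤ R.growth := by
  have := speedBound_nonneg (S := S)
  unfold growth; positivity

/-- A discrete maximum principle. Under `h * jumpRate ≤ 1` the Euler step is a combination of values
of `φ` with nonnegative coefficients, so it is dominated by the same combination of values of `M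
wt`. What remains is the generator applied to `wt`, which is at most `growth * wt`: the rates `n²`
and `n` are compensated by squared jumps `1/n²` and by jumps of size `O(1/n)`. -/
theorem WB.euler (R : Rates S) {n : ℕ} (hn : 1 ≤ n) {h M : ℝ} (h0 : 0 ≤ h)
    (hh : h * R.jumpRate n ≤ 1) {φ : TestFn S} (hM0 : 0 ≤ M) (hφ : WB M φ) :
    WB ((1 + h * R.growth) * M) (R.euler n h φ) := by
  intro σ x
  have hn' : (0 : ℝ) < n := by exact_mod_cast hn
  have hn1 : (1 : ℝ) ≤ n := by exact_mod_cast hn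
  set K := (R.κ : ℝ) * (n : ℝ) ^ 2 with hK
  set L := (R.lam : ℝ) * (n : ℝ) with hL
  have hK0 : 0 ≤ K := by positivity
  have hL0 : 0 ≤ L := by positivity
  set c := ∑ τ, (R.c σ τ : ℝ) with hc
  have hc0 : 0 ≤ 1 - h * (2 * K + L + c) := by
    have h1 : h * (2 * K + L + c) ≤ h * R.jumpRate n := by
      apply mul_le_mul_of_nonneg_left _ h0
      have := R.sum_le_sum_sum σ
      unfold Rates.jumpRate
      linarith
    linarith
  -- All terms in `φ σ x` are collected in one coefficient, which `hc0` shows to be nonnegative.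
  have hval : R.euler n h φ σ x = (1 - h * (2 * K + L + c)) * φ σ x
      + h * K * φ σ (x + 1 / (n : ℝ)) + h * K * φ σ (x - 1 / (n : ℝ))
      + h * L * φ σ (x + ((σ : ℤ) : ℝ) / (n : ℝ)) + h * ∑ τ, (R.c σ τ : ℝ) * φ τ x := by
    have : R.euler n h φ σ x = φ σ x + h * R.discA n φ σ x := rfl
    rw [this, R.discA_apply]
    simp only [mul_sub, Finset.sum_sub_distrib, ← Finset.sum_mul, ← hK, ← hL, ← hc]
    ring
  have hsum : |∑ τ, (R.c σ τ : ℝ) * φ τ x| ≤ c * (M * wt x) := by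
    rw [hc, Finset.sum_mul]
    refine (Finset.abs_sum_le_sum_abs _ _).trans (Finset.sum_le_sum fun τ _ => ?_)
    rw [abs_mul, abs_of_nonneg (NNReal.coe_nonneg _)]
    exact mul_le_mul_of_nonneg_left (hφ τ x) (NNReal.coe_nonneg _)
  have hterm : ∀ {a y : ℝ}, 0 ≤ a → |a * φ σ y| ≤ a * (M * wt y) := fun {a y} ha => by
    rw [abs_mul, abs_of_nonneg ha]
    exact mul_le_mul_of_nonneg_left (hφ σ y) ha
  have hhs : |h * ∑ τ, (R.c σ τ : ℝ) * φ τ x| ≤ h * (c * (M * wt x)) := by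
    rw [abs_mul, abs_of_nonneg h0]
    exact mul_le_mul_of_nonneg_left hsum h0
  have hsd : K * (wt (x + 1 / (n : ℝ)) + wt (x - 1 / (n : ℝ)) - 2 * wt x) ≤ 8 * R.κ * wt x := by
    refine (mul_le_mul_of_nonneg_left (wt_second_difference_le x (1 / (n : ℝ))) hK0).trans ?_
    rw [hK]
    apply le_of_eq
    field_simp
  have hfd : L * (wt (x + ((σ : ℤ) : ℝ) / (n : ℝ)) - wt x)
      ≤ R.lam * (speedBound S * (1 + speedBound S)) * wt x := by
    have e1 := (le_abs_self _).trans (abs_wt_sub_le x (((σ : ℤ) : ℝ) / (n : ℝ)))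
    have e2 := abs_div_le_speedBound hn σ
    have e3 : speedBound S / n ≤ speedBound S := div_le_self speedBound_nonneg hn1
    have e4 : |((σ : ℤ) : ℝ) / (n : ℝ)| * (1 + |((σ : ℤ) : ℝ) / (n : ℝ)|)
        ≤ speedBound S / n * (1 + speedBound S) :=
      mul_le_mul e2 (by linarith) (by positivity) (div_nonneg speedBound_nonneg hn'.le)
    refine (mul_le_mul_of_nonneg_left (e1.trans (mul_le_mul_of_nonneg_right e4 (wt_pos x).le))
      hL0).trans ?_
    rw [hL]
    apply le_of_eq
    field_simp
  rw [hval]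
  calc _ ≤ (1 - h * (2 * K + L + c)) * (M * wt x) + h * K * (M * wt (x + 1 / (n : ℝ)))
        + h * K * (M * wt (x - 1 / (n : ℝ))) + h * L * (M * wt (x + ((σ : ℤ) : ℝ) / (n : ℝ)))
        + h * (c * (M * wt x)) := by
        refine (abs_add_le _ _).trans (add_le_add ?_ hhs)
        refine (abs_add_le _ _).trans (add_le_add ?_ (hterm (mul_nonneg h0 hL0)))
        refine (abs_add_le _ _).trans (add_le_add ?_ (hterm (mul_nonneg h0 hK0)))
        exact (abs_add_le _ _).trans (add_le_add (hterm hc0) (hterm (mul_nonneg h0 hK0)))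
    _ = M * (wt x + h * (K * (wt (x + 1 / (n : ℝ)) + wt (x - 1 / (n : ℝ)) - 2 * wt x)
        + L * (wt (x + ((σ : ℤ) : ℝ) / (n : ℝ)) - wt x))) := by ring
    _ ≤ M * (wt x + h * (8 * R.κ * wt x
        + R.lam * (speedBound S * (1 + speedBound S)) * wt x)) := by gcongr
    _ = _ := by unfold Rates.growth; ring

theorem Rates.iterate_deriv_A (R : Rates S) (j : ℕ) (φ : TestFn S) :
    TestFn.deriv^[j] (R.A φ) = R.A (TestFn.deriv^[j] φ) := by
  induction j generalizing φ with
  | zero => rfl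
  | succ j ih => simp only [Function.iterate_succ_apply, R.deriv_A, ih]

theorem Rates.iterate_deriv_discA (R : Rates S) (n j : ℕ) (φ : TestFn S) :
    TestFn.deriv^[j] (R.discA n φ) = R.discA n (TestFn.deriv^[j] φ) := by
  induction j generalizing φ with
  | zero => rfl
  | succ j ih => simp only [Function.iterate_succ_apply, R.deriv_discA, ih]

theorem Rates.iterate_deriv_euler (R : Rates S) (n : ℕ) (h : ℝ) (j : ℕ) (φ : TestFn S) :
    TestFn.deriv^[j] (R.euler n h φ) = R.euler n h (TestFn.deriv^[j] φ) := by
  induction j generalizing φ with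
  | zero => rfl
  | succ j ih => simp only [Function.iterate_succ_apply, R.deriv_euler, ih]

theorem DB.euler (R : Rates S) {n : ℕ} (hn : 1 ≤ n) {h M : ℝ} (h0 : 0 ≤ h)
    (hh : h * R.jumpRate n ≤ 1) {k : ℕ} {φ : TestFn S} (hM0 : 0 ≤ M) (hφ : DB k M φ) :
    DB k ((1 + h * R.growth) * M) (R.euler n h φ) := fun j hj => by
  rw [R.iterate_deriv_euler]
  exact WB.euler R hn h0 hh hM0 (hφ j hj)

theorem DB.iterate_euler (R : Rates S) {n : ℕ} (hn : 1 ≤ n) {h M : ℝ} (h0 : 0 ≤ h)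
    (hh : h * R.jumpRate n ≤ 1) {k : ℕ} {φ : TestFn S} (hM0 : 0 ≤ M) (hφ : DB k M φ) (m : ℕ) :
    DB k (Real.exp (m * h * R.growth) * M) ((R.euler n h)^[m] φ) := by
  induction m with
  | zero => simpa using hφ
  | succ m ih =>
    rw [Function.iterate_succ_apply']
    refine (DB.euler R hn h0 hh (by positivity) ih).mono ?_
    have h1 : 1 + h * R.growth ≤ Real.exp (h * R.growth) := by
      linarith [Real.add_one_le_exp (h * R.growth)]
    calc _ ≤ Real.exp (h * R.growth) * (Real.exp (m * h * R.growth) * M) := by gcongr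
      _ = _ := by rw [← mul_assoc, ← Real.exp_add]; push_cast; ring_nf

/-! ### Consistency of the discretized generators -/

/-- The constant in the bound of `A` by two derivatives. -/
def Rates.boundA (R : Rates S) : ℝ :=
  R.κ + speedBound S * R.lam + 2 * ∑ σ, ∑ τ, (R.c σ τ : ℝ)

theorem Rates.boundA_nonneg (R : Rates S) : 0 ≤ R.boundA := by
  have := speedBound_nonneg (S := S)
  unfold boundA; positivity

theorem DB.wb_A (R : Rates S) {M : ℝ} {φ : TestFn S} (hM0 : 0 ≤ M) (hφ : DB 2 M φ) :
    WB (R.boundA * M) (R.A φ) := by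
  intro σ x
  have h0 := hφ 0 (by norm_num)
  have h1 := hφ 1 (by norm_num)
  have h2 := hφ 2 (by norm_num)
  have hw : 0 ≤ M * wt x := mul_nonneg hM0 (wt_pos x).le
  rw [R.A_apply]
  have e1 : |(R.κ : ℝ) * φ.deriv.deriv σ x| ≤ R.κ * (M * wt x) := by
    rw [abs_mul, abs_of_nonneg (NNReal.coe_nonneg _)]
    exact mul_le_mul_of_nonneg_left (h2 σ x) (NNReal.coe_nonneg _)
  have e2 : |((σ : ℤ) : ℝ) * (R.lam : ℝ) * φ.deriv σ x| ≤ speedBound S * R.lam * (M * wt x) := by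
    rw [abs_mul, abs_mul, abs_of_nonneg (NNReal.coe_nonneg R.lam)]
    exact mul_le_mul (mul_le_mul_of_nonneg_right (abs_le_speedBound σ) (NNReal.coe_nonneg _))
      (h1 σ x) (abs_nonneg _) (mul_nonneg speedBound_nonneg (NNReal.coe_nonneg _))
  have e3 : |∑ τ, (R.c σ τ : ℝ) * (φ τ x - φ σ x)| ≤
      (2 * ∑ σ, ∑ τ, (R.c σ τ : ℝ)) * (M * wt x) := by
    calc _ ≤ ∑ τ, (R.c σ τ : ℝ) * (2 * (M * wt x)) := by
          refine (Finset.abs_sum_le_sum_abs _ _).trans (Finset.sum_le_sum fun τ _ => ?_)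
          rw [abs_mul, abs_of_nonneg (NNReal.coe_nonneg _)]
          refine mul_le_mul_of_nonneg_left ?_ (NNReal.coe_nonneg _)
          have := abs_sub (φ τ x) (φ σ x)
          have e4 : |φ τ x| ≤ M * wt x := h0 τ x
          have e5 : |φ σ x| ≤ M * wt x := h0 σ x
          linarith
      _ = (∑ τ, (R.c σ τ : ℝ)) * (2 * (M * wt x)) := by rw [Finset.sum_mul]
      _ ≤ (∑ σ, ∑ τ, (R.c σ τ : ℝ)) * (2 * (M * wt x)) := by
          exact mul_le_mul_of_nonneg_right (R.sum_le_sum_sum σ) (by linarith)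
      _ = _ := by ring
  calc _ ≤ _ := (abs_add_le _ _).trans (add_le_add ((abs_add_le _ _).trans (add_le_add e1 e2)) e3)
    _ = _ := by unfold Rates.boundA; ring

theorem DB.A (R : Rates S) {M : ℝ} {k : ℕ} {φ : TestFn S} (hM0 : 0 ≤ M) (hφ : DB (k + 2) M φ) :
    DB k (R.boundA * M) (R.A φ) := fun j hj => by
  rw [R.iterate_deriv_A]
  exact DB.wb_A R hM0 (hφ.iterate hj)

/-- The constant in the consistency estimate for the discretized generators. -/
def Rates.boundDisc (R : Rates S) : ℝ :=
  (2 * R.κ + R.lam * speedBound S ^ 2) * (1 + speedBound S) ^ 2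

theorem Rates.boundDisc_nonneg (R : Rates S) : 0 ≤ R.boundDisc := by
  have := speedBound_nonneg (S := S)
  unfold boundDisc; positivity

/-- The flip terms cancel exactly. The second-order Taylor remainder contributes `n² · n⁻³` and the
first-order one `n · n⁻²`, both of order `1/n`. -/
theorem DB.wb_discA_sub_A (R : Rates S) {n : ℕ} (hn : 1 ≤ n) {M : ℝ} {φ : TestFn S}
    (hφ : DB 3 M φ) : WB (R.boundDisc * M / n) (R.discA n φ - R.A φ) := by
  intro σ x
  have hn' : (0 : ℝ) < n := by exact_mod_cast hn
  have hn1 : (1 : ℝ) ≤ n := by exact_mod_cast hn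
  have hb := speedBound_nonneg (S := S)
  have hM0 : 0 ≤ M := nonneg_of_mul_nonneg_left ((abs_nonneg _).trans (hφ.wb σ 0)) (wt_pos 0)
  have t2 := abs_taylor_two_le (hasDerivAt_testFunction (φ σ))
    (hasDerivAt_testFunction (φ.deriv σ)) (hasDerivAt_testFunction (φ.deriv.deriv σ))
    (hφ 3 le_rfl σ) x (a := 1 / (n : ℝ)) (b := speedBound S) (by
      rw [abs_of_pos (by positivity)]
      exact ((div_le_one hn').mpr hn1).trans one_le_speedBound)
  have hs := abs_div_le_speedBound hn σ
  have t1 := abs_taylor_one_le (hasDerivAt_testFunction (φ σ))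
    (hasDerivAt_testFunction (φ.deriv σ)) (hφ 2 (by norm_num) σ) x
    (a := ((σ : ℤ) : ℝ) / (n : ℝ)) (b := speedBound S)
    (hs.trans (div_le_self hb hn1))
  have hval : (R.discA n φ - R.A φ) σ x =
      R.κ * (n : ℝ) ^ 2 * (φ σ (x + 1 / (n : ℝ)) + φ σ (x - 1 / (n : ℝ)) - 2 * φ σ x
        - (1 / (n : ℝ)) ^ 2 * φ.deriv.deriv σ x)
      + R.lam * n * (φ σ (x + ((σ : ℤ) : ℝ) / (n : ℝ)) - φ σ x
        - ((σ : ℤ) : ℝ) / (n : ℝ) * φ.deriv σ x) := by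
    have : (R.discA n φ - R.A φ) σ x = R.discA n φ σ x - R.A φ σ x := rfl
    rw [this, R.discA_apply, R.A_apply]
    field_simp
    ring
  rw [hval]
  refine (abs_add_le _ _).trans ?_
  rw [abs_mul, abs_of_nonneg (by positivity : 0 ≤ (R.κ : ℝ) * (n : ℝ) ^ 2), abs_mul,
    abs_of_nonneg (by positivity : 0 ≤ (R.lam : ℝ) * (n : ℝ))]
  rw [abs_of_pos (by positivity : 0 < 1 / (n : ℝ))] at t2
  have hJ : 0 ≤ M * ((1 + speedBound S) ^ 2 * wt x) :=
    mul_nonneg hM0 (mul_nonneg (sq_nonneg _) (wt_pos x).le)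
  have t1' := t1.trans (mul_le_mul_of_nonneg_left (pow_le_pow_left₀ (abs_nonneg _) hs 2) hJ)
  calc _ ≤ R.κ * (n : ℝ) ^ 2 * (2 * M * ((1 + speedBound S) ^ 2 * wt x) * (1 / (n : ℝ)) ^ 3)
        + R.lam * n * (M * ((1 + speedBound S) ^ 2 * wt x) * (speedBound S / n) ^ 2) :=
        add_le_add (mul_le_mul_of_nonneg_left t2 (by positivity))
          (mul_le_mul_of_nonneg_left t1' (by positivity))
    _ = _ := by
        unfold Rates.boundDisc
        field_simp

theorem DB.discA_sub_A (R : Rates S) {n : ℕ} (hn : 1 ≤ n) {M : ℝ} {k : ℕ} {φ : TestFn S}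
    (hφ : DB (k + 3) M φ) : DB k (R.boundDisc * M / n) (R.discA n φ - R.A φ) := fun j hj => by
  rw [iterate_deriv_sub, R.iterate_deriv_discA, R.iterate_deriv_A]
  exact DB.wb_discA_sub_A R hn (hφ.iterate hj)

/-- The comparison with `A` spends three derivatives to obtain a constant independent of `n`;
bounding the translates one by one would cost a factor `n²`. -/
theorem DB.discA (R : Rates S) {n : ℕ} (hn : 1 ≤ n) {M : ℝ} {k : ℕ} {φ : TestFn S}
    (hM0 : 0 ≤ M) (hφ : DB (k + 3) M φ) :
    DB k ((R.boundDisc + R.boundA) * M) (R.discA n φ) := by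
  have h1 := (DB.discA_sub_A R hn hφ).add (DB.A R hM0 (hφ.mono_order (by omega : k + 2 ≤ k + 3)))
  rw [sub_add_cancel] at h1
  refine h1.mono ?_
  rw [add_mul]
  gcongr
  exact div_le_self (mul_nonneg R.boundDisc_nonneg hM0) (by exact_mod_cast hn)

/-! ### Contraction semigroups and their generators -/

section Semigroup

variable {X : Type*} [NormedAddCommGroup X] [NormedSpace ℝ X]

/-- A semigroup of contractions. -/
structure IsContractionSemigroup (T : ℝ≥0 → X →L[ℝ] X) : Prop where
  zero : ∀ f, T 0 f = f
  add : ∀ s t f, T (s + t) f = T s (T t f)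
  contraction : ∀ t f, ‖T t f‖ ≤ ‖f‖

/-- The generator of `T` is defined at `x` and takes the value `y` there. -/
def HasGenerator (T : ℝ≥0 → X →L[ℝ] X) (x y : X) : Prop :=
  Tendsto (fun t : ℝ≥0 => (t : ℝ)⁻¹ • (T t x - x)) (𝓝[>] 0) (𝓝 y)

variable {T : ℝ≥0 → X →L[ℝ] X} {x y z : X}

/-- The limit defining the generator is taken along `h / m`, so that an integer number of good steps
fills exactly the time `h`. -/
theorem HasGenerator.exists_step (hx : HasGenerator T x y) {h : ℝ≥0} (hh : 0 < h) {δ : ℝ}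
    (hδ : 0 < δ) : ∃ m : ℕ, 0 < m ∧
      ‖T (h / m) x - x - ((h / m : ℝ≥0) : ℝ) • y‖ ≤ ((h / m : ℝ≥0) : ℝ) * δ := by
  have h1 : Tendsto (fun m : ℕ => h / (m : ℝ≥0)) atTop (𝓝[>] 0) := by
    rw [tendsto_nhdsWithin_iff]
    refine ⟨tendsto_const_div_atTop_nhds_zero_nat h, ?_⟩
    filter_upwards [eventually_gt_atTop 0] with m hm
    exact div_pos hh (by exact_mod_cast hm)
  have h2 := (hx.comp h1).sub_const y
  rw [sub_self] at h2
  have h3 := (h2.norm.eventually_le_const (by simpa using hδ)).and (eventually_gt_atTop 0)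
  obtain ⟨m, hm, hm0⟩ := h3.exists
  refine ⟨m, hm0, ?_⟩
  set k := h / (m : ℝ≥0) with hk
  have hk0 : (0 : ℝ) < k := by
    rw [hk]; exact_mod_cast div_pos hh (by exact_mod_cast hm0 : (0 : ℝ≥0) < m)
  have e : T k x - x - (k : ℝ) • y = (k : ℝ) • ((k : ℝ)⁻¹ • (T k x - x) - y) := by
    rw [smul_sub, smul_smul, mul_inv_cancel₀ hk0.ne', one_smul]
  rw [e, norm_smul, Real.norm_of_nonneg hk0.le]
  exact mul_le_mul_of_nonneg_left hm hk0.le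

/-- Telescoping: `T h x - x` is a sum of `m` terms `T (i k) (T k x - x)`, each no larger than its
value at `i = 0` by contractivity. Only the derivative at time zero is used, so no integral is
needed. -/
theorem IsContractionSemigroup.norm_sub_le (hT : IsContractionSemigroup T)
    (hx : HasGenerator T x y) (h : ℝ≥0) : ‖T h x - x‖ ≤ h * ‖y‖ := by
  rcases eq_or_ne h 0 with rfl | hh
  · simp [hT.zero]
  have hh := pos_iff_ne_zero.mpr hh
  refine le_of_forall_pos_le_add fun ε hε => ?_
  obtain ⟨m, hm0, hm⟩ := hx.exists_step hh (δ := ε / h) (div_pos hε (by exact_mod_cast hh))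
  set k := h / (m : ℝ≥0) with hk
  have h1 : ‖T k x - x‖ ≤ k * (‖y‖ + ε / h) := by
    have : T k x - x = (T k x - x - (k : ℝ) • y) + (k : ℝ) • y := by abel
    rw [this]
    refine (norm_add_le _ _).trans ?_
    rw [norm_smul, Real.norm_of_nonneg (NNReal.coe_nonneg _)]
    linarith
  have h2 : ∀ i : ℕ, ‖T (i * k) x - x‖ ≤ i * (k * (‖y‖ + ε / h)) := by
    intro i
    induction i with
    | zero => simp [hT.zero]
    | succ i ih =>
      have e : T ((i + 1 : ℕ) * k) x - x = T (i * k) (T k x - x) + (T (i * k) x - x) := by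
        rw [map_sub, ← hT.add]
        push_cast
        rw [add_mul, one_mul]
        abel
      rw [e]
      refine (norm_add_le _ _).trans ((add_le_add ((hT.contraction _ _).trans h1) ih).trans ?_)
      push_cast
      linarith
  have h3 := h2 m
  have hmk : (m : ℝ≥0) * k = h := mul_div_cancel₀ _ (by exact_mod_cast hm0.ne')
  rw [hmk, ← mul_assoc] at h3
  have hmk' : (m : ℝ) * (k : ℝ) = h := by exact_mod_cast hmk
  rw [hmk', mul_add, mul_div_cancel₀ _ (by exact_mod_cast hh.ne')] at h3
  exact h3

/-- The same telescoping with `k • y` subtracted in each step. The extra error `k • (T (i k) y - y)`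
is controlled by `norm_sub_le` applied to `y`, whose generator value is `z`. -/
theorem IsContractionSemigroup.norm_sub_sub_le (hT : IsContractionSemigroup T)
    (hx : HasGenerator T x y) (hy : HasGenerator T y z) (h : ℝ≥0) :
    ‖T h x - x - (h : ℝ) • y‖ ≤ (h : ℝ) ^ 2 * ‖z‖ := by
  rcases eq_or_ne h 0 with rfl | hh
  · simp [hT.zero]
  have hh := pos_iff_ne_zero.mpr hh
  refine le_of_forall_pos_le_add fun ε hε => ?_
  obtain ⟨m, hm0, hm⟩ := hx.exists_step hh (δ := ε / h) (div_pos hε (by exact_mod_cast hh))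
  set k := h / (m : ℝ≥0) with hk
  have hmk : (m : ℝ≥0) * k = h := mul_div_cancel₀ _ (by exact_mod_cast hm0.ne')
  have hmk' : (m : ℝ) * (k : ℝ) = h := by exact_mod_cast hmk
  have h2 : ∀ i : ℕ, i ≤ m → ‖T (i * k) x - x - ((i : ℝ) * (k : ℝ)) • y‖
      ≤ i * (k * (ε / h) + k * (h * ‖z‖)) := by
    intro i
    induction i with
    | zero => simp [hT.zero]
    | succ i ih =>
      intro hi
      have e : T ((i + 1 : ℕ) * k) x - x - (((i + 1 : ℕ) : ℝ) * (k : ℝ)) • y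
          = T (i * k) (T k x - x - (k : ℝ) • y) + (k : ℝ) • (T (i * k) y - y)
            + (T (i * k) x - x - ((i : ℝ) * (k : ℝ)) • y) := by
        rw [map_sub, map_sub, ← hT.add, map_smul]
        push_cast
        rw [add_mul, one_mul, add_mul, one_mul, smul_sub, add_smul]
        abel
      have e2 : ‖T (i * k) y - y‖ ≤ h * ‖z‖ := by
        refine (hT.norm_sub_le hy _).trans (mul_le_mul_of_nonneg_right ?_ (norm_nonneg _))
        rw [← hmk]
        push_cast
        gcongr
        exact_mod_cast (Nat.le_succ i).trans hi
      rw [e]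
      refine (norm_add_le _ _).trans ((add_le_add ((norm_add_le _ _).trans
        (add_le_add ((hT.contraction _ _).trans hm) ?_)) (ih ((Nat.le_succ i).trans hi))).trans
        (le_of_eq ?_) (b := (k * (ε / h) + k * (h * ‖z‖)) + i * (k * (ε / h) + k * (h * ‖z‖))))
      · rw [norm_smul, Real.norm_of_nonneg (NNReal.coe_nonneg _)]
        gcongr
      · push_cast
        ring
  have h3 := h2 m le_rfl
  rw [hmk, hmk'] at h3
  refine h3.trans (le_of_eq ?_)
  have : (h : ℝ) ≠ 0 := by exact_mod_cast hh.ne'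
  calc _ = ((m : ℝ) * k) * (ε / h) + ((m : ℝ) * k) * (h * ‖z‖) := by ring
    _ = _ := by rw [hmk']; field_simp; ring

end Semigroup

/-! ### Approximate evolutions and the Euler scheme -/

/-- A family of linear maps on test functions that evolves according to `dF_t(ψ) = F_t(G ψ) dt`,
in the form of a weighted bound and of a second order estimate. -/
structure Evolution {E : Type*} [NormedAddCommGroup E] [NormedSpace ℝ E]
    (G : TestFn S → TestFn S) (F : ℝ≥0 → TestFn S →ₗ[ℝ] E) (B : ℝ) : Prop where
  bound : ∀ s M ψ, 0 ≤ M → WB M ψ → ‖F s ψ‖ ≤ B * M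
  step : ∀ s h : ℝ≥0, ∀ M ψ, 0 ≤ M → WB M (G (G ψ)) →
    ‖F (s + h) ψ - F s ψ - (h : ℝ) • F s (G ψ)‖ ≤ B * M * (h : ℝ) ^ 2

/-- Time is traded for Euler steps one at a time: `F (s + h) ψ` is replaced by `F s (ψ + h discA n
ψ)`. Each exchange costs `C h²` from the second-order estimate and `ε h` from replacing `G` by
`discA n`. The bounds on the iterates are uniform along the way, so `m` exchanges cost `m h (C h +
ε)` up to constants. -/
theorem Evolution.norm_sub_iterate_euler_le {E : Type*} [NormedAddCommGroup E] [NormedSpace ℝ E]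
    {G : TestFn S → TestFn S} {F : ℝ≥0 → TestFn S →ₗ[ℝ] E} {B : ℝ} (hF : Evolution G F B)
    (R : Rates S) {n : ℕ} (hn : 1 ≤ n) {C ε : ℝ} (hC : 0 ≤ C) (hε : 0 ≤ ε)
    (hGn : ∀ M ψ, 0 ≤ M → DB 3 M ψ → WB (ε * M) (G ψ - R.discA n ψ))
    (hGG : ∀ M ψ, 0 ≤ M → DB 6 M ψ → WB (C * M) (G (G ψ)))
    {h : ℝ≥0} (hh : h * R.jumpRate n ≤ 1) (m : ℕ) {M : ℝ} (hM : 0 ≤ M) {φ : TestFn S}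
    (hφ : DB 6 M φ) :
    ‖F (m * h) φ - F 0 ((R.euler n h)^[m] φ)‖ ≤
      B * (Real.exp (m * h * R.growth) * M) * (m * h) * (C * h + ε) := by
  set M' := Real.exp (m * h * R.growth) * M with hM'
  have hM'0 : 0 ≤ M' := by positivity
  have hDB : ∀ i ≤ m, DB 6 M' ((R.euler n h)^[i] φ) := fun i hi => by
    refine (DB.iterate_euler R hn h.coe_nonneg hh hM hφ i).mono ?_
    rw [hM']
    have := R.growth_nonneg
    gcongr
  have hstep : ∀ s ψ, DB 6 M' ψ →
      ‖F (s + h) ψ - F s (R.euler n h ψ)‖ ≤ B * M' * h * (C * h + ε) := by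
    intro s ψ hψ
    have h1 := hF.step s h _ ψ (mul_nonneg hC hM'0) (hGG M' ψ hM'0 hψ)
    have h2 := hF.bound s _ _ (mul_nonneg hε hM'0) (hGn M' ψ hM'0 (hψ.mono_order (by norm_num)))
    have e : F (s + h) ψ - F s (R.euler n h ψ) =
        (F (s + h) ψ - F s ψ - (h : ℝ) • F s (G ψ)) + (h : ℝ) • F s (G ψ - R.discA n ψ) := by
      rw [Rates.euler, map_add, map_smul, map_sub, smul_sub]
      abel
    rw [e]
    refine (norm_add_le _ _).trans ?_
    rw [norm_smul, Real.norm_of_nonneg h.coe_nonneg]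
    have := mul_le_mul_of_nonneg_left h2 h.coe_nonneg
    calc _ ≤ _ := add_le_add h1 this
      _ = _ := by ring
  -- Here `k` counts the exchanges made and `j` the steps of time left; the induction passes from `j
  -- + 1` to `j`, hence the quantifier over `j`.
  have key : ∀ k ≤ m, ∀ j : ℕ, ‖F ((j + k : ℕ) * h) φ - F (j * h) ((R.euler n h)^[k] φ)‖
      ≤ k * (B * M' * h * (C * h + ε)) := by
    intro k
    induction k with
    | zero => intro _ j; simp
    | succ k ih =>
      intro hk j
      have h1 := ih ((Nat.le_succ k).trans hk) (j + 1)
      have h2 := hstep (j * h) _ (hDB k ((Nat.le_succ k).trans hk))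
      have e1 : ((j + 1 : ℕ) : ℝ≥0) * h = j * h + h := by push_cast; ring
      rw [e1, show j + 1 + k = j + (k + 1) by ring] at h1
      rw [Function.iterate_succ_apply']
      calc _ ≤ _ := norm_sub_le_norm_sub_add_norm_sub _ (F (j * h + h) ((R.euler n h)^[k] φ)) _
        _ ≤ _ := add_le_add h1 h2
        _ = _ := by push_cast; ring
  have := key m le_rfl 0
  simp only [zero_add, Nat.cast_zero, zero_mul] at this
  refine this.trans (le_of_eq ?_)
  ring

/-- `G` approximates `A` to order `e`, with the estimates of `DB.A` and `DB.discA_sub_A`. -/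
structure Rates.IsApprox (R : Rates S) (G : TestFn S → TestFn S) (e : ℝ) : Prop where
  sub_le : ∀ n : ℕ, 1 ≤ n → ∀ M ψ, 0 ≤ M → DB 3 M ψ →
    WB (R.boundDisc * (1 / n + e) * M) (G ψ - R.discA n ψ)
  sq_le : ∀ M ψ, 0 ≤ M → DB 6 M ψ → WB ((R.boundDisc + R.boundA) ^ 2 * M) (G (G ψ))

theorem WB.neg {M : ℝ} {φ : TestFn S} (h : WB M φ) : WB M (-φ) := fun σ x => by
  have := h σ x
  rwa [← abs_neg] at this

theorem Rates.isApprox_A (R : Rates S) : R.IsApprox R.A 0 where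
  sub_le n hn M ψ hM hψ := by
    have := (DB.wb_discA_sub_A R hn hψ).neg
    rw [neg_sub] at this
    refine this.mono (le_of_eq ?_)
    ring
  sq_le M ψ hM hψ := by
    have h1 := R.boundA_nonneg
    have h2 := R.boundDisc_nonneg
    have := DB.A R (mul_nonneg h1 hM)
      (DB.A R hM (hψ.mono_order (by norm_num : (0 + 2) + 2 ≤ 6)))
    refine this.wb.mono ?_
    rw [← mul_assoc, ← pow_two]
    gcongr
    linarith

/-- Two discretizations are compared through `A`. Applying `discA k` twice costs three derivatives
each time, which is where the order 6 comes from. -/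
theorem Rates.isApprox_discA (R : Rates S) {k : ℕ} (hk : 1 ≤ k) :
    R.IsApprox (R.discA k) (1 / k) where
  sub_le n hn M ψ hM hψ := by
    have := (DB.wb_discA_sub_A R hk hψ).add (DB.wb_discA_sub_A R hn hψ).neg
    rw [neg_sub, sub_add_sub_cancel] at this
    refine this.mono (le_of_eq ?_)
    ring
  sq_le M ψ hM hψ := by
    have h1 := R.boundA_nonneg
    have h2 := R.boundDisc_nonneg
    have := DB.discA R hk (by positivity)
      (DB.discA R hk hM (hψ.mono_order (by norm_num : (0 + 3) + 3 ≤ 6)))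
    refine this.wb.mono ?_
    rw [← mul_assoc, ← pow_two]

/-- The number of Euler steps. -/
def Rates.steps (R : Rates S) (n : ℕ) (t : ℝ≥0) : ℕ := ⌈t * R.jumpRate n⌉₊ + n

/-- The Euler approximation of `e^{tA} φ`. -/
def Rates.eulerApprox (R : Rates S) (n : ℕ) (t : ℝ≥0) (φ : TestFn S) : TestFn S :=
  (R.euler n ((t / (R.steps n t : ℝ≥0) : ℝ≥0) : ℝ))^[R.steps n t] φ

/-- The constant in the error estimate for the Euler approximation. -/
def Rates.eulerConst (R : Rates S) (t : ℝ≥0) : ℝ :=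
  Real.exp (t * R.growth) * t * (t * (R.boundDisc + R.boundA) ^ 2 + R.boundDisc)

theorem Rates.eulerConst_nonneg (R : Rates S) (t : ℝ≥0) : 0 ≤ R.eulerConst t := by
  have h1 := R.boundA_nonneg
  have h2 := R.boundDisc_nonneg
  unfold eulerConst; positivity

theorem Rates.steps_pos (R : Rates S) {n : ℕ} (hn : 1 ≤ n) (t : ℝ≥0) : 0 < R.steps n t := by
  unfold steps; omega

theorem Rates.steps_mul (R : Rates S) {n : ℕ} (hn : 1 ≤ n) (t : ℝ≥0) :
    (R.steps n t : ℝ≥0) * (t / (R.steps n t : ℝ≥0)) = t :=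
  mul_div_cancel₀ _ (by exact_mod_cast (R.steps_pos hn t).ne')

/-- The ceiling in `steps` enforces this stability condition; its summand `n` keeps the number of
steps positive and the step size at most `t / n`. -/
theorem Rates.step_mul_jumpRate_le (R : Rates S) {n : ℕ} (hn : 1 ≤ n) (t : ℝ≥0) :
    ((t / (R.steps n t : ℝ≥0) : ℝ≥0) : ℝ) * R.jumpRate n ≤ 1 := by
  have h0 : (0 : ℝ) < R.steps n t := by exact_mod_cast R.steps_pos hn t
  push_cast
  rw [div_mul_eq_mul_div, div_le_one h0]
  refine (Nat.le_ceil _).trans ?_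
  unfold steps
  push_cast
  linarith [(Nat.cast_nonneg n : (0 : ℝ) ≤ n)]

theorem Rates.step_le (R : Rates S) {n : ℕ} (hn : 1 ≤ n) (t : ℝ≥0) :
    ((t / (R.steps n t : ℝ≥0) : ℝ≥0) : ℝ) ≤ t * (1 / n) := by
  have hn' : (0 : ℝ) < n := by exact_mod_cast hn
  push_cast
  rw [mul_one_div]
  gcongr
  unfold steps
  linarith [(Nat.cast_nonneg ⌈t * R.jumpRate n⌉₊ : (0 : ℝ) ≤ _)]

/-- The Euler approximation does not depend on `F` or `G`, so it serves as a common reference for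
different evolutions. For `e = 0` the limit `n → ∞` determines `F t φ` from `F 0`; for `G = discA N`
the choice `n = N` gives an error of order `1/N`. -/
theorem Evolution.norm_sub_eulerApprox_le {E : Type*} [NormedAddCommGroup E] [NormedSpace ℝ E]
    {G : TestFn S → TestFn S} {F : ℝ≥0 → TestFn S →ₗ[ℝ] E} {B : ℝ} (hF : Evolution G F B)
    (hB : 0 ≤ B) {R : Rates S} {e : ℝ} (he : 0 ≤ e) (hG : R.IsApprox G e) {n : ℕ} (hn : 1 ≤ n)
    (t : ℝ≥0) {M : ℝ} (hM : 0 ≤ M) {φ : TestFn S} (hφ : DB 6 M φ) :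
    ‖F t φ - F 0 (R.eulerApprox n t φ)‖ ≤ B * (R.eulerConst t * M) * (1 / n + e) := by
  have h1 := R.boundA_nonneg
  have h2 := R.boundDisc_nonneg
  have := hF.norm_sub_iterate_euler_le R hn (sq_nonneg (R.boundDisc + R.boundA))
    (by positivity : 0 ≤ R.boundDisc * (1 / n + e)) (hG.sub_le n hn) hG.sq_le
    (R.step_mul_jumpRate_le hn t) (R.steps n t) hM hφ
  have e1 : ((R.steps n t : ℕ) : ℝ) * ((t / (R.steps n t : ℝ≥0) : ℝ≥0) : ℝ) = t := by
    exact_mod_cast R.steps_mul hn t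
  rw [R.steps_mul hn t, e1] at this
  refine this.trans ?_
  have h3 : ((t / (R.steps n t : ℝ≥0) : ℝ≥0) : ℝ) ≤ t * (1 / n + e) :=
    (R.step_le hn t).trans (by gcongr; linarith)
  calc _ ≤ B * (Real.exp (t * R.growth) * M) * t *
        ((R.boundDisc + R.boundA) ^ 2 * (t * (1 / n + e)) + R.boundDisc * (1 / n + e)) := by
        gcongr
    _ = _ := by unfold Rates.eulerConst; ring

/-- Evolutions along a discretized generator inherit weighted bounds from their initial value. -/
theorem Evolution.le_of_discA {F : ℝ≥0 → TestFn S →ₗ[ℝ] ℝ} {B : ℝ} {R : Rates S} {n : ℕ}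
    (hn : 1 ≤ n) (hF : Evolution (R.discA n) F B) (t : ℝ≥0) {M K : ℝ} (hM : 0 ≤ M)
    (hK : ∀ M' ψ, 0 ≤ M' → WB M' ψ → |F 0 ψ| ≤ K * M')
    {φ : TestFn S} (hφ : WB M φ) : |F t φ| ≤ K * (Real.exp (t * R.growth) * M) := by
  obtain ⟨M₂, hM₂, hφ₂⟩ := exists_db 6 φ
  have h1 := R.boundA_nonneg
  have h2 := R.boundDisc_nonneg
  set D := (R.boundDisc + R.boundA) ^ 2 with hD
  -- The space discretization `n` is fixed and the number `m` of Euler steps tends to infinity. The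
  -- scheme belongs to `G` itself, so the consistency error is zero and only `D t / m` remains. The
  -- constant `M₂`, which involves six derivatives, thus disappears in the limit.
  have hlim : Tendsto (fun m : ℕ => K * (Real.exp (t * R.growth) * M)
      + B * (Real.exp (t * R.growth) * M₂) * t * (D * (t / m))) atTop
      (𝓝 (K * (Real.exp (t * R.growth) * M)
        + B * (Real.exp (t * R.growth) * M₂) * t * (D * 0))) :=
    tendsto_const_nhds.add
      (((tendsto_const_div_atTop_nhds_zero_nat (t : ℝ)).const_mul D).const_mul _)
  rw [mul_zero, mul_zero, add_zero] at hlim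
  refine ge_of_tendsto hlim ?_
  filter_upwards [eventually_ge_atTop (⌈t * R.jumpRate n⌉₊ + 1)] with m hm
  have hm0 : 0 < m := by omega
  have hm0' : (0 : ℝ) < m := by exact_mod_cast hm0
  have hmul : (m : ℝ≥0) * (t / (m : ℝ≥0)) = t := mul_div_cancel₀ _ (by exact_mod_cast hm0.ne')
  have hmul' : (m : ℝ) * ((t / (m : ℝ≥0) : ℝ≥0) : ℝ) = t := by exact_mod_cast hmul
  have hrate : ((t / (m : ℝ≥0) : ℝ≥0) : ℝ) * R.jumpRate n ≤ 1 := by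
    push_cast
    rw [div_mul_eq_mul_div, div_le_one hm0']
    refine (Nat.le_ceil _).trans ?_
    exact_mod_cast (by omega : ⌈t * R.jumpRate n⌉₊ ≤ m)
  have e1 := hF.norm_sub_iterate_euler_le R hn (sq_nonneg (R.boundDisc + R.boundA)) le_rfl
    (fun M ψ hM hψ σ x => by simp) (R.isApprox_discA hn).sq_le hrate m hM₂ hφ₂
  have e2 := hK _ _ (by positivity)
    (DB.iterate_euler R hn (NNReal.coe_nonneg _) hrate hM
      (k := 0) (fun j hj => by rw [Nat.le_zero.mp hj]; exact hφ) m).wb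
  rw [hmul, hmul', Real.norm_eq_abs] at e1
  rw [hmul'] at e2
  have e3 : ∀ a b : ℝ, |a| ≤ |b| + |a - b| := fun a b => by
    have := abs_add_le b (a - b); rwa [add_sub_cancel] at this
  refine (e3 _ _).trans (add_le_add e2 (e1.trans (le_of_eq ?_)))
  push_cast
  ring

/-! ### Test functions are dense in `C_{0,S}` -/

theorem CZero.norm_le {f : CZero S} {C : ℝ} (hC : 0 ≤ C) (h : ∀ σ x, |f σ x| ≤ C) : ‖f‖ ≤ C := by
  rw [pi_norm_le_iff_of_nonneg hC]
  intro σ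
  rw [← ZeroAtInftyContinuousMap.norm_toBCF_eq_norm]
  exact (BoundedContinuousFunction.norm_le hC).mpr (h σ)

theorem CZero.abs_apply_le (f : CZero S) (σ : S) (x : ℝ) : |f σ x| ≤ ‖f‖ := by
  refine le_trans ?_ (norm_le_pi_norm f σ)
  rw [← ZeroAtInftyContinuousMap.norm_toBCF_eq_norm]
  exact (f σ).toBCF.norm_coe_le_norm x

theorem CZero.continuous_apply (σ : S) (x : ℝ) : Continuous fun f : CZero S => f σ x := by
  refine LipschitzWith.continuous (K := 1) (LipschitzWith.of_dist_le_mul fun f g => ?_)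
  rw [NNReal.coe_one, one_mul, Real.dist_eq, dist_eq_norm]
  exact CZero.abs_apply_le (f - g) σ x

/-- `TestFn.toCZero` as a linear map. -/
def toCZeroL : TestFn S →ₗ[ℝ] CZero S where
  toFun := TestFn.toCZero
  map_add' _ _ := rfl
  map_smul' _ _ := rfl

@[simp]
theorem toCZeroL_apply (φ : TestFn S) : toCZeroL φ = φ.toCZero := rfl

theorem toCZero_apply (φ : TestFn S) (σ : S) (x : ℝ) : φ.toCZero σ x = φ σ x := rfl

theorem WB.norm_toCZero_le {M : ℝ} (hM : 0 ≤ M) {φ : TestFn S} (h : WB M φ) :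
    ‖φ.toCZero‖ ≤ M := CZero.norm_le hM (h.abs_le hM)

/-- Thresholding at level `ε / 2` makes the support compact. The smooth approximation `g` inherits
every bound on the oscillation of `k` over `r`-balls: the bound `δ` makes it close, and the bound 0
away from the support makes it vanish there. -/
theorem exists_testFunction_near (f : C₀(ℝ, ℝ)) {ε : ℝ} (hε : 0 < ε) :
    ∃ g : 𝓓((⊤ : TopologicalSpace.Opens ℝ), ℝ), ∀ x, |f x - g x| ≤ ε := by
  set δ := ε / 2 with hδ
  have hδ0 : 0 < δ := half_pos hε
  -- soft thresholding
  set k : ℝ → ℝ := fun x => f x - max (-δ) (min (f x) δ) with hk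
  have hkc : Continuous k := by
    have := map_continuous f
    fun_prop
  have hkf : ∀ x, |f x - k x| ≤ δ := fun x => by
    have : f x - k x = max (-δ) (min (f x) δ) := by simp [hk]
    rw [this, abs_le]
    exact ⟨le_max_left _ _, max_le (by linarith) (min_le_right _ _)⟩
  have hks : HasCompactSupport k := by
    have h1 := f.zero_at_infty'
    have h2 : ∀ᶠ x in cocompact ℝ, |f x| < δ := by
      have := h1.abs.eventually_lt_const (show |(0 : ℝ)| < δ by simpa using hδ0)
      exact this
    rw [Filter.eventually_iff, Filter.mem_cocompact] at h2
    obtain ⟨K, hK, hKs⟩ := h2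
    refine HasCompactSupport.intro hK fun x hx => ?_
    have := abs_lt.mp (show |f x| < δ from hKs hx)
    simp only [hk]
    rw [min_eq_left this.2.le, max_eq_right this.1.le, sub_self]
  have huc : UniformContinuous k := hks.uniformContinuous_of_continuous hkc
  obtain ⟨r, hr, hkr⟩ := Metric.uniformContinuous_iff.mp huc δ hδ0
  obtain ⟨g, hg, hgk⟩ := hkc.exists_contDiff_dist_le_of_forall_mem_ball_dist_le hr
  have hgs : HasCompactSupport g := by
    refine HasCompactSupport.intro (hks.isCompact.cthickening (r := r)) fun x hx => ?_
    have h0 : ∀ y ∈ Metric.ball x r, k y = 0 := by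
      intro y hy
      by_contra hne
      apply hx
      have hy' : y ∈ tsupport k := subset_closure hne
      exact Metric.mem_cthickening_of_dist_le x y r _ hy' (by
        rw [dist_comm]; exact (Metric.mem_ball.mp hy).le)
    have := hgk x 0 fun y hy => by
      rw [h0 y hy, h0 x (Metric.mem_ball_self hr), dist_self]
    rw [h0 x (Metric.mem_ball_self hr)] at this
    exact dist_le_zero.mp this
  refine ⟨⟨g, hg, hgs, by simp⟩, fun x => ?_⟩
  have h1 := hgk x δ fun y hy => (hkr (Metric.mem_ball.mp hy)).le
  rw [dist_comm, Real.dist_eq] at h1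
  have : f x - g x = (f x - k x) + (k x - g x) := by ring
  change |f x - g x| ≤ ε
  rw [this]
  refine (abs_add_le _ _).trans ?_
  linarith [hkf x]

theorem exists_testFn_near (f : CZero S) {ε : ℝ} (hε : 0 < ε) :
    ∃ φ : TestFn S, ‖f - φ.toCZero‖ ≤ ε := by
  choose φ hφ using fun σ => exists_testFunction_near (f σ) hε
  exact ⟨φ, CZero.norm_le hε.le fun σ x => hφ σ x⟩

/-! ### The semigroups of the discretized generators -/

/-- Translation on `C₀(ℝ)`. -/
def translateC (a : ℝ) (f : C₀(ℝ, ℝ)) : C₀(ℝ, ℝ) where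
  toFun x := f (x + a)
  continuous_toFun := (map_continuous f).comp (by fun_prop)
  zero_at_infty' :=
    f.zero_at_infty'.comp (Homeomorph.addRight a).isClosedEmbedding.tendsto_cocompact

theorem translateC_apply (a : ℝ) (f : C₀(ℝ, ℝ)) (x : ℝ) : translateC a f x = f (x + a) := rfl

/-- The remaining rate, at which the uniformized particle stays put. -/
def Rates.idleRate (R : Rates S) (n : ℕ) (σ : S) : ℝ :=
  R.jumpRate n - (2 * (R.κ : ℝ) * (n : ℝ) ^ 2 + (R.lam : ℝ) * n + ∑ τ, (R.c σ τ : ℝ))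

theorem Rates.idleRate_nonneg (R : Rates S) (n : ℕ) (σ : S) : 0 ≤ R.idleRate n σ := by
  have := R.sum_le_sum_sum σ
  unfold idleRate jumpRate
  linarith

/-- The jump operator of the uniformized particle: discretized generator plus total rate. -/
def Rates.jumpFun (R : Rates S) (n : ℕ) (f : CZero S) : CZero S := fun σ =>
  ((R.κ : ℝ) * (n : ℝ) ^ 2) •
      (translateC (1 / (n : ℝ)) (f σ) + translateC (-(1 / (n : ℝ))) (f σ))
    + ((R.lam : ℝ) * (n : ℝ)) • translateC (((σ : ℤ) : ℝ) / (n : ℝ)) (f σ)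
    + ∑ τ, (R.c σ τ : ℝ) • f τ + R.idleRate n σ • f σ

theorem C0_sum_apply {ι : Type*} (s : Finset ι) (f : ι → C₀(ℝ, ℝ)) (x : ℝ) :
    (∑ i ∈ s, f i) x = ∑ i ∈ s, f i x := by
  classical
  induction s using Finset.induction_on with
  | empty => simp
  | insert a s ha ih => simp [Finset.sum_insert ha, ih]

theorem Rates.jumpFun_apply (R : Rates S) (n : ℕ) (f : CZero S) (σ : S) (x : ℝ) :
    R.jumpFun n f σ x = (R.κ : ℝ) * (n : ℝ) ^ 2 * (f σ (x + 1 / (n : ℝ)) + f σ (x - 1 / (n : ℝ)))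
      + (R.lam : ℝ) * (n : ℝ) * f σ (x + ((σ : ℤ) : ℝ) / (n : ℝ))
      + ∑ τ, (R.c σ τ : ℝ) * f τ x + R.idleRate n σ * f σ x := by
  simp only [jumpFun, ZeroAtInftyContinuousMap.add_apply, ZeroAtInftyContinuousMap.smul_apply,
    C0_sum_apply, translateC_apply, smul_eq_mul, sub_eq_add_neg]

/-- The coefficients are nonnegative and sum to `jumpRate` in every internal state; `idleRate` is
there to equalize these sums. -/
theorem Rates.norm_jumpFun_le (R : Rates S) (n : ℕ) (f : CZero S) :
    ‖R.jumpFun n f‖ ≤ R.jumpRate n * ‖f‖ := by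
  refine CZero.norm_le (mul_nonneg (R.jumpRate_nonneg n) (norm_nonneg _)) fun σ x => ?_
  rw [R.jumpFun_apply]
  have hm : ∀ {a : ℝ} τ y, 0 ≤ a → |a * f τ y| ≤ a * ‖f‖ := fun {a} τ y ha => by
    rw [abs_mul, abs_of_nonneg ha]
    exact mul_le_mul_of_nonneg_left (CZero.abs_apply_le f τ y) ha
  have hK : 0 ≤ (R.κ : ℝ) * (n : ℝ) ^ 2 := by positivity
  have hL : 0 ≤ (R.lam : ℝ) * (n : ℝ) := by positivity
  rw [mul_add]
  refine (abs_add_le _ _).trans ((add_le_add ((abs_add_le _ _).trans (add_le_add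
    ((abs_add_le _ _).trans (add_le_add ((abs_add_le _ _).trans
      (add_le_add (hm _ _ hK) (hm _ _ hK))) (hm _ _ hL)))
    ((Finset.abs_sum_le_sum_abs _ _).trans
      (Finset.sum_le_sum fun τ _ => hm τ x (NNReal.coe_nonneg (R.c σ τ))))))
    (hm _ _ (R.idleRate_nonneg n σ))).trans (le_of_eq ?_))
  rw [← Finset.sum_mul]
  unfold idleRate
  ring

/-- `Rates.jumpFun` as a bounded operator. -/
def Rates.jump (R : Rates S) (n : ℕ) : CZero S →L[ℝ] CZero S :=
  LinearMap.mkContinuous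
    { toFun := R.jumpFun n
      map_add' := fun f g => by
        funext σ; ext x
        simp only [Pi.add_apply, ZeroAtInftyContinuousMap.add_apply, R.jumpFun_apply, mul_add,
          Finset.sum_add_distrib]
        ring
      map_smul' := fun a f => by
        funext σ; ext x
        simp only [Pi.smul_apply, ZeroAtInftyContinuousMap.smul_apply, R.jumpFun_apply,
          smul_eq_mul, RingHom.id_apply, mul_left_comm _ a, ← Finset.mul_sum, ← mul_add] }
    (R.jumpRate n) (R.norm_jumpFun_le n)

theorem Rates.jump_apply (R : Rates S) (n : ℕ) (f : CZero S) : R.jump n f = R.jumpFun n f := rfl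

theorem Rates.norm_jump_le (R : Rates S) (n : ℕ) : ‖R.jump n‖ ≤ R.jumpRate n :=
  LinearMap.mkContinuous_norm_le _ (R.jumpRate_nonneg n) _

theorem Rates.jump_toCZero (R : Rates S) (n : ℕ) (φ : TestFn S) :
    R.jump n φ.toCZero - R.jumpRate n • φ.toCZero = (R.discA n φ).toCZero := by
  funext σ; ext x
  simp only [R.jump_apply, Pi.sub_apply, Pi.smul_apply, ZeroAtInftyContinuousMap.sub_apply,
    ZeroAtInftyContinuousMap.smul_apply, R.jumpFun_apply, toCZero_apply, R.discA_apply, idleRate,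
    smul_eq_mul, mul_sub, Finset.sum_sub_distrib, ← Finset.sum_mul]
  ring

/-! ### Exponentials of bounded operators -/

theorem norm_exp_le_exp_norm {𝔸 : Type*} [NormedRing 𝔸] [NormedAlgebra ℝ 𝔸] [CompleteSpace 𝔸]
    [NormOneClass 𝔸] (a : 𝔸) : ‖NormedSpace.exp a‖ ≤ Real.exp ‖a‖ := by
  have h1 := NormedSpace.exp_series_hasSum_exp' (𝕂 := ℝ) a
  have h2 := NormedSpace.exp_series_hasSum_exp' (𝕂 := ℝ) ‖a‖
  rw [← Real.exp_eq_exp_ℝ] at h2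
  refine h1.norm_le_of_bounded h2 fun n => ?_
  rw [norm_smul, smul_eq_mul, Real.norm_of_nonneg (by positivity)]
  gcongr
  exact norm_pow_le a n

section Uniformization

variable {X : Type*} [NormedAddCommGroup X] [NormedSpace ℝ X] [CompleteSpace X]

/-- The semigroup `e^{-tr} e^{tJ}`. -/
def uniformizedSemigroup (J : X →L[ℝ] X) (r : ℝ) (t : ℝ≥0) : X →L[ℝ] X :=
  Real.exp (-(t * r)) • NormedSpace.exp ((t : ℝ) • J)

theorem isContractionSemigroup_uniformizedSemigroup {J : X →L[ℝ] X} {r : ℝ}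
    (hJ : ‖J‖ ≤ r) : IsContractionSemigroup (uniformizedSemigroup J r) where
  zero f := by simp [uniformizedSemigroup]
  add s t f := by
    have h1 : NormedSpace.exp (((s + t : ℝ≥0) : ℝ) • J)
        = NormedSpace.exp ((s : ℝ) • J) * NormedSpace.exp ((t : ℝ) • J) := by
      rw [NNReal.coe_add, add_smul]
      let _ : NormedAlgebra ℚ (X →L[ℝ] X) := NormedAlgebra.restrictScalars ℚ ℝ _
      exact NormedSpace.exp_add_of_commute (((Commute.refl J).smul_left _).smul_right _)
    have h2 : Real.exp (-((s + t : ℝ≥0) * r)) = Real.exp (-(s * r)) * Real.exp (-(t * r)) := by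
      rw [← Real.exp_add]; push_cast; ring_nf
    simp only [uniformizedSemigroup, h1, h2, smul_apply,
      mul_apply_eq_comp, map_smul, smul_smul]
    rw [mul_comm]
  contraction t f := by
    -- The identity has norm 1 only on a nontrivial space, and `CZero S` is trivial for empty `S`.
    rcases subsingleton_or_nontrivial X with hX | hX
    · rw [Subsingleton.elim (uniformizedSemigroup J r t f) f]
    refine (ContinuousLinearMap.le_opNorm _ _).trans (mul_le_of_le_one_left (norm_nonneg _) ?_)
    rw [uniformizedSemigroup, norm_smul, Real.norm_of_nonneg (Real.exp_nonneg _)]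
    have h1 : ‖NormedSpace.exp ((t : ℝ) • J)‖ ≤ Real.exp (t * r) := by
      refine (norm_exp_le_exp_norm _).trans (Real.exp_le_exp.mpr ?_)
      rw [norm_smul, Real.norm_of_nonneg t.coe_nonneg]
      gcongr
    calc _ ≤ Real.exp (-(t * r)) * Real.exp (t * r) := by gcongr
      _ = 1 := by rw [← Real.exp_add]; simp

theorem hasGenerator_uniformizedSemigroup (J : X →L[ℝ] X) (r : ℝ) (x : X) :
    HasGenerator (uniformizedSemigroup J r) x (J x - r • x) := by
  have h1 : HasDerivAt (fun t : ℝ => Real.exp (-(t * r))) (-r) 0 := by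
    have := ((hasDerivAt_id (0 : ℝ)).mul_const r).neg.exp
    simpa using this
  have h2 : HasDerivAt (fun t : ℝ => NormedSpace.exp (t • J) x) (J x) 0 := by
    have := (hasDerivAt_exp_smul_const (𝕂 := ℝ) J 0).clm_apply (hasDerivAt_const (0 : ℝ) x)
    simpa using this
  have h3 := h1.smul h2
  have h4 := h3.tendsto_slope_zero_right
  have h5 : Tendsto (fun t : ℝ≥0 => (t : ℝ)) (𝓝[>] 0) (𝓝[>] 0) := by
    rw [tendsto_nhdsWithin_iff]
    refine ⟨(NNReal.continuous_coe.tendsto' 0 0 rfl).mono_left nhdsWithin_le_nhds, ?_⟩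
    filter_upwards [self_mem_nhdsWithin] with t ht
    exact_mod_cast ht
  have h6 := h4.comp h5
  have e : J x - r • x = Real.exp (-(0 * r)) • J x + (-r) • NormedSpace.exp ((0 : ℝ) • J) x := by
    simp [sub_eq_add_neg]
  rw [HasGenerator, e]
  refine h6.congr fun t => ?_
  simp [uniformizedSemigroup]

/-- The exponential series of `t J` has nonnegative coefficients, so a closed convex cone preserved
by `J` is preserved by the semigroup. The cone of nonnegative functions gives positivity. -/
theorem uniformizedSemigroup_mem {J : X →L[ℝ] X} {r : ℝ} {P : Set X} (hP : IsClosed P)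
    (h0 : (0 : X) ∈ P) (hadd : ∀ x ∈ P, ∀ y ∈ P, x + y ∈ P)
    (hsmul : ∀ a : ℝ, 0 ≤ a → ∀ x ∈ P, a • x ∈ P) (hJ : ∀ x ∈ P, J x ∈ P) (t : ℝ≥0) {x : X}
    (hx : x ∈ P) : uniformizedSemigroup J r t x ∈ P := by
  have h1 := NormedSpace.exp_series_hasSum_exp' (𝕂 := ℝ) ((t : ℝ) • J)
  have h2 := (ContinuousLinearMap.apply ℝ X x).hasSum h1
  have h3 : ∀ k : ℕ, (((t : ℝ) • J) ^ k) x ∈ P := by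
    intro k
    induction k with
    | zero => simpa using hx
    | succ k ih =>
      rw [pow_succ', mul_apply_eq_comp, smul_apply]
      exact hsmul _ t.coe_nonneg _ (hJ _ ih)
  have h4 : NormedSpace.exp ((t : ℝ) • J) x ∈ P := by
    refine hP.mem_of_tendsto h2 (Eventually.of_forall fun s => ?_)
    classical
    induction s using Finset.induction_on with
    | empty => simpa using h0
    | insert a s ha ih =>
      rw [Finset.sum_insert ha]
      refine hadd _ ?_ _ ih
      simp only [ContinuousLinearMap.apply_apply, smul_apply]
      exact hsmul _ (by positivity) _ (h3 a)
  exact hsmul _ (Real.exp_nonneg _) _ h4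

end Uniformization

/-- The semigroup of the discretized generator on `C_{0,S}`. -/
def Rates.discSemigroup (R : Rates S) (n : ℕ) (t : ℝ≥0) : CZero S →L[ℝ] CZero S :=
  uniformizedSemigroup (R.jump n) (R.jumpRate n) t

theorem Rates.isContractionSemigroup_disc (R : Rates S) (n : ℕ) :
    IsContractionSemigroup (R.discSemigroup n) :=
  isContractionSemigroup_uniformizedSemigroup (R.norm_jump_le n)

theorem Rates.hasGenerator_disc (R : Rates S) (n : ℕ) (φ : TestFn S) :
    HasGenerator (R.discSemigroup n) φ.toCZero (R.discA n φ).toCZero := by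
  rw [← R.jump_toCZero]
  exact hasGenerator_uniformizedSemigroup _ _ _

theorem Rates.discSemigroup_nonneg (R : Rates S) (n : ℕ) (t : ℝ≥0) (f : CZero S)
    (hf : ∀ σ x, 0 ≤ f σ x) (σ : S) (x : ℝ) : 0 ≤ R.discSemigroup n t f σ x := by
  refine uniformizedSemigroup_mem (P := {f : CZero S | ∀ σ x, 0 ≤ f σ x}) ?_
    (fun _ _ => le_rfl) (fun f hf g hg σ x => add_nonneg (hf σ x) (hg σ x))
    (fun a ha f hf σ x => mul_nonneg ha (hf σ x)) (fun f hf σ x => ?_) t hf σ x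
  · simp only [Set.ofPred_forall]
    refine isClosed_iInter fun σ => isClosed_iInter fun x => ?_
    exact isClosed_le continuous_const (CZero.continuous_apply σ x)
  · rw [R.jump_apply, R.jumpFun_apply]
    have := R.idleRate_nonneg n σ
    have h1 := hf σ x
    have h2 := hf σ (x + 1 / (n : ℝ))
    have h3 := hf σ (x - 1 / (n : ℝ))
    have h4 := hf σ (x + ((σ : ℤ) : ℝ) / (n : ℝ))
    have h5 : 0 ≤ ∑ τ, (R.c σ τ : ℝ) * f τ x :=
      Finset.sum_nonneg fun τ _ => mul_nonneg (NNReal.coe_nonneg _) (hf τ x)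
    positivity

theorem IsContractionSemigroup.evolution {T : ℝ≥0 → CZero S →L[ℝ] CZero S}
    (hT : IsContractionSemigroup T) {G : TestFn S → TestFn S}
    (hG : ∀ φ : TestFn S, HasGenerator T φ.toCZero (G φ).toCZero) :
    Evolution G (fun s => (T s : CZero S →ₗ[ℝ] CZero S) ∘ₗ toCZeroL) 1 where
  bound s M ψ hM hψ := by
    rw [one_mul]
    exact (hT.contraction s _).trans (hψ.norm_toCZero_le hM)
  step s h M ψ hM hψ := by
    have h1 := hT.norm_sub_sub_le (hG ψ) (hG (G ψ)) h
    have e : T (s + h) ψ.toCZero - T s ψ.toCZero - (h : ℝ) • T s (G ψ).toCZero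
        = T s (T h ψ.toCZero - ψ.toCZero - (h : ℝ) • (G ψ).toCZero) := by
      rw [map_sub, map_sub, map_smul, hT.add]
    change ‖T (s + h) ψ.toCZero - T s ψ.toCZero - (h : ℝ) • T s (G ψ).toCZero‖ ≤ _
    rw [e]
    refine (hT.contraction s _).trans (h1.trans ?_)
    rw [one_mul, mul_comm]
    exact mul_le_mul_of_nonneg_right (hψ.norm_toCZero_le hM) (sq_nonneg _)

theorem IsContractionSemigroup.norm_sub_eulerApprox_le {T : ℝ≥0 → CZero S →L[ℝ] CZero S}
    (hT : IsContractionSemigroup T) {G : TestFn S → TestFn S}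
    (hG : ∀ φ : TestFn S, HasGenerator T φ.toCZero (G φ).toCZero) {R : Rates S} {e : ℝ}
    (he : 0 ≤ e) (hGe : R.IsApprox G e) {n : ℕ} (hn : 1 ≤ n) (t : ℝ≥0) {M : ℝ} (hM : 0 ≤ M)
    {φ : TestFn S} (hφ : DB 6 M φ) :
    ‖T t φ.toCZero - (R.eulerApprox n t φ).toCZero‖ ≤ R.eulerConst t * M * (1 / n + e) := by
  have := (hT.evolution hG).norm_sub_eulerApprox_le zero_le_one he hGe hn t hM hφ
  simpa [hT.zero] using this

/-! ### Existence and uniqueness of `e^{tA}` -/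

theorem Rates.IsSemigroupOfA.isContractionSemigroup {R : Rates S}
    {T : ℝ≥0 → CZero S →L[ℝ] CZero S} (hT : R.IsSemigroupOfA T) : IsContractionSemigroup T :=
  ⟨hT.zero, hT.add, hT.contraction⟩

theorem Rates.IsSemigroupOfA.norm_sub_eulerApprox_le {R : Rates S}
    {T : ℝ≥0 → CZero S →L[ℝ] CZero S} (hT : R.IsSemigroupOfA T) {n : ℕ} (hn : 1 ≤ n) (t : ℝ≥0)
    {M : ℝ} (hM : 0 ≤ M) {φ : TestFn S} (hφ : DB 6 M φ) :
    ‖T t φ.toCZero - (R.eulerApprox n t φ).toCZero‖ ≤ R.eulerConst t * M * (1 / n) := by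
  have := hT.isContractionSemigroup.norm_sub_eulerApprox_le hT.generator le_rfl R.isApprox_A hn t
    hM hφ
  rwa [add_zero] at this

theorem Rates.IsSemigroupOfA.tendsto_eulerApprox {R : Rates S}
    {T : ℝ≥0 → CZero S →L[ℝ] CZero S} (hT : R.IsSemigroupOfA T) (t : ℝ≥0) (φ : TestFn S) :
    Tendsto (fun n => (R.eulerApprox n t φ).toCZero) atTop (𝓝 (T t φ.toCZero)) := by
  obtain ⟨M, hM, hφ⟩ := exists_db 6 φ
  rw [tendsto_iff_norm_sub_tendsto_zero]
  have h0 : Tendsto (fun n : ℕ => R.eulerConst t * M * (1 / (n : ℝ))) atTop (𝓝 0) := by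
    simpa using tendsto_one_div_atTop_nhds_zero_nat.const_mul (R.eulerConst t * M)
  refine squeeze_zero' (Eventually.of_forall fun _ => norm_nonneg _) ?_ h0
  filter_upwards [eventually_ge_atTop 1] with n hn
  rw [norm_sub_rev]
  exact hT.norm_sub_eulerApprox_le hn t hM hφ

theorem clm_ext_of_testFn {T T' : CZero S →L[ℝ] CZero S}
    (h : ∀ φ : TestFn S, T φ.toCZero = T' φ.toCZero) : T = T' := by
  have hd : DenseRange (TestFn.toCZero : TestFn S → CZero S) := by
    intro f
    rw [Metric.mem_closure_iff]
    intro ε hε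
    obtain ⟨φ, hφ⟩ := exists_testFn_near f (half_pos hε)
    exact ⟨_, ⟨φ, rfl⟩, by rw [dist_eq_norm]; linarith⟩
  exact DFunLike.coe_injective (hd.equalizer T.continuous T'.continuous (funext h))

/-- On the dense set of test functions both semigroups are limits of the same Euler approximations.
-/
theorem Rates.IsSemigroupOfA.unique {R : Rates S} {T T' : ℝ≥0 → CZero S →L[ℝ] CZero S}
    (hT : R.IsSemigroupOfA T) (hT' : R.IsSemigroupOfA T') : T = T' :=
  funext fun t => clm_ext_of_testFn fun φ =>
    tendsto_nhds_unique (hT.tendsto_eulerApprox t φ) (hT'.tendsto_eulerApprox t φ)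

/-- Both are compared with the Euler approximation of parameter `n`, with errors `1/n + 1/m` and
`1/n + 1/n`. -/
theorem Rates.norm_disc_sub_disc_le (R : Rates S) (t : ℝ≥0) {M : ℝ} (hM : 0 ≤ M)
    {φ : TestFn S} (hφ : DB 6 M φ) {m n : ℕ} (hm : 1 ≤ m) (hn : 1 ≤ n) :
    ‖R.discSemigroup m t φ.toCZero - R.discSemigroup n t φ.toCZero‖
      ≤ R.eulerConst t * M * (1 / m + 3 * (1 / n)) := by
  have h1 := (R.isContractionSemigroup_disc m).norm_sub_eulerApprox_le (R.hasGenerator_disc m)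
    (by positivity) (R.isApprox_discA hm) hn t hM hφ
  have h2 := (R.isContractionSemigroup_disc n).norm_sub_eulerApprox_le (R.hasGenerator_disc n)
    (by positivity) (R.isApprox_discA hn) hn t hM hφ
  rw [norm_sub_rev] at h2
  refine (norm_sub_le_norm_sub_add_norm_sub _ _ _).trans ((add_le_add h1 h2).trans (le_of_eq ?_))
  ring

theorem Rates.exists_tendsto_disc (R : Rates S) (t : ℝ≥0) (f : CZero S) :
    ∃ g, Tendsto (fun n => R.discSemigroup n t f) atTop (𝓝 g) := by
  refine cauchySeq_tendsto_of_complete (Metric.cauchySeq_iff'.mpr fun ε hε => ?_)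
  obtain ⟨φ, hφ⟩ := exists_testFn_near f (show 0 < ε / 4 by positivity)
  obtain ⟨M, hM, hφM⟩ := exists_db 6 φ
  have h0 : Tendsto (fun n : ℕ => R.eulerConst t * M * (4 * (1 / (n : ℝ)))) atTop (𝓝 0) := by
    simpa using (tendsto_one_div_atTop_nhds_zero_nat.const_mul 4).const_mul (R.eulerConst t * M)
  obtain ⟨N, hN, hN1⟩ := ((h0.eventually_lt_const (show 0 < ε / 4 by positivity)).and
    (eventually_ge_atTop 1)).exists
  refine ⟨N, fun n hn => ?_⟩
  rw [dist_eq_norm]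
  have e : R.discSemigroup n t f - R.discSemigroup N t f
      = R.discSemigroup n t (f - φ.toCZero) - R.discSemigroup N t (f - φ.toCZero)
        + (R.discSemigroup n t φ.toCZero - R.discSemigroup N t φ.toCZero) := by
    rw [map_sub, map_sub]; abel
  have h1 := (R.isContractionSemigroup_disc n).contraction t (f - φ.toCZero)
  have h2 := (R.isContractionSemigroup_disc N).contraction t (f - φ.toCZero)
  have h3 := R.norm_disc_sub_disc_le t hM hφM (hN1.trans hn) hN1
  have h4 : R.eulerConst t * M * (1 / n + 3 * (1 / N)) ≤ R.eulerConst t * M * (4 * (1 / N)) := by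
    have : (1 : ℝ) / n ≤ 1 / N :=
      one_div_le_one_div_of_le (by exact_mod_cast hN1) (by exact_mod_cast hn)
    exact mul_le_mul_of_nonneg_left (by linarith) (mul_nonneg (R.eulerConst_nonneg t) hM)
  rw [e]
  refine (norm_add_le _ _).trans_lt ?_
  have := norm_sub_le (R.discSemigroup n t (f - φ.toCZero)) (R.discSemigroup N t (f - φ.toCZero))
  linarith

theorem Rates.tendsto_discA (R : Rates S) (φ : TestFn S) :
    Tendsto (fun n => (R.discA n φ).toCZero) atTop (𝓝 (R.A φ).toCZero) := by
  obtain ⟨M, hM, hφ⟩ := exists_db 3 φ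
  rw [tendsto_iff_norm_sub_tendsto_zero]
  have h0 : Tendsto (fun n : ℕ => R.boundDisc * M / (n : ℝ)) atTop (𝓝 0) :=
    tendsto_const_div_atTop_nhds_zero_nat _
  refine squeeze_zero' (Eventually.of_forall fun _ => norm_nonneg _) ?_ h0
  filter_upwards [eventually_ge_atTop 1] with n hn
  exact (DB.wb_discA_sub_A R hn hφ).norm_toCZero_le
    (div_nonneg (mul_nonneg R.boundDisc_nonneg hM) (Nat.cast_nonneg _))

/-- The limit of the semigroups of the discretized generators. -/
def Rates.limitSemigroup (R : Rates S) (t : ℝ≥0) : CZero S →L[ℝ] CZero S :=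
  LinearMap.mkContinuous
    { toFun := fun f => (R.exists_tendsto_disc t f).choose
      map_add' := fun f g => by
        refine tendsto_nhds_unique (R.exists_tendsto_disc t (f + g)).choose_spec ?_
        simpa using ((R.exists_tendsto_disc t f).choose_spec.add
          (R.exists_tendsto_disc t g).choose_spec)
      map_smul' := fun a f => by
        refine tendsto_nhds_unique (R.exists_tendsto_disc t (a • f)).choose_spec ?_
        simpa using ((R.exists_tendsto_disc t f).choose_spec.const_smul a) }
    1 fun f => by
      rw [one_mul]
      exact le_of_tendsto (R.exists_tendsto_disc t f).choose_spec.norm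
        (Eventually.of_forall fun n => (R.isContractionSemigroup_disc n).contraction t f)

theorem Rates.tendsto_limitSemigroup (R : Rates S) (t : ℝ≥0) (f : CZero S) :
    Tendsto (fun n => R.discSemigroup n t f) atTop (𝓝 (R.limitSemigroup t f)) :=
  (R.exists_tendsto_disc t f).choose_spec

theorem Rates.limitSemigroup_contraction (R : Rates S) (t : ℝ≥0) (f : CZero S) :
    ‖R.limitSemigroup t f‖ ≤ ‖f‖ :=
  le_of_tendsto (R.tendsto_limitSemigroup t f).norm
    (Eventually.of_forall fun n => (R.isContractionSemigroup_disc n).contraction t f)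

/-- The second-order estimate for the discretized semigroups is uniform in `n` and survives the
limit. It yields the generator and, by density, strong continuity. -/
theorem Rates.norm_limitSemigroup_sub_le (R : Rates S) (φ : TestFn S) :
    ∃ C, ∀ t : ℝ≥0, ‖R.limitSemigroup t φ.toCZero - φ.toCZero - (t : ℝ) • (R.A φ).toCZero‖
      ≤ (t : ℝ) ^ 2 * C := by
  obtain ⟨M, hM, hφ⟩ := exists_db 6 φ
  refine ⟨(R.boundDisc + R.boundA) ^ 2 * M, fun t => ?_⟩
  refine le_of_tendsto (((R.tendsto_limitSemigroup t φ.toCZero).sub_const _).sub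
    ((R.tendsto_discA φ).const_smul (t : ℝ))).norm ?_
  filter_upwards [eventually_ge_atTop 1] with n hn
  refine ((R.isContractionSemigroup_disc n).norm_sub_sub_le (R.hasGenerator_disc n φ)
    (R.hasGenerator_disc n _) t).trans (mul_le_mul_of_nonneg_left ?_ (sq_nonneg _))
  exact ((R.isApprox_discA hn).sq_le M φ hM hφ).norm_toCZero_le (by positivity)

theorem Rates.isSemigroupOfA_limitSemigroup (R : Rates S) : R.IsSemigroupOfA R.limitSemigroup where
  zero f := tendsto_nhds_unique (R.tendsto_limitSemigroup 0 f)
    (by simp [(R.isContractionSemigroup_disc _).zero])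
  add s t f := by
    refine tendsto_nhds_unique (R.tendsto_limitSemigroup (s + t) f) ?_
    have h1 := R.tendsto_limitSemigroup s (R.limitSemigroup t f)
    -- The outer operator varies with `n`; contractivity allows the inner limit to be taken first.
    have h2 : Tendsto (fun n => R.discSemigroup n s
        (R.discSemigroup n t f - R.limitSemigroup t f)) atTop (𝓝 0) := by
      refine squeeze_zero_norm (fun n => (R.isContractionSemigroup_disc n).contraction s _) ?_
      simpa using ((R.tendsto_limitSemigroup t f).sub_const (R.limitSemigroup t f)).norm
    have h3 := h2.add h1
    rw [zero_add] at h3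
    refine h3.congr fun n => ?_
    rw [map_sub, sub_add_cancel, (R.isContractionSemigroup_disc n).add]
  strong_cont f := by
    rw [Metric.tendsto_nhds]
    intro ε hε
    obtain ⟨φ, hφ⟩ := exists_testFn_near f (show 0 < ε / 4 by positivity)
    obtain ⟨C, hC⟩ := R.norm_limitSemigroup_sub_le φ
    have h0 : Tendsto (fun t : ℝ≥0 => (t : ℝ) ^ 2 * C + t * ‖(R.A φ).toCZero‖) (𝓝 0) (𝓝 0) := by
      have : Continuous fun t : ℝ≥0 => (t : ℝ) ^ 2 * C + t * ‖(R.A φ).toCZero‖ := by fun_prop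
      simpa using this.tendsto 0
    filter_upwards [h0.eventually_lt_const (show 0 < ε / 4 by positivity)] with t ht
    have h1 := R.limitSemigroup_contraction t (f - φ.toCZero)
    have e : R.limitSemigroup t f - f = R.limitSemigroup t (f - φ.toCZero)
        + (R.limitSemigroup t φ.toCZero - φ.toCZero - (t : ℝ) • (R.A φ).toCZero)
        + (t : ℝ) • (R.A φ).toCZero - (f - φ.toCZero) := by
      rw [map_sub]; abel
    have h2 : ‖(t : ℝ) • (R.A φ).toCZero‖ = t * ‖(R.A φ).toCZero‖ := by
      rw [norm_smul, Real.norm_of_nonneg t.coe_nonneg]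
    rw [dist_eq_norm, e]
    refine (norm_sub_le _ _).trans_lt ?_
    have h3 := norm_add_le (R.limitSemigroup t (f - φ.toCZero)
        + (R.limitSemigroup t φ.toCZero - φ.toCZero - (t : ℝ) • (R.A φ).toCZero))
        ((t : ℝ) • (R.A φ).toCZero)
    have h4 := norm_add_le (R.limitSemigroup t (f - φ.toCZero))
        (R.limitSemigroup t φ.toCZero - φ.toCZero - (t : ℝ) • (R.A φ).toCZero)
    have h5 := hC t
    linarith
  contraction := R.limitSemigroup_contraction
  nonneg t f hf σ x := by
    refine ge_of_tendsto (((CZero.continuous_apply σ x).tendsto _).comp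
      (R.tendsto_limitSemigroup t f)) (Eventually.of_forall fun n => ?_)
    exact R.discSemigroup_nonneg n t f hf σ x
  generator φ := by
    obtain ⟨C, hC⟩ := R.norm_limitSemigroup_sub_le φ
    rw [tendsto_iff_norm_sub_tendsto_zero]
    have h0 : Tendsto (fun t : ℝ≥0 => (t : ℝ) * C) (𝓝[>] 0) (𝓝 0) := by
      have : Continuous fun t : ℝ≥0 => (t : ℝ) * C := by fun_prop
      have := this.tendsto 0
      simp only [NNReal.coe_zero, zero_mul] at this
      exact this.mono_left nhdsWithin_le_nhds
    refine squeeze_zero' (Eventually.of_forall fun _ => norm_nonneg _) ?_ h0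
    filter_upwards [self_mem_nhdsWithin] with t ht
    have ht0 : (0 : ℝ) < t := by exact_mod_cast ht
    have e : (t : ℝ)⁻¹ • (R.limitSemigroup t φ.toCZero - φ.toCZero) - (R.A φ).toCZero
        = (t : ℝ)⁻¹ •
          (R.limitSemigroup t φ.toCZero - φ.toCZero - (t : ℝ) • (R.A φ).toCZero) := by
      rw [smul_sub (t : ℝ)⁻¹ (R.limitSemigroup t φ.toCZero - φ.toCZero), smul_smul,
        inv_mul_cancel₀ ht0.ne', one_smul]
    rw [e, norm_smul, Real.norm_of_nonneg (inv_nonneg.mpr ht0.le)]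
    refine (mul_le_mul_of_nonneg_left (hC t) (inv_nonneg.mpr ht0.le)).trans (le_of_eq ?_)
    field_simp

theorem Rates.existsUnique_semigroup (R : Rates S) : ∃! T, R.IsSemigroupOfA T :=
  ⟨R.limitSemigroup, R.isSemigroupOfA_limitSemigroup,
    fun _ hT => hT.unique R.isSemigroupOfA_limitSemigroup⟩

theorem Rates.isSemigroupOfA_expA (R : Rates S) : R.IsSemigroupOfA R.expA := by
  have h := R.existsUnique_semigroup
  rw [expA, dif_pos h]
  exact h.choose_spec.1

/-! ### Right-continuous processes -/

/-- The time is rounded up to the grid of mesh `1/(n+1)`. The rounded process takes countably many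
times and is jointly measurable; it converges by right-continuity. -/
theorem measurable_uncurry_of_rightContinuous {Ω : Type*} [MeasurableSpace Ω] {X : ℝ≥0 → Ω → ℝ}
    (hX : ∀ t, Measurable (X t))
    (hc : ∀ ω t, ContinuousWithinAt (fun t => X t ω) (Set.Ici t) t) :
    Measurable (Function.uncurry X) := by
  let d : ℕ → ℕ → ℝ≥0 := fun n m => ((m : ℝ≥0) + 1) / ((n : ℝ≥0) + 1)
  have hd : ∀ n m, d n m = ((m : ℝ≥0) + 1) / ((n : ℝ≥0) + 1) := fun _ _ => rfl
  clear_value d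
  have h1 : ∀ n : ℕ, Measurable fun p : ℝ≥0 × Ω =>
      X (d n ⌊((n : ℝ≥0) + 1) * p.1⌋₊) p.2 := by
    intro n
    have h2 : Measurable fun q : ℕ × Ω => X (d n q.1) q.2 :=
      measurable_from_prod_countable_right fun m => hX (d n m)
    have h3 : Measurable fun p : ℝ≥0 × Ω => (⌊((n : ℝ≥0) + 1) * p.1⌋₊, p.2) :=
      (Nat.measurable_floor.comp (measurable_fst.const_mul _)).prodMk measurable_snd
    exact h2.comp h3
  refine measurable_of_tendsto_metrizable h1 (tendsto_pi_nhds.mpr fun p => ?_)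
  have hlim : Tendsto (fun n : ℕ => d n ⌊((n : ℝ≥0) + 1) * p.1⌋₊) atTop (𝓝[≥] p.1) := by
    have hge : ∀ n : ℕ, p.1 ≤ d n ⌊((n : ℝ≥0) + 1) * p.1⌋₊ := fun n => by
      rw [hd]
      rw [le_div_iff₀ (by positivity), mul_comm]
      exact (Nat.lt_floor_add_one _).le
    have hle : ∀ n : ℕ, d n ⌊((n : ℝ≥0) + 1) * p.1⌋₊ ≤ p.1 + 1 / ((n : ℝ≥0) + 1) := fun n => by
      rw [hd]
      rw [add_div]
      gcongr
      rw [div_le_iff₀ (by positivity), mul_comm]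
      exact Nat.floor_le (by positivity)
    refine tendsto_nhdsWithin_iff.mpr ⟨?_, Eventually.of_forall hge⟩
    refine tendsto_of_tendsto_of_tendsto_of_le_of_le tendsto_const_nhds ?_ hge hle
    have : Tendsto (fun n : ℕ => 1 / ((n : ℝ≥0) + 1)) atTop (𝓝 0) :=
      tendsto_one_div_add_atTop_nhds_zero_nat
    simpa using this.const_add p.1
  exact (hc p.2 p.1).tendsto.comp hlim

section Fubini

variable {Ω : Type*} [MeasurableSpace Ω] {P : Measure Ω} [IsProbabilityMeasure P]
  {X : ℝ≥0 → Ω → ℝ} {Z : Ω → ℝ}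

theorem measurable_integral_mul (hX : ∀ t, Measurable (X t))
    (hc : ∀ ω t, ContinuousWithinAt (fun t => X t ω) (Set.Ici t) t) (hZ : Measurable Z) :
    Measurable fun r : ℝ => ∫ ω, X r.toNNReal ω * Z ω ∂P := by
  have h1 : Measurable fun p : ℝ × Ω => X p.1.toNNReal p.2 * Z p.2 :=
    ((measurable_uncurry_of_rightContinuous hX hc).comp
      ((measurable_real_toNNReal.comp measurable_fst).prodMk measurable_snd)).mul
      (hZ.comp measurable_snd)
  exact h1.stronglyMeasurable.integral_prod_right.measurable

theorem integral_intervalIntegral_mul (hX : ∀ t, Measurable (X t))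
    (hc : ∀ ω t, ContinuousWithinAt (fun t => X t ω) (Set.Ici t) t) (hZ : Measurable Z)
    (hint : ∀ s, Integrable (fun ω => X s ω * Z ω) P) {C : ℝ}
    (hC : ∀ s, ∫ ω, ‖X s ω * Z ω‖ ∂P ≤ C) (t : ℝ≥0) :
    Integrable (fun ω => (∫ s in (0 : ℝ)..t, X s.toNNReal ω) * Z ω) P ∧
    ∫ ω, (∫ s in (0 : ℝ)..t, X s.toNNReal ω) * Z ω ∂P
      = ∫ s in (0 : ℝ)..t, ∫ ω, X s.toNNReal ω * Z ω ∂P := by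
  have h1 : Measurable fun p : ℝ × Ω => X p.1.toNNReal p.2 * Z p.2 :=
    ((measurable_uncurry_of_rightContinuous hX hc).comp
      ((measurable_real_toNNReal.comp measurable_fst).prodMk measurable_snd)).mul
      (hZ.comp measurable_snd)
  have h2 : Integrable (fun p : ℝ × Ω => X p.1.toNNReal p.2 * Z p.2)
      ((volume.restrict (Set.Ioc (0 : ℝ) t)).prod P) := by
    rw [integrable_prod_iff h1.aestronglyMeasurable]
    refine ⟨Eventually.of_forall fun r => ?_, ?_⟩
    · exact hint r.toNNReal
    refine Integrable.of_bound (C := C)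
      h1.stronglyMeasurable.norm.integral_prod_right.aestronglyMeasurable
      (Eventually.of_forall fun r => ?_)
    rw [Real.norm_of_nonneg (integral_nonneg fun _ => norm_nonneg _)]
    exact hC r.toNNReal
  have e : ∀ ω, (∫ s in (0 : ℝ)..t, X s.toNNReal ω) * Z ω
      = ∫ s in Set.Ioc (0 : ℝ) t, X s.toNNReal ω * Z ω := fun ω => by
    rw [intervalIntegral.integral_of_le t.coe_nonneg, integral_mul_const]
  simp_rw [e]
  refine ⟨h2.integral_prod_right, ?_⟩
  rw [intervalIntegral.integral_of_le t.coe_nonneg]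
  exact (integral_integral_swap h2).symm

end Fubini

/-! ### Evolutions from integral equations -/

/-- The integral equation is inserted into itself: the second-order remainder is the integral over
`[s, s+h]` of `F r (Gψ) - F s (Gψ)`, itself an integral of `F u (G (G ψ))` over a length at most
`h`. Boundedness and measurability in time are enough. -/
theorem Evolution.of_integral {G : TestFn S → TestFn S} {F : ℝ≥0 → TestFn S →ₗ[ℝ] ℝ} {B : ℝ}
    (hB : 0 ≤ B) (hbound : ∀ s M ψ, 0 ≤ M → WB M ψ → |F s ψ| ≤ B * M)
    (hmeas : ∀ ψ, Measurable fun r : ℝ => F r.toNNReal ψ)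
    (heq : ∀ (t : ℝ≥0) ψ, F t ψ = F 0 ψ + ∫ r in (0 : ℝ)..t, F r.toNNReal (G ψ)) :
    Evolution G F B where
  bound := hbound
  step s h M ψ hM hψ := by
    have hint : ∀ ψ a b, IntervalIntegrable (fun r : ℝ => F r.toNNReal ψ) volume a b := by
      intro ψ a b
      obtain ⟨C, hC, hψ⟩ := exists_wb ψ
      refine (intervalIntegrable_const (c := B * C)).mono_fun
        (hmeas ψ).aestronglyMeasurable (Eventually.of_forall fun r => ?_)
      rw [Real.norm_of_nonneg (mul_nonneg hB hC)]
      exact hbound _ _ _ hC hψ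
    have hdiff : ∀ (a b : ℝ≥0) ψ, F b ψ - F a ψ = ∫ r in (a : ℝ)..b, F r.toNNReal (G ψ) := by
      intro a b ψ
      rw [heq b, heq a, ← intervalIntegral.integral_interval_sub_left (hint _ 0 b) (hint _ 0 a)]
      ring
    have h1 : F (s + h) ψ - F s ψ - (h : ℝ) • F s (G ψ)
        = ∫ r in (s : ℝ)..(s + h : ℝ≥0), (F r.toNNReal (G ψ) - F s (G ψ)) := by
      rw [intervalIntegral.integral_sub (hint _ _ _) intervalIntegrable_const, ← hdiff,
        intervalIntegral.integral_const]
      push_cast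
      rw [add_sub_cancel_left]
    have h2 : ∀ r ∈ Set.uIoc (s : ℝ) (s + h : ℝ≥0), ‖F r.toNNReal (G ψ) - F s (G ψ)‖
        ≤ B * M * h := by
      intro r hr
      rw [Set.uIoc_of_le (by exact_mod_cast le_self_add)] at hr
      have hr0 : 0 ≤ r := s.coe_nonneg.trans hr.1.le
      rw [hdiff]
      refine (intervalIntegral.norm_integral_le_of_norm_le_const (C := B * M)
        fun u _ => hbound _ _ _ hM hψ).trans ?_
      rw [Real.coe_toNNReal r hr0, abs_of_nonneg (by linarith [hr.1])]
      have := hr.2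
      push_cast at this
      exact mul_le_mul_of_nonneg_left (by linarith) (mul_nonneg hB hM)
    rw [h1]
    refine (intervalIntegral.norm_integral_le_of_norm_le_const h2).trans (le_of_eq ?_)
    push_cast
    rw [add_sub_cancel_left, abs_of_nonneg h.coe_nonneg]
    ring

/-! ### The law of one particle -/

/-- The restriction of a test function to the rescaled lattice. -/
def onLattice (N : ℕ) (φ : TestFn S) (v : Site S) : ℝ := φ v.2 ((v.1 : ℝ) / (N : ℝ))

/-- No discretization error arises: the lattice generator is exactly `discA N` read on the rescaled
lattice, so the particle is an evolution along `discA N`. -/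
theorem siteGenerator_onLattice (R : Rates S) {N : ℕ} (φ : TestFn S) (v : Site S) :
    R.siteGenerator N (onLattice N φ) v = onLattice N (R.discA N φ) v := by
  simp only [Rates.siteGenerator, onLattice, R.discA_apply]
  push_cast
  rw [add_div, sub_div, add_div]

theorem abs_onLattice_le {N : ℕ} {M : ℝ} {φ : TestFn S} (hφ : WB M φ) (v : Site S) :
    |onLattice N φ v| ≤ M * wt ((v.1 : ℝ) / N) := hφ _ _

theorem exists_bound_onLattice (N : ℕ) (φ : TestFn S) : ∃ C, ∀ v, |onLattice N φ v| ≤ C := by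
  obtain ⟨M, hM, hφ⟩ := exists_wb φ
  exact ⟨M, fun v => hφ.abs_le hM _ _⟩

section Particle

variable {R : Rates S} {N : ℕ} {Ω : Type*} [MeasurableSpace Ω] {P : Measure Ω}
  {v : Site S} {X : ℝ≥0 → Ω → Site S}

theorem Rates.IsParticle.measurable_comp (hX : R.IsParticle N P v X) (f : Site S → ℝ) (t : ℝ≥0) :
    Measurable fun ω => f (X t ω) := (Measurable.of_discrete (f := f)).comp (hX.measurable t)

variable [IsProbabilityMeasure P]

theorem Rates.IsParticle.integrable_comp (hX : R.IsParticle N P v X) {f : Site S → ℝ} {C : ℝ}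
    (hf : ∀ w, |f w| ≤ C) (t : ℝ≥0) : Integrable (fun ω => f (X t ω)) P :=
  Integrable.of_bound (hX.measurable_comp f t).aestronglyMeasurable C
    (Eventually.of_forall fun _ => hf _)

/-- Dynkin's formula: the martingale vanishes at time zero and therefore has mean zero. -/
theorem Rates.IsParticle.integral_eq (hX : R.IsParticle N P v X) {f : Site S → ℝ} {C C' : ℝ}
    (hf : ∀ w, |f w| ≤ C) (hf' : ∀ w, |R.siteGenerator N f w| ≤ C') (t : ℝ≥0) :
    ∫ ω, f (X t ω) ∂P
      = f v + ∫ s in (0 : ℝ)..t, ∫ ω, R.siteGenerator N f (X s.toNNReal ω) ∂P := by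
  have hc : ∀ ω t, ContinuousWithinAt (fun t => R.siteGenerator N f (X t ω)) (Set.Ici t) t :=
    fun ω t => ContinuousAt.comp_continuousWithinAt
      (continuous_of_discreteTopology (f := R.siteGenerator N f)).continuousAt (hX.cadlag ω t).1
  have h1 := integral_intervalIntegral_mul (P := P) (Z := fun _ => 1)
    (fun t => hX.measurable_comp (R.siteGenerator N f) t) hc measurable_const
    (fun s => by simpa using hX.integrable_comp hf' s) (C := C') (fun s => by
      simp only [mul_one]
      refine (integral_mono (hX.integrable_comp hf' s).norm (integrable_const C')
        fun ω => hf' _).trans ?_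
      simp) t
  simp only [mul_one] at h1
  have h2 : ∫ ω, (f (X t ω) - f (X 0 ω)
      - ∫ s in (0 : ℝ)..t, R.siteGenerator N f (X s.toNNReal ω)) ∂P = 0 := by
    have hm := hX.martingale f ⟨C, hf⟩
    have h3 := hm.setIntegral_eq (zero_le : 0 ≤ t) (s := Set.univ) MeasurableSet.univ
    simpa using h3.symm
  have h4 : ∫ ω, f (X 0 ω) ∂P = f v := by
    rw [integral_congr_ae (g := fun _ => f v) (hX.start.mono fun ω hω => by simp only [hω])]
    simp
  have h5 : Integrable (fun ω => f (X t ω) - f (X 0 ω)) P :=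
    (hX.integrable_comp hf t).sub (hX.integrable_comp hf 0)
  rw [integral_sub h5 h1.1,
    integral_sub (hX.integrable_comp hf t) (hX.integrable_comp hf 0), h1.2, h4] at h2
  linarith

/-- The expectation `ψ ↦ E ψ(X_t / N)`. -/
def Rates.IsParticle.mean (hX : R.IsParticle N P v X) (t : ℝ≥0) : TestFn S →ₗ[ℝ] ℝ where
  toFun ψ := ∫ ω, onLattice N ψ (X t ω) ∂P
  map_add' φ ψ := by
    obtain ⟨C, hC⟩ := exists_bound_onLattice N φ
    obtain ⟨C', hC'⟩ := exists_bound_onLattice N ψ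
    exact integral_add (hX.integrable_comp hC t) (hX.integrable_comp hC' t)
  map_smul' a φ := integral_const_mul a _

theorem Rates.IsParticle.mean_apply (hX : R.IsParticle N P v X) (t : ℝ≥0) (ψ : TestFn S) :
    hX.mean t ψ = ∫ ω, onLattice N ψ (X t ω) ∂P := rfl

theorem Rates.IsParticle.mean_zero (hX : R.IsParticle N P v X) (ψ : TestFn S) :
    hX.mean 0 ψ = onLattice N ψ v := by
  rw [hX.mean_apply, integral_congr_ae (g := fun _ => onLattice N ψ v)
    (hX.start.mono fun ω hω => by simp only [hω])]
  simp

theorem Rates.IsParticle.evolution (hX : R.IsParticle N P v X) :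
    Evolution (R.discA N) hX.mean 1 := by
  have hb : ∀ s M ψ, 0 ≤ M → WB M ψ → |hX.mean s ψ| ≤ 1 * M := by
    intro s M ψ hM hψ
    rw [one_mul]
    have := norm_integral_le_of_norm_le_const (μ := P) (C := M)
      (f := fun ω => onLattice N ψ (X s ω))
      (Eventually.of_forall fun ω => hψ.abs_le hM (X s ω).2 ((X s ω).1 / (N : ℝ)))
    simpa [hX.mean_apply] using this
  refine Evolution.of_integral zero_le_one hb (fun ψ => ?_) fun t ψ => ?_
  · have hc : ∀ ω t, ContinuousWithinAt (fun t => onLattice N ψ (X t ω)) (Set.Ici t) t :=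
      fun ω t => ContinuousAt.comp_continuousWithinAt
        (continuous_of_discreteTopology (f := onLattice N ψ)).continuousAt (hX.cadlag ω t).1
    have := measurable_integral_mul (P := P) (Z := fun _ => 1)
      (fun t => hX.measurable_comp (onLattice N ψ) t) hc measurable_const
    simpa [hX.mean_apply] using this
  · obtain ⟨C, hC⟩ := exists_bound_onLattice N ψ
    obtain ⟨C', hC'⟩ := exists_bound_onLattice N (R.discA N ψ)
    have := hX.integral_eq hC (C' := C') (fun w => by rw [siteGenerator_onLattice]; exact hC' w) t
    simp only [siteGenerator_onLattice] at this
    rw [hX.mean_zero]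
    exact this

/-- Uniform closeness of `E φ(X_t / N)` to `e^{tA} φ`. -/
theorem Rates.IsParticle.abs_mean_sub_le (hX : R.IsParticle N P v X) (hN : 1 ≤ N) (t : ℝ≥0)
    {M : ℝ} (hM : 0 ≤ M) {φ : TestFn S} (hφ : DB 6 M φ) :
    |hX.mean t φ - R.expA t φ.toCZero v.2 ((v.1 : ℝ) / N)| ≤ R.eulerConst t * M * (3 / N) := by
  -- With Euler parameter `n = N`, the particle contributes the error `1/N + 1/N` and the semigroup
  -- another `1/N`.
  have h1 := hX.evolution.norm_sub_eulerApprox_le zero_le_one (by positivity)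
    (R.isApprox_discA hN) hN t hM hφ
  have h2 := R.isSemigroupOfA_expA.norm_sub_eulerApprox_le hN t hM hφ
  have h3 := (CZero.abs_apply_le (R.expA t φ.toCZero - (R.eulerApprox N t φ).toCZero) v.2
    ((v.1 : ℝ) / N)).trans h2
  rw [hX.mean_zero, Real.norm_eq_abs, one_mul] at h1
  change |R.expA t φ.toCZero v.2 ((v.1 : ℝ) / N) - onLattice N (R.eulerApprox N t φ) v| ≤ _ at h3
  rw [abs_sub_comm] at h3
  refine (abs_sub_le _ (onLattice N (R.eulerApprox N t φ) v) _).trans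
    ((add_le_add h1 h3).trans (le_of_eq ?_))
  ring

/-- At time zero the mean is evaluation at `v`, so the constant `K` may be taken to be `wt (v/N)`.
This decay in the starting point replaces tail estimates for the displacement of a particle. -/
theorem Rates.IsParticle.abs_mean_le (hX : R.IsParticle N P v X) (hN : 1 ≤ N) (t : ℝ≥0)
    {M : ℝ} (hM : 0 ≤ M) {φ : TestFn S} (hφ : WB M φ) :
    |hX.mean t φ| ≤ wt ((v.1 : ℝ) / N) * (Real.exp (t * R.growth) * M) :=
  hX.evolution.le_of_discA hN t hM (fun M' ψ hM' hψ => by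
    rw [hX.mean_zero, mul_comm]; exact abs_onLattice_le hψ v) hφ

/-- The absolute value of a test function need not be smooth; a multiple of a bump function equal to
1 on the support stands in for it. -/
theorem exists_dominating (φ : TestFn S) : ∃ χ : TestFn S, ∀ σ x, |φ σ x| ≤ χ σ x := by
  have : ∀ σ, ∃ g : 𝓓((⊤ : TopologicalSpace.Opens ℝ), ℝ), ∀ x, |φ σ x| ≤ g x := by
    intro σ
    obtain ⟨r, hr0, hr⟩ := (φ σ).hasCompactSupport.isCompact.isBounded.subset_closedBall_lt 0 0
    obtain ⟨C, hC⟩ := (φ σ).continuous.bounded_above_of_compact_support (φ σ).hasCompactSupport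
    have hC0 : 0 ≤ C := (norm_nonneg _).trans (hC 0)
    let f : ContDiffBump (0 : ℝ) := ⟨r, r + 1, hr0, by linarith⟩
    refine ⟨⟨fun x => C * f x, contDiff_const.mul f.contDiff, f.hasCompactSupport.mul_left,
      by simp⟩, fun x => ?_⟩
    change |φ σ x| ≤ C * f x
    by_cases hx : x ∈ tsupport (φ σ)
    · rw [f.one_of_mem_closedBall (hr hx), mul_one]
      exact hC x
    · rw [image_eq_zero_of_notMem_tsupport hx, abs_zero]
      exact mul_nonneg hC0 f.nonneg
  choose g hg using this
  exact ⟨g, hg⟩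

/-- `E |φ(X_t / N)|` is summable over the starting points. -/
theorem exists_integral_abs_le (R : Rates S) {N : ℕ} (hN : 1 ≤ N) (t : ℝ≥0) (φ : TestFn S) :
    ∃ C, 0 ≤ C ∧ ∀ (Ω : Type*) [MeasurableSpace Ω] (P : Measure Ω) [IsProbabilityMeasure P]
      (v : Site S) (X : ℝ≥0 → Ω → Site S), R.IsParticle N P v X →
      ∫ ω, |onLattice N φ (X t ω)| ∂P ≤ C * wt ((v.1 : ℝ) / N) := by
  obtain ⟨χ, hχ⟩ := exists_dominating φ
  obtain ⟨M, hM, hχM⟩ := exists_wb χ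
  refine ⟨Real.exp (t * R.growth) * M, by positivity, fun Ω _ P _ v X hX => ?_⟩
  obtain ⟨C, hC⟩ := exists_bound_onLattice N φ
  obtain ⟨C', hC'⟩ := exists_bound_onLattice N χ
  have h1 : ∫ ω, |onLattice N φ (X t ω)| ∂P ≤ hX.mean t χ :=
    integral_mono (hX.integrable_comp hC t).abs (hX.integrable_comp hC' t) fun ω => hχ _ _
  rw [mul_comm]
  exact h1.trans ((le_abs_self _).trans (hX.abs_mean_le hN t hM hχM))

end Particle

/-! ### Riemann sums -/

theorem finite_support_comp_div {N : ℕ} (hN : 1 ≤ N) {f : ℝ → ℝ} (hf : HasCompactSupport f) :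
    (Function.support fun k : ℤ => f ((k : ℝ) / N)).Finite := by
  obtain ⟨r, hr⟩ := hf.isCompact.isBounded.subset_closedBall 0
  have hN' : (0 : ℝ) < N := by exact_mod_cast hN
  refine (Set.finite_Icc (-⌈r * N⌉) ⌈r * N⌉).subset fun k hk => ?_
  have h1 := hr (subset_closure hk)
  rw [Metric.mem_closedBall, dist_zero_right, Real.norm_eq_abs, abs_div, abs_of_pos hN',
    div_le_iff₀ hN'] at h1
  have h2 := abs_le.mp (h1.trans (Int.le_ceil _))
  exact ⟨by exact_mod_cast h2.1, by exact_mod_cast h2.2⟩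

theorem integral_comp_floor {g : ℤ → ℝ} (hg : (Function.support g).Finite) :
    ∫ y : ℝ, g ⌊y⌋ = ∑' k, g k := by
  have h1 : ∀ y : ℝ, g ⌊y⌋ = ∑ k ∈ hg.toFinset,
      (Set.Ico (k : ℝ) (k + 1)).indicator (fun _ => g k) y := by
    intro y
    have h2 : ∀ k : ℤ, (Set.Ico (k : ℝ) (k + 1)).indicator (fun _ => g k) y
        = if ⌊y⌋ = k then g k else 0 := fun k => by
      rw [Set.indicator_apply]
      simp only [Int.floor_eq_iff, Set.mem_Ico]
    simp_rw [h2]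
    rw [Finset.sum_ite_eq]
    split_ifs with h
    · rfl
    · simpa using h
  simp_rw [h1]
  rw [integral_finsetSum, tsum_eq_sum (s := hg.toFinset)]
  · refine Finset.sum_congr rfl fun k _ => ?_
    rw [integral_indicator measurableSet_Ico, setIntegral_const]
    simp
  · intro k hk
    simpa using hk
  · intro k _
    exact (integrable_indicator_iff measurableSet_Ico).mpr
      (integrableOn_const (by simp))

/-- The Riemann sum is the integral of a step function, so its convergence reduces to dominated
convergence. -/
theorem riemannSum_eq_integral {N : ℕ} (hN : 1 ≤ N) {f : ℝ → ℝ} (hf : HasCompactSupport f) :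
    (N : ℝ)⁻¹ * ∑' k : ℤ, f ((k : ℝ) / N) = ∫ x : ℝ, f ((⌊(N : ℝ) * x⌋ : ℝ) / N) := by
  have hN' : (0 : ℝ) < N := by exact_mod_cast hN
  rw [← integral_comp_floor (finite_support_comp_div hN hf),
    Measure.integral_comp_mul_left (fun y : ℝ => f ((⌊y⌋ : ℝ) / N)) (N : ℝ),
    abs_of_pos (inv_pos.mpr hN'), smul_eq_mul]

theorem tendsto_riemannSum {f : ℝ → ℝ} (hc : Continuous f) (hf : HasCompactSupport f) :
    Tendsto (fun N : ℕ => (N : ℝ)⁻¹ * ∑' k : ℤ, f ((k : ℝ) / N)) atTop (𝓝 (∫ x, f x)) := by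
  obtain ⟨r, hr⟩ := hf.isCompact.isBounded.subset_closedBall 0
  obtain ⟨C, hC⟩ := hc.bounded_above_of_compact_support hf
  have hclose : ∀ N : ℕ, 1 ≤ N → ∀ x : ℝ, |(⌊(N : ℝ) * x⌋ : ℝ) / N - x| ≤ 1 / N := by
    intro N hN x
    have hN' : (0 : ℝ) < N := by exact_mod_cast hN
    have e : (⌊(N : ℝ) * x⌋ : ℝ) / N - x = ((⌊(N : ℝ) * x⌋ : ℝ) - N * x) / N := by
      field_simp
    rw [e, abs_div, abs_of_pos hN']
    gcongr
    rw [abs_le]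
    constructor <;> linarith [Int.floor_le ((N : ℝ) * x), Int.lt_floor_add_one ((N : ℝ) * x)]
  have h1 : Tendsto (fun N : ℕ => ∫ x : ℝ, f ((⌊(N : ℝ) * x⌋ : ℝ) / N)) atTop
      (𝓝 (∫ x, f x)) := by
    -- The interval is enlarged by 1 because grid points lie within `1/N ≤ 1` of `x`.
    refine tendsto_integral_filter_of_dominated_convergence
      ((Set.Icc (-(r + 1)) (r + 1)).indicator fun _ => C) ?_ ?_ ?_ ?_
    · refine Eventually.of_forall fun N => (hc.measurable.comp ?_).aestronglyMeasurable
      exact ((measurable_from_top (f := fun k : ℤ => (k : ℝ))).comp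
        (Int.measurable_floor.comp (measurable_id.const_mul _))).div_const _
    · filter_upwards [eventually_ge_atTop 1] with N hN
      refine Eventually.of_forall fun x => ?_
      by_cases hx : x ∈ Set.Icc (-(r + 1)) (r + 1)
      · rw [Set.indicator_of_mem hx]
        exact hC _
      · rw [Set.indicator_of_notMem hx]
        have : f ((⌊(N : ℝ) * x⌋ : ℝ) / N) = 0 := by
          by_contra hne
          have h2 := hr (subset_closure hne)
          rw [Metric.mem_closedBall, dist_zero_right, Real.norm_eq_abs] at h2
          have h3 := hclose N hN x
          have h4 : (1 : ℝ) / N ≤ 1 := by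
            rw [div_le_one (by exact_mod_cast hN)]; exact_mod_cast hN
          apply hx
          rw [abs_le] at h2 h3
          constructor <;> linarith [h2.1, h2.2, h3.1, h3.2]
        rw [this, norm_zero]
    · exact (integrable_indicator_iff measurableSet_Icc).mpr
        (integrableOn_const (by simp))
    · refine Eventually.of_forall fun x => (hc.tendsto x).comp ?_
      rw [tendsto_iff_dist_tendsto_zero]
      refine squeeze_zero' (Eventually.of_forall fun _ => dist_nonneg) ?_
        tendsto_one_div_atTop_nhds_zero_nat
      filter_upwards [eventually_ge_atTop 1] with N hN
      exact hclose N hN x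
  refine h1.congr' ?_
  filter_upwards [eventually_ge_atTop 1] with N hN
  exact (riemannSum_eq_integral hN hf).symm

theorem finite_support_site {N : ℕ} (hN : 1 ≤ N) {f : S → ℝ → ℝ}
    (hf : ∀ σ, HasCompactSupport (f σ)) :
    (Function.support fun v : Site S => f v.2 ((v.1 : ℝ) / N)).Finite := by
  have h1 : (⋃ σ : S, (fun k : ℤ => (k, σ)) ''
      (Function.support fun k : ℤ => f σ ((k : ℝ) / N))).Finite :=
    Set.finite_iUnion fun σ => (finite_support_comp_div hN (hf σ)).image _
  refine h1.subset fun v hv => Set.mem_iUnion.mpr ⟨v.2, v.1, hv, rfl⟩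

theorem tendsto_riemannSum_site {f : S → ℝ → ℝ} (hc : ∀ σ, Continuous (f σ))
    (hf : ∀ σ, HasCompactSupport (f σ)) :
    Tendsto (fun N : ℕ => (N : ℝ)⁻¹ * ∑' v : Site S, f v.2 ((v.1 : ℝ) / N)) atTop
      (𝓝 (∑ σ, ∫ x, f σ x)) := by
  have h1 := tendsto_finsetSum Finset.univ fun σ (_ : σ ∈ Finset.univ) =>
    tendsto_riemannSum (hc σ) (hf σ)
  refine h1.congr' ?_
  filter_upwards [eventually_ge_atTop 1] with N hN
  have hs : Summable fun v : Site S => f v.2 ((v.1 : ℝ) / N) :=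
    summable_of_hasFiniteSupport (finite_support_site hN hf)
  rw [← Finset.mul_sum, hs.tsum_prod' fun k => Summable.of_finite]
  simp_rw [tsum_fintype]
  rw [Summable.tsum_finsetSum fun σ _ =>
    summable_of_hasFiniteSupport (finite_support_comp_div hN (hf σ))]

/-! ### Moments of the product Poisson measure -/

/-- Since `n / n! = 1 / (n-1)!`, a shift of the index reduces each moment to the preceding ones. -/
theorem hasSum_mul_poisson (r : ℝ≥0) :
    HasSum (fun n : ℕ => Real.exp (-r) * r ^ n / n.factorial * (n : ℝ)) r := by
  rw [← hasSum_nat_add_iff' 1]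
  have h := (hasSum_one_poissonMeasure r).mul_left (r : ℝ)
  simp only [Finset.range_one, Finset.sum_singleton, Nat.cast_zero, mul_zero, sub_zero]
  rw [mul_one] at h
  convert! h using 1
  funext n
  rw [Nat.factorial_succ]
  push_cast
  field_simp
  ring

theorem hasSum_sq_poisson (r : ℝ≥0) :
    HasSum (fun n : ℕ => Real.exp (-r) * r ^ n / n.factorial * (n : ℝ) ^ 2) (r ^ 2 + r) := by
  rw [← hasSum_nat_add_iff' 1]
  have h := ((hasSum_mul_poisson r).mul_left (r : ℝ)).add
    ((hasSum_one_poissonMeasure r).mul_left (r : ℝ))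
  simp only [Finset.range_one, Finset.sum_singleton, Nat.cast_zero, ne_eq, OfNat.ofNat_ne_zero,
    not_false_eq_true, zero_pow, mul_zero, sub_zero]
  rw [mul_one, ← pow_two] at h
  convert! h using 1
  funext n
  rw [Nat.factorial_succ]
  push_cast
  field_simp
  ring

theorem integrable_cast_poisson (r : ℝ≥0) :
    Integrable (fun n : ℕ => (n : ℝ)) (poissonMeasure r) := by
  rw [integrable_poissonMeasure_iff]
  simpa using (hasSum_mul_poisson r).summable

theorem integrable_sq_poisson (r : ℝ≥0) :
    Integrable (fun n : ℕ => (n : ℝ) ^ 2) (poissonMeasure r) := by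
  rw [integrable_poissonMeasure_iff]
  simpa using (hasSum_sq_poisson r).summable

theorem integral_cast_poisson (r : ℝ≥0) : ∫ n : ℕ, (n : ℝ) ∂(poissonMeasure r) = r := by
  rw [integral_poissonMeasure]
  exact (hasSum_mul_poisson r).tsum_eq

theorem integral_sq_poisson (r : ℝ≥0) :
    ∫ n : ℕ, (n : ℝ) ^ 2 ∂(poissonMeasure r) = r ^ 2 + r := by
  rw [integral_poissonMeasure]
  exact (hasSum_sq_poisson r).tsum_eq

variable {ρ : ℝ≥0}

theorem memLp_two_cast_poisson (r : ℝ≥0) :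
    MemLp (fun n : ℕ => (n : ℝ)) 2 (poissonMeasure r) :=
  (memLp_two_iff_integrable_sq Measurable.of_discrete.aestronglyMeasurable).mpr
    (integrable_sq_poisson r)

theorem measurePreserving_eval (v : Site S) :
    MeasurePreserving (fun η : Site S → ℕ => η v) (poissonProduct S ρ) (poissonMeasure ρ) :=
  measurePreserving_eval_infinitePi _ v

theorem memLp_two_occupation (v : Site S) :
    MemLp (fun η : Site S → ℕ => (η v : ℝ)) 2 (poissonProduct S ρ) :=
  (memLp_two_cast_poisson ρ).comp_measurePreserving (measurePreserving_eval v)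

theorem integral_comp_eval (g : ℕ → ℝ) (v : Site S) :
    ∫ η : Site S → ℕ, g (η v) ∂(poissonProduct S ρ) = ∫ n, g n ∂(poissonMeasure ρ) := by
  rw [← (measurePreserving_eval (S := S) (ρ := ρ) v).map_eq,
    integral_map (measurable_pi_apply v).aemeasurable Measurable.of_discrete.aestronglyMeasurable]

theorem memLp_two_centered (v : Site S) :
    MemLp (fun η : Site S → ℕ => (η v : ℝ) - ρ) 2 (poissonProduct S ρ) :=
  (memLp_two_occupation v).sub (memLp_const _)

theorem integral_centered (v : Site S) :
    ∫ η : Site S → ℕ, ((η v : ℝ) - ρ) ∂(poissonProduct S ρ) = 0 := by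
  rw [integral_comp_eval (fun n => (n : ℝ) - ρ), integral_sub (integrable_cast_poisson ρ)
    (integrable_const _), integral_cast_poisson]
  simp

theorem iIndepFun_eval : iIndepFun (fun (v : Site S) (η : Site S → ℕ) => η v)
    (poissonProduct S ρ) :=
  iIndepFun_infinitePi (X := fun _ n => n) fun _ => measurable_id

/-- Off the diagonal this is independence and centering; on it, the Poisson variance equals the
mean. -/
theorem integral_occupation_mul_centered (v u : Site S) :
    ∫ η : Site S → ℕ, (η v : ℝ) * ((η u : ℝ) - ρ) ∂(poissonProduct S ρ)
      = if u = v then (ρ : ℝ) else 0 := by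
  split_ifs with h
  · subst h
    rw [integral_comp_eval (fun n => (n : ℝ) * ((n : ℝ) - ρ))]
    have e : ∀ n : ℕ, (n : ℝ) * ((n : ℝ) - ρ) = (n : ℝ) ^ 2 - ρ * n := fun n => by ring
    simp_rw [e]
    rw [integral_sub (integrable_sq_poisson ρ) ((integrable_cast_poisson ρ).const_mul _),
      integral_const_mul, integral_cast_poisson, integral_sq_poisson]
    ring
  · have hi : IndepFun (fun η : Site S → ℕ => η v) (fun η => η u) (poissonProduct S ρ) :=
      iIndepFun_eval.indepFun (Ne.symm h)
    have hi' := hi.comp (φ := fun n : ℕ => (n : ℝ)) (ψ := fun n : ℕ => (n : ℝ) - ρ)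
      Measurable.of_discrete Measurable.of_discrete
    have := hi'.integral_fun_mul_eq_mul_integral (memLp_two_occupation v).aestronglyMeasurable
      (memLp_two_centered u).aestronglyMeasurable
    simp only [Function.comp_apply] at this
    rw [this, integral_centered, mul_zero]

/-! ### The fluctuation field as a finite sum -/

theorem hasCompactSupport_testFn (φ : TestFn S) (σ : S) : HasCompactSupport fun x => φ σ x :=
  (φ σ).hasCompactSupport

theorem finite_support_onLattice {N : ℕ} (hN : 1 ≤ N) (φ : TestFn S) :
    (Function.support (onLattice N φ)).Finite :=
  finite_support_site hN fun σ => hasCompactSupport_testFn φ σ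

theorem tsum_centered_eq_sum (η : Site S → ℕ) {N : ℕ} (hN : 1 ≤ N) (φ : TestFn S) :
    ∑' v : Site S, ((η v : ℝ) - ρ) * φ v.2 ((v.1 : ℝ) / (N : ℝ))
      = ∑ v ∈ (finite_support_onLattice hN φ).toFinset, ((η v : ℝ) - ρ) * onLattice N φ v := by
  refine tsum_eq_sum fun v hv => ?_
  have : onLattice N φ v = 0 := by simpa using hv
  change _ * onLattice N φ v = 0
  rw [this, mul_zero]

theorem fluctuation_eq_sum (η : Site S → ℕ) {N : ℕ} (hN : 1 ≤ N) (φ : TestFn S) :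
    fluctuation N ρ η φ = (√(N : ℝ))⁻¹ *
      ∑ v ∈ (finite_support_onLattice hN φ).toFinset, ((η v : ℝ) - ρ) * onLattice N φ v := by
  rw [fluctuation, tsum_centered_eq_sum η hN φ]

theorem measurable_fluctuation {N : ℕ} (hN : 1 ≤ N) (φ : TestFn S) :
    Measurable fun η : Site S → ℕ => fluctuation N ρ η φ := by
  simp_rw [fluctuation_eq_sum _ hN φ]
  refine (Finset.measurable_fun_sum _ fun v _ => Measurable.mul_const ?_ _).const_mul _
  exact (Measurable.of_discrete (f := fun n : ℕ => (n : ℝ) - ρ)).comp (measurable_pi_apply v)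

theorem memLp_two_fluctuation {N : ℕ} (hN : 1 ≤ N) (φ : TestFn S) :
    MemLp (fun η : Site S → ℕ => fluctuation N ρ η φ) 2 (poissonProduct S ρ) := by
  simp_rw [fluctuation_eq_sum _ hN φ]
  have h : ∀ v : Site S, MemLp (fun η : Site S → ℕ => ((η v : ℝ) - ρ) * onLattice N φ v) 2
      (poissonProduct S ρ) := fun v => (memLp_two_centered v).mul_const _
  exact (memLp_finsetSum _ fun v _ => h v).const_mul _

theorem integral_occupation_mul_fluctuation {N : ℕ} (hN : 1 ≤ N) (ψ : TestFn S) (v : Site S) :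
    ∫ η : Site S → ℕ, (η v : ℝ) * fluctuation N ρ η ψ ∂(poissonProduct S ρ)
      = (√(N : ℝ))⁻¹ * (ρ * onLattice N ψ v) := by
  have e : ∀ η : Site S → ℕ, (η v : ℝ) * fluctuation N ρ η ψ = (√(N : ℝ))⁻¹ *
      ∑ u ∈ (finite_support_onLattice hN ψ).toFinset,
        ((η v : ℝ) * ((η u : ℝ) - ρ)) * onLattice N ψ u := fun η => by
    rw [fluctuation_eq_sum η hN, mul_left_comm, Finset.mul_sum]
    simp only [mul_assoc]
  simp_rw [e]
  rw [integral_const_mul, integral_finsetSum]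
  · simp_rw [integral_mul_const, integral_occupation_mul_centered, ite_mul, zero_mul]
    rw [Finset.sum_ite_eq']
    split_ifs with h
    · rfl
    · have : onLattice N ψ v = 0 := by simpa using h
      rw [this, mul_zero, mul_zero, mul_zero]
  · intro u _
    exact ((memLp_two_occupation v).integrable_mul (memLp_two_centered u)).mul_const _

theorem integrable_occupation_mul_fluctuation {N : ℕ} (hN : 1 ≤ N) (ψ : TestFn S) (v : Site S) :
    Integrable (fun η : Site S → ℕ => (η v : ℝ) * fluctuation N ρ η ψ) (poissonProduct S ρ) :=
  (memLp_two_occupation v).integrable_mul (memLp_two_fluctuation hN ψ)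

/-- The product is at most the sum of the squares; uniformity in `v` holds because all occupation
numbers have the same law. -/
theorem integral_abs_occupation_mul_fluctuation_le {N : ℕ} (hN : 1 ≤ N) (ψ : TestFn S) :
    ∃ C, 0 ≤ C ∧ ∀ v : Site S, ∫ η : Site S → ℕ, |(η v : ℝ) * fluctuation N ρ η ψ|
      ∂(poissonProduct S ρ) ≤ C := by
  have hF := (memLp_two_fluctuation (S := S) (ρ := ρ) hN ψ).integrable_sq
  refine ⟨((ρ : ℝ) ^ 2 + ρ) + ∫ η : Site S → ℕ, fluctuation N ρ η ψ ^ 2 ∂(poissonProduct S ρ),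
    by positivity, fun v => ?_⟩
  have hv := (memLp_two_occupation (S := S) (ρ := ρ) v).integrable_sq
  have e : ∫ η : Site S → ℕ, (η v : ℝ) ^ 2 ∂(poissonProduct S ρ) = (ρ : ℝ) ^ 2 + ρ := by
    rw [integral_comp_eval (fun n => (n : ℝ) ^ 2), integral_sq_poisson]
  rw [← e, ← integral_add hv hF]
  refine integral_mono (integrable_occupation_mul_fluctuation hN ψ v).abs (hv.add hF) fun η => ?_
  simp only [abs_mul]
  rw [← sq_abs (η v : ℝ), ← sq_abs (fluctuation N ρ η ψ)]
  nlinarith [sq_nonneg (|(η v : ℝ)| - |fluctuation N ρ η ψ|), sq_nonneg |(η v : ℝ)|,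
    sq_nonneg |fluctuation N ρ η ψ|]

end RunAndTumble

end

noncomputable section

namespace RunAndTumble

variable {S : Finset ℤ} {ρ : ℝ≥0}

/-! ### Summability -/

theorem summable_wt {N : ℕ} (hN : 1 ≤ N) : Summable fun v : Site S => wt ((v.1 : ℝ) / N) := by
  have hN' : (0 : ℝ) < N := by exact_mod_cast hN
  have h1 : Summable fun k : ℤ => wt ((k : ℝ) / N) := by
    have h2 : Summable fun k : ℤ => (N : ℝ) ^ 2 * (1 / (k : ℝ) ^ 2) + if k = 0 then 1 else 0 :=
      ((Real.summable_one_div_int_pow.mpr one_lt_two).mul_left _).add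
        (hasSum_ite_eq (0 : ℤ) (1 : ℝ)).summable
    refine Summable.of_nonneg_of_le (fun k : ℤ => (wt_pos ((k : ℝ) / N)).le) (fun k => ?_) h2
    rcases eq_or_ne k 0 with rfl | hk
    · simp [wt]
    · have hk' : 0 < (k : ℝ) ^ 2 := by positivity
      simp only [hk, if_false, add_zero]
      rw [wt, mul_one_div, ← inv_div ((k : ℝ) ^ 2) ((N : ℝ) ^ 2)]
      refine inv_anti₀ (by positivity) ?_
      rw [div_pow]
      linarith
  have h3 : Summable fun p : S × ℤ => wt ((p.2 : ℝ) / N) := by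
    rw [summable_prod_of_nonneg fun p : S × ℤ => (wt_pos ((p.2 : ℝ) / N)).le]
    exact ⟨fun _ => h1, .of_finite⟩
  exact (Equiv.prodComm (ℤ) S).summable_iff.mpr h3

/-- Used for sums over particle labels `(v, i)`: the sum over `i` is bounded uniformly in `v`, and
the weight in `v` is summable. -/
theorem summable_mul_of_sum_range_le {ι : Type*} {a : ι → ℕ → ℝ} {b : ι → ℝ} {C : ℝ}
    (ha : ∀ v i, 0 ≤ a v i) (hC : ∀ v k, ∑ i ∈ Finset.range k, a v i ≤ C) (hb : ∀ v, 0 ≤ b v)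
    (hs : Summable b) : Summable fun p : ι × ℕ => a p.1 p.2 * b p.1 := by
  have h1 : ∀ v, Summable fun i => a v i * b v := fun v =>
    Summable.mul_right (b v) (summable_of_sum_range_le (ha v) (hC v))
  refine (summable_prod_of_nonneg (f := fun p : ι × ℕ => a p.1 p.2 * b p.1)
    fun p => mul_nonneg (ha p.1 p.2) (hb p.1)).mpr ⟨h1, ?_⟩
  simp only [tsum_mul_right]
  exact Summable.of_nonneg_of_le (fun v => mul_nonneg (tsum_nonneg (ha v)) (hb v))
    (fun v => mul_le_mul_of_nonneg_right (Real.tsum_le_of_sum_range_le (ha v) (hC v)) (hb v))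
    (hs.mul_left C)

theorem integrable_of_hasSum {Ω ι : Type*} [Countable ι] [MeasurableSpace Ω] {P : Measure Ω}
    {F : ι → Ω → ℝ} {g : Ω → ℝ} (hg : AEStronglyMeasurable g P) (hF : ∀ i, Integrable (F i) P)
    (hs : Summable fun i => ∫ ω, ‖F i ω‖ ∂P) (h : ∀ᵐ ω ∂P, HasSum (fun i => F i ω) (g ω)) :
    Integrable g P ∧ HasSum (fun i => ∫ ω, F i ω ∂P) (∫ ω, g ω ∂P) := by
  constructor
  · refine ⟨hg, ?_⟩
    have h1 : ∫⁻ ω, ‖g ω‖ₑ ∂P ≤ ∫⁻ ω, ∑' i, ‖F i ω‖ₑ ∂P := by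
      refine lintegral_mono_ae (h.mono fun ω hω => ?_)
      rw [← hω.tsum_eq]
      exact enorm_tsum_le_tsum_enorm
    rw [lintegral_tsum fun i => (hF i).1.enorm] at h1
    refine h1.trans_lt ?_
    have h2 : ∀ i, ∫⁻ ω, ‖F i ω‖ₑ ∂P = ENNReal.ofReal (∫ ω, ‖F i ω‖ ∂P) := fun i => by
      rw [ofReal_integral_eq_lintegral_ofReal (hF i).norm
        (Eventually.of_forall fun _ => norm_nonneg _)]
      simp_rw [ofReal_norm]
    simp_rw [h2]
    rw [← ENNReal.ofReal_tsum_of_nonneg (fun i => integral_nonneg fun _ => norm_nonneg _) hs]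
    exact ENNReal.ofReal_lt_top
  · have h3 := hasSum_integral_of_summable_integral_norm hF hs
    rwa [integral_congr_ae (h.mono fun ω hω => hω.tsum_eq)] at h3

/-! ### Covariances of the particle system -/

theorem Evolution.sub {F F' : ℝ≥0 → TestFn S →ₗ[ℝ] ℝ} {G : TestFn S → TestFn S} {B B' : ℝ}
    (hF : Evolution G F B) (hF' : Evolution G F' B') :
    Evolution G (fun t => F t - F' t) (B + B') where
  bound s M ψ hM hψ := by
    rw [add_mul]
    exact (norm_sub_le _ _).trans (add_le_add (hF.bound s M ψ hM hψ) (hF'.bound s M ψ hM hψ))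
  step s h M ψ hM hψ := by
    have e : (F (s + h) - F' (s + h)) ψ - (F s - F' s) ψ - (h : ℝ) • (F s - F' s) (G ψ)
        = (F (s + h) ψ - F s ψ - (h : ℝ) • F s (G ψ))
          - (F' (s + h) ψ - F' s ψ - (h : ℝ) • F' s (G ψ)) := by
      simp only [LinearMap.sub_apply, smul_sub]
      abel
    rw [e]
    refine (norm_sub_le _ _).trans ((add_le_add (hF.step s h M ψ hM hψ)
      (hF'.step s h M ψ hM hψ)).trans (le_of_eq ?_))
    ring

/-- The difference of the means is an evolution with initial value zero, so the weighted bound holds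
with `K = 0`. -/
theorem Rates.IsParticle.mean_eq {R : Rates S} {N : ℕ} (hN : 1 ≤ N) {Ω : Type*}
    [MeasurableSpace Ω] {P : Measure Ω} [IsProbabilityMeasure P] {v : Site S}
    {X X' : ℝ≥0 → Ω → Site S} (hX : R.IsParticle N P v X) (hX' : R.IsParticle N P v X')
    (t : ℝ≥0) (φ : TestFn S) : hX.mean t φ = hX'.mean t φ := by
  obtain ⟨M, hM, hφ⟩ := exists_wb φ
  have := (hX.evolution.sub hX'.evolution).le_of_discA hN t hM (K := 0) (fun M' ψ hM' hψ => by
    simp [hX.mean_zero, hX'.mean_zero]) hφ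
  rw [zero_mul] at this
  exact sub_eq_zero.mp (abs_nonpos_iff.mp this)

/-! ### Sums over particle labels -/

theorem hasSum_ite_lt (m : ℕ) (a : ℝ) : HasSum (fun i : ℕ => if i < m then a else 0) (m * a) := by
  have h : HasSum (fun i : ℕ => if i < m then a else 0)
      (∑ i ∈ Finset.range m, if i < m then a else 0) :=
    hasSum_sum_of_ne_finset_zero fun i hi => if_neg (by simpa using hi)
  rwa [Finset.sum_congr rfl (g := fun _ => a) (fun i hi => if_pos (by simpa using hi)),
    Finset.sum_const, Finset.card_range, nsmul_eq_mul] at h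

section LabelSum

variable {Ω : Type*} [MeasurableSpace Ω] {P : Measure Ω} {n : Ω → ℕ} {U : Ω → ℝ}

theorem integrable_ite_lt (hn : Measurable n) (hU : Measurable U)
    (hint : Integrable (fun ω => (n ω : ℝ) * U ω) P) (i : ℕ) :
    Integrable (fun ω => if i < n ω then U ω else 0) P := by
  refine hint.mono (Measurable.ite (measurableSet_lt measurable_const hn) hU
    measurable_const).aestronglyMeasurable (Eventually.of_forall fun ω => ?_)
  split_ifs with h
  · rw [norm_mul]
    refine le_mul_of_one_le_left (norm_nonneg _) ?_
    rw [Real.norm_of_nonneg (Nat.cast_nonneg _)]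
    exact_mod_cast (by omega : 1 ≤ n ω)
  · rw [norm_zero]
    exact norm_nonneg _

theorem sum_integral_norm_ite_lt_le (hn : Measurable n) (hU : Measurable U)
    (hint : Integrable (fun ω => (n ω : ℝ) * U ω) P) (k : ℕ) :
    ∑ i ∈ Finset.range k, ∫ ω, ‖(if i < n ω then U ω else 0)‖ ∂P
      ≤ ∫ ω, |(n ω : ℝ) * U ω| ∂P := by
  rw [← integral_finsetSum _ fun i _ => (integrable_ite_lt hn hU hint i).norm]
  refine integral_mono (integrable_finsetSum _ fun i _ => (integrable_ite_lt hn hU hint i).norm)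
    hint.abs fun ω => ?_
  have h := hasSum_ite_lt (n ω) |U ω|
  have e : ∀ i, ‖(if i < n ω then U ω else 0)‖ = if i < n ω then |U ω| else 0 := fun i => by
    split_ifs <;> simp
  simp_rw [e]
  rw [abs_mul, abs_of_nonneg (Nat.cast_nonneg (n ω) : (0 : ℝ) ≤ n ω)]
  exact sum_le_hasSum _ (fun i _ => by split_ifs <;> simp) h

theorem hasSum_integral_ite_lt (hn : Measurable n) (hU : Measurable U)
    (hint : Integrable (fun ω => (n ω : ℝ) * U ω) P) :
    HasSum (fun i => ∫ ω, (if i < n ω then U ω else 0) ∂P) (∫ ω, (n ω : ℝ) * U ω ∂P) :=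
  (integrable_of_hasSum hint.1 (integrable_ite_lt hn hU hint)
    (summable_of_sum_range_le (fun _ => integral_nonneg fun _ => norm_nonneg _)
      (sum_integral_norm_ite_lt_le hn hU hint))
    (Eventually.of_forall fun ω => hasSum_ite_lt (n ω) (U ω))).2

end LabelSum

/-- Active labels are grouped by position. The equality in `ℕ∞` makes each group finite with `n w`
members, and only the finitely many sites in `F` contribute. -/
theorem hasSum_labels {ι : Type*} {n : Site S → ℕ} {act : Set ι} {pos : ι → Site S}
    (h : ∀ w, (n w : ℕ∞) = Set.encard {p | p ∈ act ∧ pos p = w}) {f : Site S → ℝ}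
    {F : Finset (Site S)} (hf : ∀ w ∉ F, f w = 0) :
    HasSum (fun p => act.indicator (fun p => f (pos p)) p) (∑ w ∈ F, (n w : ℝ) * f w) := by
  classical
  have h1 : ∀ w, HasSum (fun p => {p | p ∈ act ∧ pos p = w}.indicator (fun _ => f w) p)
      ((n w : ℝ) * f w) := by
    intro w
    have hfin : {p | p ∈ act ∧ pos p = w}.Finite := Set.finite_of_encard_eq_coe (h w).symm
    have hcard : hfin.toFinset.card = n w := by
      have h2 := h w
      rw [hfin.encard_eq_coe_toFinset_card] at h2
      exact_mod_cast h2.symm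
    have h3 : HasSum (fun p => {p | p ∈ act ∧ pos p = w}.indicator (fun _ => f w) p)
        (∑ p ∈ hfin.toFinset, {p | p ∈ act ∧ pos p = w}.indicator (fun _ => f w) p) :=
      hasSum_sum_of_ne_finset_zero fun p hp => Set.indicator_of_notMem (by simpa using hp) _
    have e : ∀ p ∈ hfin.toFinset, {p | p ∈ act ∧ pos p = w}.indicator (fun _ => f w) p = f w :=
      fun p hp => Set.indicator_of_mem (by simpa using hp) _
    rwa [Finset.sum_congr rfl e, Finset.sum_const, hcard, nsmul_eq_mul] at h3
  have h4 := hasSum_sum (s := F) fun w _ => h1 w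
  convert! h4 using 1
  funext p
  by_cases hp : p ∈ act
  · rw [Set.indicator_of_mem hp]
    by_cases hw : pos p ∈ F
    · rw [Finset.sum_eq_single (pos p)]
      · rw [Set.indicator_of_mem (show p ∈ {q | q ∈ act ∧ pos q = pos p} from ⟨hp, rfl⟩)]
      · intro w _ hne
        exact Set.indicator_of_notMem (fun hq => hne hq.2.symm) _
      · exact fun h => absurd hw h
    · rw [hf _ hw, Finset.sum_eq_zero]
      intro w hwF
      exact Set.indicator_of_notMem (fun hq => hw (by rw [hq.2]; exact hwF)) _
  · rw [Set.indicator_of_notMem hp, Finset.sum_eq_zero]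
    intro w _
    exact Set.indicator_of_notMem (fun hq => hp hq.1) _

theorem fluctuation_eq_sub {N : ℕ} (hN : 1 ≤ N) (η : Site S → ℕ) (φ : TestFn S) :
    fluctuation N ρ η φ = (√(N : ℝ))⁻¹ *
      (∑ v ∈ (finite_support_onLattice hN φ).toFinset, (η v : ℝ) * onLattice N φ v
        - ρ * ∑ v ∈ (finite_support_onLattice hN φ).toFinset, onLattice N φ v) := by
  rw [fluctuation_eq_sum η hN]
  congr 1
  rw [Finset.mul_sum, ← Finset.sum_sub_distrib]
  simp only [sub_mul]

theorem integral_fluctuation {N : ℕ} (hN : 1 ≤ N) (φ : TestFn S) :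
    ∫ η : Site S → ℕ, fluctuation N ρ η φ ∂(poissonProduct S ρ) = 0 := by
  simp_rw [fluctuation_eq_sum _ hN φ]
  rw [integral_const_mul, integral_finsetSum]
  · simp_rw [integral_mul_const, integral_centered, zero_mul]
    simp
  · intro v _
    exact ((memLp_two_centered v).integrable one_le_two).mul_const _

/-- The space-time covariance of the fluctuation field. -/
theorem Rates.IsSystem.covariance {R : Rates S} {N : ℕ} (hN : 1 ≤ N) {Ω : Type*}
    [MeasurableSpace Ω] {P : Measure Ω} [IsProbabilityMeasure P] {η : ℝ≥0 → Ω → Site S → ℕ}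
    (hη : R.IsSystem N ρ P η) (t : ℝ≥0) (φ ψ : TestFn S) {M : ℝ} (hM : 0 ≤ M) (hφ : DB 6 M φ) :
    Integrable (fun ω => fluctuation N ρ (η t ω) φ * fluctuation N ρ (η 0 ω) ψ) P ∧
    ∃ q : Site S → ℝ,
      (∀ v, |q v - R.expA t φ.toCZero v.2 ((v.1 : ℝ) / N)| ≤ R.eulerConst t * M * (3 / N)) ∧
      ∫ ω, fluctuation N ρ (η t ω) φ * fluctuation N ρ (η 0 ω) ψ ∂P
        = (N : ℝ)⁻¹ * ∑' v, ρ * onLattice N ψ v * q v := by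
  obtain ⟨X, hX, -, hind, hcount⟩ := hη.particles
  have hN' : (0 : ℝ) < N := by exact_mod_cast hN
  set U : Ω → ℝ := fun ω => fluctuation N ρ (η 0 ω) ψ with hU
  have hmp : MeasurePreserving (η 0) P (poissonProduct S ρ) := ⟨hη.measurable 0, hη.initial⟩
  have hUm : Measurable U := (measurable_fluctuation hN ψ).comp (hη.measurable 0)
  have hnm : ∀ v, Measurable fun ω => η 0 ω v := fun v =>
    (measurable_pi_apply v).comp (hη.measurable 0)
  have hint : ∀ v, Integrable (fun ω => (η 0 ω v : ℝ) * U ω) P := fun v =>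
    hmp.integrable_comp_of_integrable (integrable_occupation_mul_fluctuation hN ψ v)
  have hcomp : ∀ {g : (Site S → ℕ) → ℝ}, Measurable g →
      ∫ ω, g (η 0 ω) ∂P = ∫ ξ, g ξ ∂(poissonProduct S ρ) := fun {g} hg => by
    rw [← hη.initial, integral_map (hη.measurable 0).aemeasurable hg.aestronglyMeasurable]
  have hval : ∀ v, ∫ ω, (η 0 ω v : ℝ) * U ω ∂P
      = (√(N : ℝ))⁻¹ * (ρ * onLattice N ψ v) := fun v => by
    rw [← integral_occupation_mul_fluctuation hN ψ v]
    exact hcomp (((Measurable.of_discrete (f := fun n : ℕ => (n : ℝ))).comp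
      (measurable_pi_apply v)).mul (measurable_fluctuation hN ψ))
  obtain ⟨C₁, hC₁, hC₁'⟩ := integral_abs_occupation_mul_fluctuation_le (S := S) (ρ := ρ) hN ψ
  have habs : ∀ v, ∫ ω, |(η 0 ω v : ℝ) * U ω| ∂P ≤ C₁ := fun v => by
    refine le_trans (le_of_eq ?_) (hC₁' v)
    exact hcomp (g := fun ξ => |(ξ v : ℝ) * fluctuation N ρ ξ ψ|)
      (((Measurable.of_discrete (f := fun n : ℕ => (n : ℝ))).comp
      (measurable_pi_apply v)).mul (measurable_fluctuation hN ψ)).abs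
  obtain ⟨C₂, hC₂, hC₂'⟩ := exists_integral_abs_le R hN t φ
  obtain ⟨C₃, hC₃⟩ := exists_bound_onLattice N φ
  -- The contribution of one label splits into a function of `η 0` and a function of the trajectory,
  -- which are independent.
  set F : Site S × ℕ → Ω → ℝ := fun p ω =>
    (if p.2 < η 0 ω p.1 then U ω else 0) * onLattice N φ (X p.1 p.2 t ω) with hF
  have hFind : ∀ (p : Site S × ℕ) (f : Site S → ℝ),
      IndepFun (fun ω => if p.2 < η 0 ω p.1 then U ω else 0) (fun ω => f (X p.1 p.2 t ω)) P := by
    intro p f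
    have h1 : Measurable fun ξ : Site S → ℕ => if p.2 < ξ p.1 then fluctuation N ρ ξ ψ else 0 :=
      Measurable.ite (measurableSet_lt measurable_const (measurable_pi_apply _))
        (measurable_fluctuation hN ψ) measurable_const
    have h2 : Measurable fun x : Site S × ℕ → ℝ≥0 → Site S => f (x p t) :=
      (Measurable.of_discrete (f := f)).comp
        ((measurable_pi_apply t).comp (measurable_pi_apply p))
    exact hind.comp h1 h2
  have hI1 : ∀ p : Site S × ℕ, Integrable (fun ω => if p.2 < η 0 ω p.1 then U ω else 0) P :=
    fun p => integrable_ite_lt (hnm p.1) hUm (hint p.1) p.2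
  have hI2 : ∀ p : Site S × ℕ, Integrable (fun ω => onLattice N φ (X p.1 p.2 t ω)) P :=
    fun p => (hX p.1 p.2).integrable_comp hC₃ t
  have hFint : ∀ p, Integrable (F p) P := fun p =>
    (hFind p (onLattice N φ)).integrable_mul (hI1 p) (hI2 p)
  have hFnorm : ∀ p, ∫ ω, ‖F p ω‖ ∂P = (∫ ω, ‖(if p.2 < η 0 ω p.1 then U ω else 0)‖ ∂P)
      * ∫ ω, |onLattice N φ (X p.1 p.2 t ω)| ∂P := fun p => by
    have h1 := (hFind p (fun w => |onLattice N φ w|)).comp (φ := fun x : ℝ => ‖x‖) (ψ := id)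
      measurable_norm measurable_id
    have h2 := h1.integral_fun_mul_eq_mul_integral (hI1 p).1.norm (hI2 p).abs.1
    simp only [hF, norm_mul]
    exact h2
  -- Particles with the same starting site have the same mean, so the label `(v, 0)` represents them
  -- all and the sum over `i` can be carried out.
  have hFval : ∀ p, ∫ ω, F p ω ∂P = (∫ ω, (if p.2 < η 0 ω p.1 then U ω else 0) ∂P)
      * (hX p.1 0).mean t φ := fun p => by
    rw [(hX p.1 0).mean_eq hN (hX p.1 p.2)]
    exact (hFind p (onLattice N φ)).integral_fun_mul_eq_mul_integral (hI1 p).1 (hI2 p).1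
  have hsum : Summable fun p => ∫ ω, ‖F p ω‖ ∂P := by
    have h1 := (summable_mul_of_sum_range_le
      (a := fun v i => ∫ ω, ‖(if i < η 0 ω v then U ω else 0)‖ ∂P)
      (fun v i => integral_nonneg fun _ => norm_nonneg _)
      (fun v k => (sum_integral_norm_ite_lt_le (hnm v) hUm (hint v) k).trans (habs v))
      (fun v => (wt_pos ((v.1 : ℝ) / N)).le) (summable_wt hN)).mul_right C₂
    refine h1.of_nonneg_of_le (fun p => integral_nonneg fun _ => norm_nonneg _) fun p => ?_
    rw [hFnorm, mul_assoc, mul_comm (wt _)]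
    exact mul_le_mul_of_nonneg_left (hC₂' Ω P p.1 (X p.1 p.2) (hX p.1 p.2))
      (integral_nonneg fun _ => norm_nonneg _)
  set Z : Ω → ℝ := fun ω =>
    ∑ w ∈ (finite_support_onLattice hN φ).toFinset, (η t ω w : ℝ) * onLattice N φ w with hZ
  have hZm : Measurable Z := Finset.measurable_fun_sum _ fun w _ =>
    ((Measurable.of_discrete (f := fun n : ℕ => (n : ℝ))).comp
      ((measurable_pi_apply w).comp (hη.measurable t))).mul_const _
  have hZsum : ∀ᵐ ω ∂P, HasSum (fun p => F p ω) (Z ω * U ω) := by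
    filter_upwards [hcount t] with ω hω
    have h1 := hasSum_labels (n := η t ω) (act := {p : Site S × ℕ | p.2 < η 0 ω p.1})
      (pos := fun p => X p.1 p.2 t ω) hω (f := onLattice N φ)
      (F := (finite_support_onLattice hN φ).toFinset) (fun w hw => by simpa using hw)
    have h2 := h1.mul_right (U ω)
    convert! h2 using 1
    funext p
    simp only [hF, Set.indicator_apply, Set.mem_ofPred_eq]
    split_ifs
    · rw [mul_comm]
    · rw [zero_mul, zero_mul]
  obtain ⟨hZint, hZval⟩ := integrable_of_hasSum (g := fun ω => Z ω * U ω)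
    (hZm.mul hUm).aestronglyMeasurable hFint hsum hZsum
  have hUint : Integrable U P := hmp.integrable_comp_of_integrable
    ((memLp_two_fluctuation hN ψ).integrable one_le_two)
  have hU0 : ∫ ω, U ω ∂P = 0 := by
    rw [← integral_fluctuation (S := S) (ρ := ρ) hN ψ]
    exact hcomp (measurable_fluctuation hN ψ)
  -- The deterministic centering at time `t`; it drops out because `U` has mean zero.
  set c : ℝ := ρ * ∑ v ∈ (finite_support_onLattice hN φ).toFinset, onLattice N φ v with hc
  have hprod : ∀ ω, fluctuation N ρ (η t ω) φ * fluctuation N ρ (η 0 ω) ψ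
      = (√(N : ℝ))⁻¹ * (Z ω * U ω) - (√(N : ℝ))⁻¹ * c * U ω := fun ω => by
    rw [fluctuation_eq_sub hN (η t ω)]
    ring
  simp_rw [hprod]
  refine ⟨(hZint.const_mul _).sub (hUint.const_mul _), fun v => (hX v 0).mean t φ,
    fun v => (hX v 0).abs_mean_sub_le hN t hM hφ, ?_⟩
  rw [integral_sub (hZint.const_mul _) (hUint.const_mul _), integral_const_mul, integral_const_mul,
    hU0, mul_zero, sub_zero, ← hZval.tsum_eq, hZval.summable.tsum_prod]
  have hinner : ∀ v, ∑' i, ∫ ω, F (v, i) ω ∂P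
      = (√(N : ℝ))⁻¹ * (ρ * onLattice N ψ v * (hX v 0).mean t φ) := fun v => by
    have e : ∀ i, ∫ ω, F (v, i) ω ∂P
        = (∫ ω, (if i < η 0 ω v then U ω else 0) ∂P) * (hX v 0).mean t φ := fun i => hFval (v, i)
    simp_rw [e]
    rw [tsum_mul_right, (hasSum_integral_ite_lt (hnm v) hUm (hint v)).tsum_eq, hval]
    ring
  simp_rw [hinner]
  rw [tsum_mul_left, ← mul_assoc, ← mul_inv, Real.mul_self_sqrt hN'.le]

/-- Convergence of the covariances. -/
theorem tendsto_covariance (R : Rates S) {Ω : ℕ → Type*} [∀ N, MeasurableSpace (Ω N)]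
    {P : ∀ N, Measure (Ω N)} [∀ N, IsProbabilityMeasure (P N)]
    {η : ∀ N, ℝ≥0 → Ω N → Site S → ℕ} (hη : ∀ N, 1 ≤ N → R.IsSystem N ρ (P N) (η N))
    (t : ℝ≥0) (φ ψ : TestFn S) :
    Tendsto (fun N => ∫ ω, fluctuation N ρ (η N t ω) φ * fluctuation N ρ (η N 0 ω) ψ ∂(P N))
      atTop (𝓝 (ρ * pairing (fun σ x => R.expA t φ.toCZero σ x) (fun σ x => ψ σ x))) := by
  obtain ⟨M, hM, hφ⟩ := exists_db 6 φ
  set T := R.expA t φ.toCZero with hT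
  set K := R.eulerConst t * M with hK
  have hK0 : 0 ≤ K := mul_nonneg (R.eulerConst_nonneg t) hM
  have h1 : Tendsto (fun N : ℕ => (N : ℝ)⁻¹ * ∑' v : Site S, T v.2 ((v.1 : ℝ) / N)
      * ψ v.2 ((v.1 : ℝ) / N)) atTop (𝓝 (∑ σ, ∫ x, T σ x * ψ σ x)) :=
    tendsto_riemannSum_site (f := fun σ x => T σ x * ψ σ x)
      (fun σ => (map_continuous (T σ)).mul (ψ σ).continuous)
      fun σ => (ψ σ).hasCompactSupport.mul_left
  have h2 : Tendsto (fun N : ℕ => (N : ℝ)⁻¹ * ∑' v : Site S, |ψ v.2 ((v.1 : ℝ) / N)|) atTop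
      (𝓝 (∑ σ, ∫ x, |ψ σ x|)) :=
    tendsto_riemannSum_site (f := fun σ x => |ψ σ x|) (fun σ => (ψ σ).continuous.abs)
      fun σ => (ψ σ).hasCompactSupport.norm
  have h3 : Tendsto (fun N : ℕ => ρ * (K * (3 / (N : ℝ)))
      * ((N : ℝ)⁻¹ * ∑' v : Site S, |ψ v.2 ((v.1 : ℝ) / N)|)) atTop (𝓝 0) := by
    have h4 := ((tendsto_const_div_atTop_nhds_zero_nat (3 : ℝ)).const_mul K).const_mul (ρ : ℝ)
    simpa using h4.mul h2
  have h5 := h1.const_mul (ρ : ℝ)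
  -- Replacing the particle means by `e^{tA} φ` costs at most `3K/N` per site, weighted by the
  -- convergent Riemann sum of `|ψ|`.
  refine tendsto_of_tendsto_of_dist h5 (squeeze_zero' (Eventually.of_forall fun _ => dist_nonneg)
    ?_ h3)
  filter_upwards [eventually_ge_atTop 1] with N hN
  obtain ⟨-, q, hq, hqv⟩ := (hη N hN).covariance hN t φ ψ hM hφ
  have hfin : (Function.support fun v : Site S => ψ v.2 ((v.1 : ℝ) / N)).Finite :=
    finite_support_onLattice hN ψ
  have hsm : ∀ g : Site S → ℝ, Summable fun v : Site S => g v * ψ v.2 ((v.1 : ℝ) / N) :=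
    fun g => summable_of_hasFiniteSupport (hfin.subset (Function.support_mul_subset_right _ _))
  have habs : Summable fun v : Site S => |ψ v.2 ((v.1 : ℝ) / N)| :=
    summable_of_hasFiniteSupport (hfin.subset fun v hv h0 => hv (by simp [h0]))
  rw [hqv, Real.dist_eq]
  have e1 : ∀ v : Site S, ρ * onLattice N ψ v * q v = ρ * (q v * ψ v.2 ((v.1 : ℝ) / N)) :=
    fun v => by rw [onLattice]; ring
  simp_rw [e1]
  rw [tsum_mul_left, mul_left_comm, ← mul_sub, ← mul_sub,
    ← (hsm fun v => T v.2 ((v.1 : ℝ) / N)).tsum_sub (hsm q), abs_mul, abs_mul,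
    abs_of_nonneg ρ.coe_nonneg, abs_of_nonneg (by positivity : 0 ≤ (N : ℝ)⁻¹)]
  have e2 : |∑' v : Site S, (T v.2 ((v.1 : ℝ) / N) * ψ v.2 ((v.1 : ℝ) / N)
      - q v * ψ v.2 ((v.1 : ℝ) / N))| ≤ K * (3 / N) * ∑' v : Site S, |ψ v.2 ((v.1 : ℝ) / N)| := by
    rw [← tsum_mul_left, ← Real.norm_eq_abs]
    refine tsum_of_norm_bounded (habs.mul_left (K * (3 / (N : ℝ)))).hasSum fun v => ?_
    rw [← sub_mul, norm_mul, Real.norm_eq_abs, Real.norm_eq_abs, abs_sub_comm]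
    exact mul_le_mul_of_nonneg_right (hq v) (abs_nonneg _)
  calc _ ≤ (N : ℝ)⁻¹ * (ρ * (K * (3 / N) * ∑' v : Site S, |ψ v.2 ((v.1 : ℝ) / N)|)) := by gcongr
    _ = _ := by ring

/-! ### The Gaussian limit of the initial fluctuation field -/

theorem charFun_centered (s t : ℝ) (v : Site S) :
    charFun ((poissonProduct S ρ).map fun η : Site S → ℕ => s * ((η v : ℝ) - ρ)) t
      = Complex.exp (ρ * (Complex.exp ((t * s : ℝ) * Complex.I) - 1
          - (t * s : ℝ) * Complex.I)) := by
  have hm : Measurable fun n : ℕ => s * ((n : ℝ) - ρ) := .of_discrete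
  have e1 : (poissonProduct S ρ).map (fun η : Site S → ℕ => s * ((η v : ℝ) - ρ))
      = (poissonMeasure ρ).map fun n : ℕ => s * ((n : ℝ) - ρ) := by
    rw [← (measurePreserving_eval (S := S) (ρ := ρ) v).map_eq,
      Measure.map_map hm (measurable_pi_apply v)]
    rfl
  have e2 := charFun_map_cast_poissonMeasure ρ (t * s)
  rw [charFun_apply_real, integral_map .of_discrete (by fun_prop)] at e2
  rw [e1, charFun_apply_real, integral_map hm.aemeasurable (by fun_prop)]
  have e3 : ∀ n : ℕ, Complex.exp (t * ((s * ((n : ℝ) - ρ) : ℝ) : ℂ) * Complex.I)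
      = Complex.exp ((t * s : ℝ) * (n : ℝ) * Complex.I)
        * Complex.exp (-(ρ * ((t * s : ℝ) * Complex.I))) := fun n => by
    rw [← Complex.exp_add]
    congr 1
    push_cast
    ring
  simp_rw [e3]
  rw [integral_mul_const, e2, ← Complex.exp_add]
  congr 1
  ring

theorem charFun_fluctuation {N : ℕ} (hN : 1 ≤ N) (φ : TestFn S) (t : ℝ) :
    charFun ((poissonProduct S ρ).map fun η : Site S → ℕ => fluctuation N ρ η φ) t
      = Complex.exp (∑' v : Site S,
          ρ * (Complex.exp ((t * ((√(N : ℝ))⁻¹ * onLattice N φ v) : ℝ) * Complex.I) - 1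
            - (t * ((√(N : ℝ))⁻¹ * onLattice N φ v) : ℝ) * Complex.I)) := by
  have e : ∀ η : Site S → ℕ, fluctuation N ρ η φ
      = ∑ v ∈ (finite_support_onLattice hN φ).toFinset,
        (√(N : ℝ))⁻¹ * onLattice N φ v * ((η v : ℝ) - ρ) := fun η => by
    rw [fluctuation_eq_sum η hN, Finset.mul_sum]
    exact Finset.sum_congr rfl fun v _ => by ring
  have hm : ∀ v : Site S, Measurable fun n : ℕ =>
      (√(N : ℝ))⁻¹ * onLattice N φ v * ((n : ℝ) - ρ) := fun v => .of_discrete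
  simp_rw [e]
  have hind : iIndepFun (fun (v : Site S) (η : Site S → ℕ) =>
      (√(N : ℝ))⁻¹ * onLattice N φ v * ((η v : ℝ) - ρ)) (poissonProduct S ρ) :=
    iIndepFun_eval.comp _ hm
  have hmap := iIndepFun.charFun_map_fun_finsetSum_eq_prod
    (X := fun (v : Site S) (η : Site S → ℕ) => (√(N : ℝ))⁻¹ * onLattice N φ v * ((η v : ℝ) - ρ))
    (s := (finite_support_onLattice hN φ).toFinset)
    (fun v _ => ((hm v).comp (measurable_pi_apply v)).aemeasurable) (hind.restrict _)
  rw [hmap, Finset.prod_apply, tsum_eq_sum (s := (finite_support_onLattice hN φ).toFinset)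
    fun v hv => by
      have : onLattice N φ v = 0 := by simpa using hv
      simp [this], Complex.exp_sum]
  exact Finset.prod_congr rfl fun v _ => charFun_centered _ t v

theorem norm_exp_taylor_two_le {u : ℝ} (hu : |u| ≤ 1) :
    ‖Complex.exp (u * Complex.I) - 1 - u * Complex.I + (u : ℂ) ^ 2 / 2‖ ≤ |u| ^ 3 := by
  have hn : ‖(u : ℂ) * Complex.I‖ = |u| := by simp
  have h := Complex.exp_bound (x := u * Complex.I) (n := 3) (by rwa [hn]) (by norm_num)
  rw [hn] at h
  have e : Complex.exp (u * Complex.I) - 1 - u * Complex.I + (u : ℂ) ^ 2 / 2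
      = Complex.exp (u * Complex.I)
        - ∑ m ∈ Finset.range 3, ((u : ℂ) * Complex.I) ^ m / m.factorial := by
    simp only [Finset.sum_range_succ, Finset.sum_range_zero, mul_pow, Complex.I_sq]
    norm_num [Nat.factorial]
    ring
  rw [e]
  refine h.trans (mul_le_of_le_one_right (by positivity) ?_)
  norm_num [Nat.factorial]

/-- In the exponent `e^{iu} - 1 - iu = -u²/2 + O(|u|³)` with `u = O(N^{-1/2})`. The quadratic terms
form a Riemann sum for the squared norm of `φ`; the cubic ones are at most `max |u|` times the sum
of the `u²` and vanish in the limit. -/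
theorem tendsto_charFun_fluctuation (φ : TestFn S) (t : ℝ) :
    Tendsto (fun N : ℕ =>
        charFun ((poissonProduct S ρ).map fun η : Site S → ℕ => fluctuation N ρ η φ) t)
      atTop (𝓝 (Complex.exp
        (-((ρ * pairing (fun σ x => φ σ x) (fun σ x => φ σ x) * t ^ 2 / 2 : ℝ) : ℂ)))) := by
  obtain ⟨C, hC, hφ⟩ := exists_wb φ
  have hφC : ∀ (N : ℕ) v, |onLattice N φ v| ≤ C := fun N v => hφ.abs_le hC _ _
  have hsq : Tendsto (fun N : ℕ => (N : ℝ)⁻¹ * ∑' v : Site S, onLattice N φ v ^ 2) atTop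
      (𝓝 (∑ σ, ∫ x, φ σ x ^ 2)) :=
    tendsto_riemannSum_site (f := fun σ x => φ σ x ^ 2) (fun σ => (φ σ).continuous.pow 2)
      fun σ => (φ σ).hasCompactSupport.comp_left (g := fun y : ℝ => y ^ 2) (by simp)
  have hs0 : Tendsto (fun N : ℕ => (√(N : ℝ))⁻¹) atTop (𝓝 0) :=
    tendsto_inv_atTop_zero.comp (Real.tendsto_sqrt_atTop.comp tendsto_natCast_atTop_atTop)
  have hsmall : Tendsto (fun N : ℕ => |t| * ((√(N : ℝ))⁻¹ * C)) atTop (𝓝 0) := by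
    simpa using (hs0.mul_const C).const_mul |t|
  have hpair : pairing (fun σ x => φ σ x) (fun σ x => φ σ x) = ∑ σ, ∫ x, φ σ x ^ 2 := by
    simp only [pairing, sq]
  have hmain : Tendsto (fun N : ℕ => -((ρ * ((N : ℝ)⁻¹ * ∑' v : Site S, onLattice N φ v ^ 2)
      * t ^ 2 / 2 : ℝ) : ℂ)) atTop
      (𝓝 (-((ρ * pairing (fun σ x => φ σ x) (fun σ x => φ σ x) * t ^ 2 / 2 : ℝ) : ℂ))) := by
    rw [hpair]
    exact (Complex.continuous_ofReal.tendsto _).comp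
      (((hsq.const_mul (ρ : ℝ)).mul_const (t ^ 2)).div_const 2) |>.neg
  have hrem : Tendsto (fun N : ℕ => ρ * (|t| * ((√(N : ℝ))⁻¹ * C))
      * (((N : ℝ)⁻¹ * ∑' v : Site S, onLattice N φ v ^ 2) * t ^ 2)) atTop (𝓝 0) := by
    simpa using (hsmall.const_mul (ρ : ℝ)).mul (hsq.mul_const (t ^ 2))
  have hexp : ∀ᶠ N : ℕ in atTop, ‖(∑' v : Site S,
      (ρ : ℂ) * (Complex.exp ((t * ((√(N : ℝ))⁻¹ * onLattice N φ v) : ℝ) * Complex.I) - 1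
        - (t * ((√(N : ℝ))⁻¹ * onLattice N φ v) : ℝ) * Complex.I))
      - -((ρ * ((N : ℝ)⁻¹ * ∑' v : Site S, onLattice N φ v ^ 2) * t ^ 2 / 2 : ℝ) : ℂ)‖
      ≤ ρ * (|t| * ((√(N : ℝ))⁻¹ * C))
        * (((N : ℝ)⁻¹ * ∑' v : Site S, onLattice N φ v ^ 2) * t ^ 2) := by
    filter_upwards [eventually_ge_atTop 1, hsmall.eventually (ge_mem_nhds one_pos)] with N hN hN1
    set u : Site S → ℝ := fun v => t * ((√(N : ℝ))⁻¹ * onLattice N φ v) with hu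
    have hule : ∀ v, |u v| ≤ |t| * ((√(N : ℝ))⁻¹ * C) := fun v => by
      rw [hu]
      simp only [abs_mul]
      rw [abs_of_nonneg (inv_nonneg.mpr (Real.sqrt_nonneg _))]
      gcongr
      exact hφC N v
    have husum : ((N : ℝ)⁻¹ * ∑' v : Site S, onLattice N φ v ^ 2) * t ^ 2
        = ∑ v ∈ (finite_support_onLattice hN φ).toFinset, u v ^ 2 := by
      rw [tsum_eq_sum (s := (finite_support_onLattice hN φ).toFinset), Finset.mul_sum,
        Finset.sum_mul]
      · refine Finset.sum_congr rfl fun v _ => ?_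
        simp only [hu]
        rw [mul_pow, mul_pow, inv_pow, Real.sq_sqrt (Nat.cast_nonneg _)]
        ring
      · intro v hv
        have : onLattice N φ v = 0 := by simpa using hv
        rw [this, zero_pow two_ne_zero]
    have e1 : (∑' v : Site S,
        (ρ : ℂ) * (Complex.exp ((u v : ℝ) * Complex.I) - 1 - (u v : ℝ) * Complex.I))
        - -((ρ * ((N : ℝ)⁻¹ * ∑' v : Site S, onLattice N φ v ^ 2) * t ^ 2 / 2 : ℝ) : ℂ)
        = ∑ v ∈ (finite_support_onLattice hN φ).toFinset,
          (ρ : ℂ) * (Complex.exp ((u v : ℝ) * Complex.I) - 1 - (u v : ℝ) * Complex.I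
            + (u v : ℂ) ^ 2 / 2) := by
      rw [mul_assoc (ρ : ℝ), husum, sub_neg_eq_add,
        tsum_eq_sum (s := (finite_support_onLattice hN φ).toFinset) fun v hv => by
          have : onLattice N φ v = 0 := by simpa using hv
          simp [hu, this]]
      push_cast
      rw [Finset.mul_sum, Finset.sum_div, ← Finset.sum_add_distrib]
      exact Finset.sum_congr rfl fun v _ => by ring
    rw [e1, husum, Finset.mul_sum]
    refine (norm_sum_le _ _).trans (Finset.sum_le_sum fun v _ => ?_)
    rw [norm_mul, mul_assoc]
    have hρ : ‖(ρ : ℂ)‖ = (ρ : ℝ) := by simp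
    rw [hρ]
    refine mul_le_mul_of_nonneg_left ((norm_exp_taylor_two_le ((hule v).trans hN1)).trans ?_)
      ρ.coe_nonneg
    rw [pow_succ', sq_abs]
    exact mul_le_mul_of_nonneg_right (hule v) (sq_nonneg _)
  have hlim := tendsto_of_tendsto_of_dist hmain (squeeze_zero' (Eventually.of_forall fun _ =>
    dist_nonneg) (hexp.mono fun N hN => by rwa [dist_comm, dist_eq_norm]) hrem)
  refine ((Complex.continuous_exp.tendsto _).comp hlim).congr' ?_
  filter_upwards [eventually_ge_atTop 1] with N hN
  exact (charFun_fluctuation hN φ t).symm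

/-- The initial value of the limiting field is white noise with intensity `ρ`. -/
theorem IsInitialLimit.map_eq {Ω : Type*} [MeasurableSpace Ω] {P : Measure Ω}
    [IsProbabilityMeasure P] {Y : ℝ≥0 → Ω → Distr S} (hY : IsInitialLimit ρ P Y) (φ : TestFn S) :
    P.map (fun ω => Y 0 ω φ) = gaussianReal 0
      (ρ * (pairing (fun σ x => φ σ x) (fun σ x => φ σ x)).toNNReal) := by
  have hp : 0 ≤ pairing (fun σ x => φ σ x) (fun σ x => φ σ x) :=
    Finset.sum_nonneg fun σ _ => integral_nonneg fun x => mul_self_nonneg _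
  have hT := hY φ
  have h1 := ProbabilityMeasure.tendsto_iff_tendsto_charFun.mp hT.tendsto
  have : IsProbabilityMeasure (P.map fun ω => Y 0 ω φ) :=
    Measure.isProbabilityMeasure_map hT.aemeasurable_limit
  refine Measure.ext_of_charFun (funext fun t => ?_)
  refine (tendsto_nhds_unique (h1 t) (tendsto_charFun_fluctuation φ t)).trans ?_
  rw [charFun_gaussianReal]
  congr 1
  push_cast
  rw [Real.coe_toNNReal _ hp]
  ring

theorem IsInitialLimit.memLp_two {Ω : Type*} [MeasurableSpace Ω] {P : Measure Ω}
    [IsProbabilityMeasure P] {Y : ℝ≥0 → Ω → Distr S} (hY : IsInitialLimit ρ P Y) (φ : TestFn S) :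
    MemLp (fun ω => Y 0 ω φ) 2 P := by
  have h := memLp_id_gaussianReal (μ := 0)
    (v := ρ * (pairing (fun σ x => φ σ x) (fun σ x => φ σ x)).toNNReal) 2
  rw [← hY.map_eq φ] at h
  exact (memLp_map_measure_iff h.1 (hY φ).aemeasurable_limit).mp h

theorem IsInitialLimit.integral_sq {Ω : Type*} [MeasurableSpace Ω] {P : Measure Ω}
    [IsProbabilityMeasure P] {Y : ℝ≥0 → Ω → Distr S} (hY : IsInitialLimit ρ P Y) (φ : TestFn S) :
    ∫ ω, Y 0 ω φ ^ 2 ∂P = ρ * pairing (fun σ x => φ σ x) (fun σ x => φ σ x) := by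
  have hp : 0 ≤ pairing (fun σ x => φ σ x) (fun σ x => φ σ x) :=
    Finset.sum_nonneg fun σ _ => integral_nonneg fun x => mul_self_nonneg _
  have h := variance_of_integral_eq_zero (X := id) (μ := gaussianReal 0
    (ρ * (pairing (fun σ x => φ σ x) (fun σ x => φ σ x)).toNNReal)) aemeasurable_id
    integral_id_gaussianReal
  rw [variance_id_gaussianReal, ← hY.map_eq φ,
    integral_map (hY φ).aemeasurable_limit (by fun_prop)] at h
  simp only [id] at h
  rw [← h, NNReal.coe_mul, Real.coe_toNNReal _ hp]

theorem pairing_add_self (φ ψ : TestFn S) :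
    pairing (fun σ x => (φ + ψ) σ x) (fun σ x => (φ + ψ) σ x)
      = pairing (fun σ x => φ σ x) (fun σ x => φ σ x)
        + 2 * pairing (fun σ x => φ σ x) (fun σ x => ψ σ x)
        + pairing (fun σ x => ψ σ x) (fun σ x => ψ σ x) := by
  have hint : ∀ (f g : TestFn S) σ, Integrable fun x => f σ x * g σ x := fun f g σ =>
    ((f σ).continuous.mul (g σ).continuous).integrable_of_hasCompactSupport
      (g σ).hasCompactSupport.mul_left
  simp only [pairing]
  rw [Finset.mul_sum, ← Finset.sum_add_distrib, ← Finset.sum_add_distrib]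
  refine Finset.sum_congr rfl fun σ _ => ?_
  have e : ∀ x, (φ + ψ) σ x * (φ + ψ) σ x
      = φ σ x * φ σ x + 2 * (φ σ x * ψ σ x) + ψ σ x * ψ σ x := fun x => by
    rw [show (φ + ψ) σ x = φ σ x + ψ σ x from rfl]
    ring
  have h2 : Integrable fun x => 2 * (φ σ x * ψ σ x) := (hint φ ψ σ).const_mul 2
  have h3 : Integrable fun x => φ σ x * φ σ x + 2 * (φ σ x * ψ σ x) := (hint φ φ σ).add h2
  simp_rw [e]
  rw [integral_add h3 (hint ψ ψ σ), integral_add (hint φ φ σ) h2, integral_const_mul]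

/-- The covariance of the initial value of the limiting field. -/
theorem IsInitialLimit.integral_mul {Ω : Type*} [MeasurableSpace Ω] {P : Measure Ω}
    [IsProbabilityMeasure P] {Y : ℝ≥0 → Ω → Distr S} (hY : IsInitialLimit ρ P Y)
    (φ ψ : TestFn S) :
    ∫ ω, Y 0 ω φ * Y 0 ω ψ ∂P = ρ * pairing (fun σ x => φ σ x) (fun σ x => ψ σ x) := by
  -- Polarization: the limit law is prescribed for one test function at a time, and linearity of `Y
  -- 0 ω` recovers the joint moment.
  have h := hY.integral_sq (φ + ψ)
  have e : ∀ ω, Y 0 ω (φ + ψ) ^ 2 = Y 0 ω φ ^ 2 + 2 * (Y 0 ω φ * Y 0 ω ψ) + Y 0 ω ψ ^ 2 :=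
    fun ω => by rw [map_add]; ring
  have h1 := (hY.memLp_two φ).integrable_sq
  have h2 : Integrable (fun ω => 2 * (Y 0 ω φ * Y 0 ω ψ)) P :=
    ((hY.memLp_two φ).integrable_mul (hY.memLp_two ψ)).const_mul 2
  have h3 : Integrable (fun ω => Y 0 ω φ ^ 2 + 2 * (Y 0 ω φ * Y 0 ω ψ)) P := h1.add h2
  simp_rw [e] at h
  rw [integral_add h3 (hY.memLp_two ψ).integrable_sq, integral_add h1 h2, integral_const_mul,
    hY.integral_sq, hY.integral_sq, pairing_add_self] at h
  linarith

/-! ### The covariance of stationary solutions of the SPDE -/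

theorem tendsto_pairing {f : ℕ → CZero S} {g : CZero S} (h : Tendsto f atTop (𝓝 g))
    (ψ : TestFn S) :
    Tendsto (fun n => pairing (fun σ x => f n σ x) (fun σ x => ψ σ x)) atTop
      (𝓝 (pairing (fun σ x => g σ x) (fun σ x => ψ σ x))) := by
  refine tendsto_finsetSum _ fun σ _ => ?_
  have hψ : Integrable fun x => ψ σ x :=
    (ψ σ).continuous.integrable_of_hasCompactSupport (ψ σ).hasCompactSupport
  refine tendsto_integral_filter_of_dominated_convergence (fun x => (‖g‖ + 1) * |ψ σ x|)
    (Eventually.of_forall fun n => ?_) ?_ (hψ.abs.const_mul _)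
    (Eventually.of_forall fun x => ?_)
  · exact ((map_continuous (f n σ)).mul (ψ σ).continuous).aestronglyMeasurable
  · filter_upwards [h.norm.eventually (gt_mem_nhds (lt_add_one ‖g‖))] with n hn
    refine Eventually.of_forall fun x => ?_
    rw [norm_mul]
    exact mul_le_mul_of_nonneg_right ((CZero.abs_apply_le (f n) σ x).trans hn.le) (abs_nonneg _)
  · exact (((CZero.continuous_apply σ x).tendsto g).comp h).mul_const _

/-- Since `wt² ≤ wt` and `wt` has integral `π`, the weighted norm controls the norm in `L²`, and
hence the variance of the stationary field. -/
theorem WB.pairing_self_le {M : ℝ} {φ : TestFn S} (hM : 0 ≤ M) (hφ : WB M φ) :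
    pairing (fun σ x => φ σ x) (fun σ x => φ σ x) ≤ (S.card * Real.pi) * M ^ 2 := by
  have h : ∀ σ, ∫ x, φ σ x * φ σ x ≤ Real.pi * M ^ 2 := fun σ => by
    rw [← integral_univ_inv_one_add_sq, ← integral_mul_const]
    refine integral_mono (((φ σ).continuous.mul (φ σ).continuous).integrable_of_hasCompactSupport
      (φ σ).hasCompactSupport.mul_left) (integrable_inv_one_add_sq.mul_const _) fun x => ?_
    change φ σ x * φ σ x ≤ wt x * M ^ 2
    have h1 := hφ σ x
    have h2 := wt_pos x
    have h3 := wt_le_one x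
    calc φ σ x * φ σ x = |φ σ x| * |φ σ x| := (abs_mul_abs_self _).symm
      _ ≤ (M * wt x) * (M * 1) := by gcongr; exact h1.trans (by gcongr)
      _ = wt x * M ^ 2 := by ring
  refine (Finset.sum_le_sum fun σ _ => h σ).trans (le_of_eq ?_)
  rw [Finset.sum_const, Finset.card_univ, Fintype.card_coe, nsmul_eq_mul, mul_assoc]

theorem WB.eq_zero {φ : TestFn S} (h : WB 0 φ) : φ = 0 := by
  funext σ
  refine DFunLike.ext _ _ fun x => ?_
  have := h σ x
  rw [zero_mul] at this
  exact abs_nonpos_iff.mp this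

theorem Rates.driftPart_zero (R : Rates S) {Ω : Type*} (Y : ℝ≥0 → Ω → Distr S) (φ : TestFn S)
    (ω : Ω) : R.driftPart Y φ 0 ω = 0 := by
  simp [Rates.driftPart]

section SPDE

variable {R : Rates S} {Ω : Type*} [MeasurableSpace Ω] {P : Measure Ω} {Y : ℝ≥0 → Ω → Distr S}

theorem IsStationary.identDistrib (hs : IsStationary P Y) (t : ℝ≥0) (φ : TestFn S) :
    IdentDistrib (fun ω => Y t ω φ) (fun ω => Y 0 ω φ) P P := by
  have h := (hs t).comp (u := fun x : ℝ≥0 × TestFn S → ℝ => x (0, φ)) (measurable_pi_apply _)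
  simpa [Function.comp_def] using h

theorem Rates.SolvesSPDE.measurable_apply (hY : R.SolvesSPDE ρ P Y) (t : ℝ≥0) (φ : TestFn S) :
    Measurable fun ω => Y t ω φ := (measurable_pi_apply φ).comp (hY.measurable t)

/-- `Y 0 ω ψ` is measurable at time zero and can be pulled out of the conditional expectation, where
the martingale takes its initial value 0. -/
theorem Rates.SolvesSPDE.integral_driftPart_mul [IsProbabilityMeasure P]
    (hY : R.SolvesSPDE ρ P Y) (t : ℝ≥0) (φ ψ : TestFn S)
    (hint : Integrable (fun ω => R.driftPart Y φ t ω * Y 0 ω ψ) P) :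
    ∫ ω, R.driftPart Y φ t ω * Y 0 ω ψ ∂P = 0 := by
  set ℱ := naturalFiltration (fun t ω (φ : TestFn S) => Y t ω φ) hY.measurable with hℱ
  have hm : Measurable[ℱ 0] fun ω => Y 0 ω ψ := by
    have h1 : Measurable[MeasurableSpace.comap (fun ω (φ : TestFn S) => Y 0 ω φ) inferInstance]
        fun ω => Y 0 ω ψ := (measurable_pi_apply ψ).comp (comap_measurable _)
    exact h1.mono (le_iSup₂_of_le (f := fun s (_ : s ≤ (0 : ℝ≥0)) => MeasurableSpace.comap
      (fun ω (φ : TestFn S) => Y s ω φ) inferInstance) 0 le_rfl le_rfl) le_rfl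
  have h2 := condExp_mul_of_stronglyMeasurable_right (m := ℱ 0) (μ := P) hm.stronglyMeasurable hint
    ((hY.martingale_drift φ).integrable t)
  have h3 := (hY.martingale_drift φ).condExp_ae_eq (zero_le (a := t))
  have h4 : P[fun ω => R.driftPart Y φ t ω * Y 0 ω ψ | ℱ 0] =ᵐ[P] 0 := by
    refine h2.trans ?_
    filter_upwards [h3] with ω hω
    rw [Pi.mul_apply, hω, R.driftPart_zero, zero_mul, Pi.zero_apply]
  rw [← integral_condExp (ℱ.le 0), integral_congr_ae h4]
  simp

variable [IsProbabilityMeasure P]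

theorem memLp_two_of_stationary (hs : IsStationary P Y) (hi : IsInitialLimit ρ P Y) (t : ℝ≥0)
    (φ : TestFn S) : MemLp (fun ω => Y t ω φ) 2 P :=
  (hs.identDistrib t φ).memLp_iff.mpr (hi.memLp_two φ)

theorem integral_sq_of_stationary (hs : IsStationary P Y) (hi : IsInitialLimit ρ P Y) (t : ℝ≥0)
    (φ : TestFn S) :
    ∫ ω, Y t ω φ ^ 2 ∂P = ρ * pairing (fun σ x => φ σ x) (fun σ x => φ σ x) := by
  rw [← hi.integral_sq φ]
  exact ((hs.identDistrib t φ).comp (u := fun x : ℝ => x ^ 2) (by fun_prop)).integral_eq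

theorem integrable_mul_of_stationary (hs : IsStationary P Y) (hi : IsInitialLimit ρ P Y) (t : ℝ≥0)
    (φ ψ : TestFn S) : Integrable (fun ω => Y t ω φ * Y 0 ω ψ) P :=
  (memLp_two_of_stationary hs hi t φ).integrable_mul (hi.memLp_two ψ)

/-- The inequality `2ab ≤ a²/M + M b²` is balanced with `M` so that the bound is linear in `M`, as
`Evolution` requires; the case `M = 0` is separate. -/
theorem integral_abs_mul_le_of_stationary (hs : IsStationary P Y) (hi : IsInitialLimit ρ P Y)
    (t : ℝ≥0) {φ : TestFn S} (ψ : TestFn S) {M : ℝ} (hM : 0 ≤ M) (hφ : WB M φ) :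
    ∫ ω, |Y t ω φ * Y 0 ω ψ| ∂P ≤ ((ρ * (S.card * Real.pi)
      + ρ * pairing (fun σ x => ψ σ x) (fun σ x => ψ σ x)) / 2) * M := by
  rcases hM.eq_or_lt with rfl | hM'
  · simp [hφ.eq_zero]
  have h1 := (memLp_two_of_stationary hs hi t φ).integrable_sq
  have h2 := (hi.memLp_two ψ).integrable_sq
  calc ∫ ω, |Y t ω φ * Y 0 ω ψ| ∂P
      ≤ ∫ ω, ((2 * M)⁻¹ * Y t ω φ ^ 2 + M / 2 * Y 0 ω ψ ^ 2) ∂P := by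
        refine integral_mono (integrable_mul_of_stationary hs hi t φ ψ).abs
          ((h1.const_mul _).add (h2.const_mul _)) fun ω => ?_
        have e : (2 * M)⁻¹ * Y t ω φ ^ 2 + M / 2 * Y 0 ω ψ ^ 2 - |Y t ω φ| * |Y 0 ω ψ|
            = (2 * M)⁻¹ * (|Y t ω φ| - M * |Y 0 ω ψ|) ^ 2 := by
          rw [← sq_abs (Y t ω φ), ← sq_abs (Y 0 ω ψ)]
          field_simp
          ring
        have : 0 ≤ (2 * M)⁻¹ * (|Y t ω φ| - M * |Y 0 ω ψ|) ^ 2 := by positivity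
        simp only [abs_mul]
        linarith
    _ = (2 * M)⁻¹ * (ρ * pairing (fun σ x => φ σ x) (fun σ x => φ σ x))
        + M / 2 * (ρ * pairing (fun σ x => ψ σ x) (fun σ x => ψ σ x)) := by
        rw [integral_add (h1.const_mul _) (h2.const_mul _), integral_const_mul,
          integral_const_mul, integral_sq_of_stationary hs hi, hi.integral_sq]
    _ ≤ (2 * M)⁻¹ * (ρ * ((S.card * Real.pi) * M ^ 2))
        + M / 2 * (ρ * pairing (fun σ x => ψ σ x) (fun σ x => ψ σ x)) := by
        gcongr
        exact hφ.pairing_self_le hM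
    _ = _ := by
        field_simp

/-- The covariance `E[Y_t(φ) Y_0(ψ)]` as a functional of `φ`. -/
def covFunctional (hs : IsStationary P Y) (hi : IsInitialLimit ρ P Y) (ψ : TestFn S) (t : ℝ≥0) :
    TestFn S →ₗ[ℝ] ℝ where
  toFun φ := ∫ ω, Y t ω φ * Y 0 ω ψ ∂P
  map_add' φ φ' := by
    rw [← integral_add (integrable_mul_of_stationary hs hi t φ ψ)
      (integrable_mul_of_stationary hs hi t φ' ψ)]
    simp only [map_add, add_mul]
  map_smul' a φ := by
    simp only [map_smul, smul_eq_mul, mul_assoc, integral_const_mul, RingHom.id_apply]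

theorem covFunctional_apply (hs : IsStationary P Y) (hi : IsInitialLimit ρ P Y) (φ ψ : TestFn S)
    (t : ℝ≥0) : covFunctional hs hi ψ t φ = ∫ ω, Y t ω φ * Y 0 ω ψ ∂P := rfl

/-- The drift martingale times `Y 0 ω ψ` has mean zero, which after Fubini is the integral equation
of the covariance; stationarity keeps the weighted bound uniform in time. -/
theorem Rates.SolvesSPDE.evolution (hY : R.SolvesSPDE ρ P Y) (hs : IsStationary P Y)
    (hi : IsInitialLimit ρ P Y) (ψ : TestFn S) :
    Evolution R.A (covFunctional hs hi ψ) ((ρ * (S.card * Real.pi)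
      + ρ * pairing (fun σ x => ψ σ x) (fun σ x => ψ σ x)) / 2) := by
  have hp : 0 ≤ pairing (fun σ x => ψ σ x) (fun σ x => ψ σ x) :=
    Finset.sum_nonneg fun σ _ => integral_nonneg fun x => mul_self_nonneg _
  refine Evolution.of_integral (by positivity) (fun s M φ hM hφ => ?_) (fun φ => ?_) fun t φ => ?_
  · exact (abs_integral_le_integral_abs (f := fun ω => Y s ω φ * Y 0 ω ψ)).trans
      (integral_abs_mul_le_of_stationary hs hi s ψ hM hφ)
  · exact measurable_integral_mul (fun t => hY.measurable_apply t φ)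
      (fun ω t => (hY.cadlag ω φ t).1) (hY.measurable_apply 0 ψ)
  · obtain ⟨M, hM, hφ⟩ := exists_wb (R.A φ)
    obtain ⟨h1, h2⟩ := integral_intervalIntegral_mul (fun t => hY.measurable_apply t (R.A φ))
      (fun ω t => (hY.cadlag ω (R.A φ) t).1) (hY.measurable_apply 0 ψ)
      (fun s => integrable_mul_of_stationary hs hi s (R.A φ) ψ)
      (fun s => integral_abs_mul_le_of_stationary hs hi s ψ hM hφ) t
    have h3 := integrable_mul_of_stationary hs hi t φ ψ
    have h4 := integrable_mul_of_stationary hs hi 0 φ ψ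
    have h5 : Integrable (fun ω => Y t ω φ * Y 0 ω ψ - Y 0 ω φ * Y 0 ω ψ) P := h3.sub h4
    have e : ∀ ω, R.driftPart Y φ t ω * Y 0 ω ψ = Y t ω φ * Y 0 ω ψ - Y 0 ω φ * Y 0 ω ψ
        - (∫ s in (0 : ℝ)..t, Y s.toNNReal ω (R.A φ)) * Y 0 ω ψ := fun ω => by
      rw [Rates.driftPart]
      ring
    have h6 := hY.integral_driftPart_mul t φ ψ (by simp_rw [e]; exact h5.sub h1)
    simp_rw [e] at h6
    rw [integral_sub h5 h1, integral_sub h3 h4, h2] at h6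
    simp only [covFunctional_apply]
    linarith

/-- The white-noise covariance at time zero is evaluated at the Euler approximations, which are
legitimate test functions. As `n → ∞` these values tend both to the covariance at time `t` and to
`ρ` times the pairing of `e^{tA} φ` with `ψ`. -/
theorem Rates.SolvesSPDE.integral_mul (hY : R.SolvesSPDE ρ P Y) (hs : IsStationary P Y)
    (hi : IsInitialLimit ρ P Y) (t : ℝ≥0) (φ ψ : TestFn S) :
    ∫ ω, Y t ω φ * Y 0 ω ψ ∂P
      = ρ * pairing (fun σ x => R.expA t φ.toCZero σ x) (fun σ x => ψ σ x) := by
  obtain ⟨M, hM, hφ⟩ := exists_db 6 φ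
  have hp : 0 ≤ pairing (fun σ x => ψ σ x) (fun σ x => ψ σ x) :=
    Finset.sum_nonneg fun σ _ => integral_nonneg fun x => mul_self_nonneg _
  set B : ℝ := (ρ * (S.card * Real.pi)
      + ρ * pairing (fun σ x => ψ σ x) (fun σ x => ψ σ x)) / 2 with hB
  have hB0 : 0 ≤ B := by positivity
  have h1 : Tendsto (fun n => covFunctional hs hi ψ 0 (R.eulerApprox n t φ)) atTop
      (𝓝 (ρ * pairing (fun σ x => R.expA t φ.toCZero σ x) (fun σ x => ψ σ x))) := by
    simp only [covFunctional_apply, hi.integral_mul]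
    exact (tendsto_pairing (R.isSemigroupOfA_expA.tendsto_eulerApprox t φ) ψ).const_mul _
  have h2 : Tendsto (fun n : ℕ => B * (R.eulerConst t * M) * (1 / (n : ℝ) + 0)) atTop (𝓝 0) := by
    simpa using tendsto_one_div_atTop_nhds_zero_nat.const_mul (B * (R.eulerConst t * M))
  have h3 : Tendsto (fun n => covFunctional hs hi ψ 0 (R.eulerApprox n t φ)) atTop
      (𝓝 (covFunctional hs hi ψ t φ)) := by
    rw [tendsto_iff_norm_sub_tendsto_zero]
    refine squeeze_zero' (Eventually.of_forall fun _ => norm_nonneg _) ?_ h2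
    filter_upwards [eventually_ge_atTop 1] with n hn
    rw [norm_sub_rev]
    exact (hY.evolution hs hi ψ).norm_sub_eulerApprox_le hB0 le_rfl R.isApprox_A hn t hM hφ
  exact tendsto_nhds_unique h3 h1

end SPDE

end RunAndTumble

end


open RunAndTumble

theorem proposition3p2 {S : Finset ℤ} (R : Rates S) (ρ : ℝ≥0) :
    (∃! T, R.IsSemigroupOfA T) ∧
    ∀ (t : ℝ≥0) (φ ψ : TestFn S),
      (∀ (Ω : ℕ → Type*) [∀ N, MeasurableSpace (Ω N)] (P : ∀ N, Measure (Ω N))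
          [∀ N, IsProbabilityMeasure (P N)] (η : ∀ N, ℝ≥0 → Ω N → Site S → ℕ),
        (∀ N, 1 ≤ N → R.IsSystem N ρ (P N) (η N)) →
          (∀ N, 1 ≤ N →
            Integrable (fun ω => fluctuation N ρ (η N t ω) φ * fluctuation N ρ (η N 0 ω) ψ)
              (P N)) ∧
          Tendsto
            (fun N => ∫ ω, fluctuation N ρ (η N t ω) φ * fluctuation N ρ (η N 0 ω) ψ ∂(P N))
            atTop
            (𝓝 (ρ * pairing (fun σ x => R.expA t φ.toCZero σ x) (fun σ x => ψ σ x)))) ∧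
      (∀ (Ω : Type*) [MeasurableSpace Ω] (P : Measure Ω) [IsProbabilityMeasure P]
          (Y : ℝ≥0 → Ω → Distr S),
        R.SolvesSPDE ρ P Y → IsStationary P Y → IsInitialLimit ρ P Y →
          Integrable (fun ω => Y t ω φ * Y 0 ω ψ) P ∧
          ∫ ω, Y t ω φ * Y 0 ω ψ ∂P
            = ρ * pairing (fun σ x => R.expA t φ.toCZero σ x) (fun σ x => ψ σ x)) := by
  refine ⟨R.existsUnique_semigroup, fun t φ ψ => ⟨fun Ω _ P _ η hη => ⟨fun N hN => ?_,
    tendsto_covariance R hη t φ ψ⟩, fun Ω _ P _ Y hY hs hi =>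
    ⟨integrable_mul_of_stationary hs hi t φ ψ, hY.integral_mul hs hi t φ ψ⟩⟩⟩
  obtain ⟨M, hM, hφ⟩ := exists_db 6 φ
  exact ((hη N hN).covariance hN t φ ψ hM hφ).1
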